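/- For a positive integer $n$, let $\mathcal{F}^0_{4n^2}$ be the (finite) set of binary quartic forms $f(x,y)=ax^4+cy^4$ with $a,c\in\mathbb{Z}$, $ac=4n^2$ and $0\le \operatorname{ord}_p a\le 1$ for every prime $p$. For a field $K\supseteq\mathbb{Q}$, say that the curve $C_f\colon z^2=f(x,y)$ has a $K$-point if there are $x,y,z\in K$ with $(x,y)\neq(0,0)$ and $z^2=f(x,y)$. Call $f$ soluble if $C_f$ has a $\mathbb{Q}$-point, and locally soluble if $C_f$ has an $\mathbb{R}$-point and a $\mathbb{Q}_p$-point for every prime $p$. Let $\mathcal{F}^{0,\mathrm{sol}}_{4n^2}$ and $\mathcal{F}^{0,\mathrm{ls}}_{4n^2}$ be the sets of soluble and of locally soluble forms in $\mathcal{F}^0_{4n^2}$, respectively. Then, with $X$ running through the real numbers, $$\lim_{X\to\infty}\frac{\displaystyle\sum_{\substack{0<n<X\\ n\ \text{squarefree}}}\#\mathcal{F}^{0,\mathrm{sol}}_{4n^2}}{\displaystyle\sum_{\substack{0<n<X\\ n\ \text{squarefree}}}\#\mathcal{F}^{0,\mathrm{ls}}_{4n^2}}=1.$$ -/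

import Mathlib

/-- The integral binary quartic form `a x⁴ + B x² y² + c y⁴`, given by its coefficients. -/
@[ext]
structure EvenQuartic where
  a : ℤ
  B : ℤ
  c : ℤ

namespace EvenQuartic

/-- The value `a x⁴ + B x² y² + c y⁴` at a point with coordinates in a field `K`. -/
def eval {K : Type*} [Field K] (f : EvenQuartic) (x y : K) : K :=
  (f.a : K) * x ^ 4 + (f.B : K) * x ^ 2 * y ^ 2 + (f.c : K) * y ^ 4

/-- `C_f(K) ≠ ∅`, where `C_f : z² = f(x, y)` lives in the weighted projective plane with weights
`(1, 1, 2)` for `(x, y, z)`. A point of `C_f` over `K` is the class of a solution with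
`(x, y) ≠ (0, 0)`; the points with `y = 0` are the points at infinity of the affine curve
`z² = f(x, 1)`. -/
def HasPoint (f : EvenQuartic) (K : Type*) [Field K] : Prop :=
  ∃ x y z : K, (x ≠ 0 ∨ y ≠ 0) ∧ z ^ 2 = f.eval x y

/-- `f` is soluble: `C_f` has a rational point. -/
def Soluble (f : EvenQuartic) : Prop :=
  f.HasPoint ℚ

/-- `f` is locally soluble: `C_f` has a point over `ℝ` and over `ℚ_p` for every prime `p`. -/
def LocallySoluble (f : EvenQuartic) : Prop :=
  f.HasPoint ℝ ∧ ∀ (p : ℕ) [Fact p.Prime], f.HasPoint ℚ_[p]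

/-- The set `W^B_M(ℤ)` of forms `a x⁴ + B x² y² + c y⁴` with `a, c ∈ ℤ` and `a c = M`. -/
def W (B M : ℤ) : Set EvenQuartic :=
  {f | f.B = B ∧ f.a * f.c = M}

/-- The set `𝓕^B_M` of the forms in `W^B_M(ℤ)` with `0 ≤ ord_p a ≤ 1` for all primes `p`
(the lower bound is automatic, as `a` is an integer). -/
def F (B M : ℤ) : Set EvenQuartic :=
  {f | f ∈ W B M ∧ ∀ p : ℕ, p.Prime → emultiplicity (p : ℤ) f.a ≤ 1}

/-- The soluble forms in `𝓕^B_M`. -/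
def Fsol (B M : ℤ) : Set EvenQuartic :=
  {f | f ∈ F B M ∧ f.Soluble}

/-- The locally soluble forms in `𝓕^B_M`. -/
def Fls (B M : ℤ) : Set EvenQuartic :=
  {f | f ∈ F B M ∧ f.LocallySoluble}

/-- For `M ≠ 0` the set `𝓕^B_M` is finite, so that its subsets are honestly counted by
`Set.ncard`. -/
theorem F_finite (B : ℤ) {M : ℤ} (hM : M ≠ 0) : (F B M).Finite := by
  refine Set.Finite.of_finite_image (f := fun f => (f.a, f.c)) ?_ ?_
  · refine (((Set.finite_Icc (-|M|) |M|).prod (Set.finite_Icc (-|M|) |M|))).subset ?_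
    rintro _ ⟨f, ⟨⟨-, h⟩, -⟩, rfl⟩
    have ha : |f.a| ≤ |M| :=
      Int.le_of_dvd (abs_pos.mpr hM) ((abs_dvd_abs _ _).mpr ⟨f.c, h.symm⟩)
    have hc : |f.c| ≤ |M| :=
      Int.le_of_dvd (abs_pos.mpr hM) ((abs_dvd_abs _ _).mpr ⟨f.a, by rw [← h, mul_comm]⟩)
    exact ⟨abs_le.mp ha, abs_le.mp hc⟩
  · rintro f ⟨⟨hf, -⟩, -⟩ g ⟨⟨hg, -⟩, -⟩ h
    simp only [Prod.mk.injEq] at h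
    exact EvenQuartic.ext h.1 (hf.trans hg.symm) h.2

end EvenQuartic

/-- The squarefree integers `n` with `0 < n < X`. -/
noncomputable def sqfBelow (X : ℝ) : Finset ℕ :=
  {n ∈ Finset.range ⌈X⌉₊ | 0 < n ∧ Squarefree n}

/-- `sqfBelow X` has the members that it should have. -/
theorem mem_sqfBelow {X : ℝ} {n : ℕ} : n ∈ sqfBelow X ↔ 0 < n ∧ (n : ℝ) < X ∧ Squarefree n := by
  simp only [sqfBelow, Finset.mem_filter, Finset.mem_range, Nat.lt_ceil]
  tauto

/-!
The form `x⁴ + 4 n² y⁴` is always soluble, so each `n` contributes at least `1` to both sums, and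
soluble forms are locally soluble. As the squarefree `n` have positive lower density
(`le_card_squarefree`), it is enough that a typical squarefree `n` has no other locally soluble
form: the number of the others, summed over `n ≤ N`, has to be `o(N)`
(`exists_sum_admissibleCount_le`).

**Local conditions.** If `n` is squarefree and `f = (α, 0, γ)` is locally soluble, then `α > 0` by
the real place, and `α = κ a` with `κ ∈ {1, 2}`, `a` odd and `n = a b`. At an odd prime `p ∣ a`
both coefficients of `f` are divisible by `p` exactly once, and a `p`-adic point forces
`p ≡ 1 mod 4` and `(κ b / p) = 1`; at an odd prime `p ∣ b` it forces `(κ a / p) = 1`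
(`exists_admissible_of_mem_Fls`). With `c` the smaller and `d` the larger of `a` and `b`, the pair
`(c, d)` is then linked: each odd prime dividing one entry sees `κ` times the other as a square,
and the primes dividing `a` are `1` mod `4`. It remains to count the linked pairs with `c d ≤ N`.

**Bounded smaller entry.** For fixed `c` the larger entry avoids all primes in some residue class:
those `3` mod `4` if `c = b`, and, if `c = a`, those of a class mod `8 a` on which `(κ a / ·) = -1`,
which exists by quadratic reciprocity as `κ a ≠ 1` is squarefree. The reciprocals of these primes
have a divergent sum, so the larger entries have density zero (`exists_card_linked_left_le`,
`exists_card_linked_right_le`).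

**Large smaller entry.** The range of `c` is cut into the doubly exponential blocks
`[2 ^ 2 ^ (20 i), 2 ^ 2 ^ (20 (i + 1)))`. For given `c`, the number of `d ≤ N / c` is bounded by a
combinatorial sieve truncated by Bonferroni's inequality (`card_sieve_le`): requiring
`(κ d / p) = 1` for the primes `p ∣ c` below the sieving limit gains a factor `1 / 2` for each, and
the primes `p` at which the condition on `d` fails are sieved out. Entries `c` with many prime
factors are rare (`sum_squarefree_many_primeFactors_le`) and are discarded beforehand. Among
the primes `p` allowed by the mod `4` condition about half have `(κ c / p) ≠ 1`; a second moment
estimate for `∑ (κ c / p) / p` over `c` (`sum_sq_jacobiSym_le`) shows that this fails only for a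
negligible set of exceptional `c`. Write `T` for the double logarithm of the sieving limit, and let
all sums over primes be of size `T` times the density of the primes in question. If only the first
entry is restricted to primes `1` mod `4`, the sieve saves `exp (-T / 2)`, while the weight
`2 ^ (-ω(c))` summed over such `c` costs `exp (T / 4)`; if only the second entry is restricted, the
sieve saves `exp (-3 T / 4)` against a cost of `exp (T / 2)`. In both cases the block has at most
`K 2 ^ (-i) N` pairs (`exists_block_bound_left`, `exists_block_bound_right`), and these
bounds add up to an arbitrarily small multiple of `N` over the blocks from a fixed one on.

The sums over primes in residue classes come from the behaviour at `s = 1` of the Dirichlet series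
of the von Mangoldt function on a residue class, which Mathlib provides for Dirichlet's theorem: an
integration over `s` and a Tauberian argument give `∑ 1 / p` up to `2 ^ 2 ^ T` with an error of at
most `ε T + C` (`recipSum_two_pow_le`, `le_recipSum_two_pow`).
-/

/-! ### Sums of reciprocals of primes in residue classes -/

section PrimeSums

open ArithmeticFunction ArithmeticFunction.vonMangoldt LSeries

/-- The indicator function of the primes in the residue class `a` mod `q`. -/
noncomputable def primeInd {q : ℕ} (a : ZMod q) : ℕ → ℝ :=
  Set.indicator {n : ℕ | n.Prime ∧ (n : ZMod q) = a} 1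

theorem primeInd_nonneg {q : ℕ} (a : ZMod q) (n : ℕ) : 0 ≤ primeInd a n :=
  Set.indicator_nonneg (fun _ _ => zero_le_one) n

theorem primeInd_le_one {q : ℕ} (a : ZMod q) (n : ℕ) : primeInd a n ≤ 1 :=
  Set.indicator_le_self' (fun _ _ => zero_le_one) n

theorem primeInd_zero {q : ℕ} (a : ZMod q) : primeInd a 0 = 0 := by
  simp [primeInd, Nat.not_prime_zero]

theorem LSeries_ofReal {f : ℕ → ℝ} (hf : f 0 = 0) (x : ℝ) :
    LSeries (fun n => (f n : ℂ)) x = ((∑' n, f n / (n : ℝ) ^ x : ℝ) : ℂ) := by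
  rw [Complex.ofReal_tsum, LSeries]
  refine tsum_congr fun n => ?_
  rcases eq_or_ne n 0 with rfl | hn
  · simp [hf]
  · rw [LSeries.term_of_ne_zero hn, Complex.ofReal_div, Complex.ofReal_cpow n.cast_nonneg,
      Complex.ofReal_natCast]

theorem abscissaOfAbsConv_primeInd_le_one {q : ℕ} (a : ZMod q) :
    abscissaOfAbsConv (fun n => (primeInd a n : ℂ)) ≤ 1 := by
  refine abscissaOfAbsConv_le_of_le_const ⟨1, fun n _ => ?_⟩
  rw [Complex.norm_real, Real.norm_of_nonneg (primeInd_nonneg a n)]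
  exact primeInd_le_one a n

theorem summable_primeInd {q : ℕ} (a : ZMod q) {x : ℝ} (hx : 1 < x) :
    Summable fun n : ℕ => primeInd a n / (n : ℝ) ^ x :=
  summable_real_of_abscissaOfAbsConv_lt
    ((abscissaOfAbsConv_primeInd_le_one a).trans_lt (by exact_mod_cast hx))

theorem hasDerivAt_tsum_primeInd {q : ℕ} (a : ZMod q) {x : ℝ} (hx : 1 < x) :
    HasDerivAt (fun x : ℝ => ∑' n : ℕ, primeInd a n / (n : ℝ) ^ x)
      (-∑' n : ℕ, Real.log n * primeInd a n / (n : ℝ) ^ x) x := by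
  have hlt : abscissaOfAbsConv (fun n => (primeInd a n : ℂ)) < ((x : ℂ).re : EReal) := by
    rw [Complex.ofReal_re]
    exact (abscissaOfAbsConv_primeInd_le_one a).trans_lt (by exact_mod_cast hx)
  have h := (LSeries_hasDerivAt hlt).real_of_complex
  have h1 : LSeries (logMul fun n => (primeInd a n : ℂ)) x =
      ((∑' n : ℕ, Real.log n * primeInd a n / (n : ℝ) ^ x : ℝ) : ℂ) := by
    rw [← LSeries_ofReal (f := fun n => Real.log n * primeInd a n) (by simp)]
    refine LSeries_congr (fun {n} _ => ?_) _
    rw [logMul, Complex.ofReal_mul, ← Complex.natCast_log]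
  simp only [h1, LSeries_ofReal (primeInd_zero a), ← Complex.ofReal_neg, Complex.ofReal_re] at h
  exact h

/-- Near `x = 1` the Dirichlet series of the von Mangoldt function on a residue class is
`1 / (φ(q) (x - 1))` up to a bounded error. -/
theorem abs_tsum_residueClass_sub_le {q : ℕ} [NeZero q] {a : ZMod q} (ha : IsUnit a) :
    ∃ C : ℝ, ∀ x ∈ Set.Ioc (1 : ℝ) 2,
      |∑' n, residueClass a n / (n : ℝ) ^ x - (q.totient : ℝ)⁻¹ / (x - 1)| ≤ C := by
  have H {x : ℝ} (hx : 1 < x) :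
      ∑' n, residueClass a n / (n : ℝ) ^ x - (q.totient : ℝ)⁻¹ / (x - 1) =
        (LFunctionResidueClassAux a x).re := by
    rw [eqOn_LFunctionResidueClassAux ha (Set.mem_ofPred.mpr (Complex.ofReal_re x ▸ hx))]
    beta_reduce
    rw [LSeries_ofReal (residueClass_apply_zero a)]
    have : (((q.totient : ℂ))⁻¹ / ((x : ℂ) - 1)) = (((q.totient : ℝ)⁻¹ / (x - 1) : ℝ) : ℂ) := by
      push_cast; rfl
    rw [this, ← Complex.ofReal_sub, Complex.ofReal_re]
  have hcont : ContinuousOn (fun x : ℝ => (LFunctionResidueClassAux a x).re) (Set.Icc 1 2) :=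
    Complex.continuous_re.continuousOn.comp (t := Set.univ)
      (continuousOn_LFunctionResidueClassAux a) (fun _ _ => trivial) |>.comp
        Complex.continuous_ofReal.continuousOn fun x hx => by
          simpa only [Set.mem_ofPred_eq, Complex.ofReal_re] using hx.1
  obtain ⟨C, hC⟩ := isCompact_Icc.exists_bound_of_continuousOn hcont
  refine ⟨C, fun x hx => ?_⟩
  rw [H hx.1]
  exact hC x (Set.Ioc_subset_Icc_self hx)

/-- The proper prime powers contribute a convergent series at `x = 1`, so they may be dropped. -/
theorem abs_tsum_log_primeInd_sub_le {q : ℕ} [NeZero q] {a : ZMod q} (ha : IsUnit a) :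
    ∃ C : ℝ, ∀ x ∈ Set.Ioc (1 : ℝ) 2,
      |∑' n : ℕ, Real.log n * primeInd a n / (n : ℝ) ^ x - (q.totient : ℝ)⁻¹ / (x - 1)| ≤ C := by
  obtain ⟨C, hC⟩ := abs_tsum_residueClass_sub_le ha
  have hS := summable_residueClass_non_primes_div a
  set D := ∑' n : ℕ, (if n.Prime then 0 else residueClass a n) / (n : ℝ) with hD
  refine ⟨C + D, fun x hx => ?_⟩
  have hG : Summable fun n : ℕ => residueClass a n / (n : ℝ) ^ x :=
    summable_real_of_abscissaOfAbsConv_lt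
      ((abscissaOfAbsConv_residueClass_le_one a).trans_lt (by exact_mod_cast hx.1))
  have hle (n : ℕ) : (if n.Prime then 0 else residueClass a n) / (n : ℝ) ^ x ≤
      (if n.Prime then 0 else residueClass a n) / (n : ℝ) := by
    rcases n.eq_zero_or_pos with rfl | hn
    · simp
    · refine div_le_div_of_nonneg_left ?_ (mod_cast hn) ?_
      · split_ifs
        exacts [le_rfl, residueClass_nonneg a n]
      · conv_lhs => rw [← Real.rpow_one n]
        exact Real.rpow_le_rpow_of_exponent_le (by exact_mod_cast hn) hx.1.le
  have hnn (n : ℕ) : 0 ≤ (if n.Prime then 0 else residueClass a n) / (n : ℝ) ^ x := by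
    refine div_nonneg ?_ (by positivity)
    split_ifs
    exacts [le_rfl, residueClass_nonneg a n]
  have hS' : Summable fun n : ℕ => (if n.Prime then 0 else residueClass a n) / (n : ℝ) ^ x :=
    Summable.of_nonneg_of_le hnn hle hS
  have heq : ∑' n : ℕ, Real.log n * primeInd a n / (n : ℝ) ^ x =
      ∑' n, residueClass a n / (n : ℝ) ^ x -
        ∑' n : ℕ, (if n.Prime then 0 else residueClass a n) / (n : ℝ) ^ x := by
    rw [← hG.tsum_sub hS']
    refine tsum_congr fun n => ?_
    rw [← sub_div]
    congr 1
    by_cases hp : n.Prime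
    · by_cases hn : (n : ZMod q) = a
      · simp [primeInd, residueClass, hp, hn, vonMangoldt_apply_prime]
      · simp [primeInd, residueClass, hp, hn]
    · simp [primeInd, hp]
  have h1 := hC x hx
  have h2 := hS'.tsum_le_tsum hle hS
  have h3 : 0 ≤ ∑' n : ℕ, (if n.Prime then 0 else residueClass a n) / (n : ℝ) ^ x :=
    tsum_nonneg hnn
  rw [heq]
  rw [abs_le] at h1 ⊢
  constructor <;> linarith

/-- Integrating the previous estimate: `∑ p⁻ˣ` over the primes of a residue class is
`-log (x - 1) / φ(q)` up to a bounded error. -/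
theorem abs_tsum_primeInd_add_log_le {q : ℕ} [NeZero q] {a : ZMod q} (ha : IsUnit a) :
    ∃ C : ℝ, ∀ x ∈ Set.Ioc (1 : ℝ) 2,
      |∑' n : ℕ, primeInd a n / (n : ℝ) ^ x + (q.totient : ℝ)⁻¹ * Real.log (x - 1)| ≤ C := by
  obtain ⟨C, hC⟩ := abs_tsum_log_primeInd_sub_le ha
  set H : ℝ → ℝ := fun x =>
    ∑' n : ℕ, primeInd a n / (n : ℝ) ^ x + (q.totient : ℝ)⁻¹ * Real.log (x - 1) with hH
  have hder (x : ℝ) (hx : x ∈ Set.Ioc (1 : ℝ) 2) :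
      HasDerivWithinAt H (-∑' n : ℕ, Real.log n * primeInd a n / (n : ℝ) ^ x +
        (q.totient : ℝ)⁻¹ * (1 / (x - 1))) (Set.Ioc 1 2) x := by
    refine HasDerivAt.hasDerivWithinAt ?_
    refine (hasDerivAt_tsum_primeInd a hx.1).add (HasDerivAt.const_mul _ ?_)
    exact ((hasDerivAt_id x).sub_const 1).log (by have := hx.1; simp only [id]; linarith)
  have hb (x : ℝ) (hx : x ∈ Set.Ioc (1 : ℝ) 2) :
      ‖-∑' n : ℕ, Real.log n * primeInd a n / (n : ℝ) ^ x +
        (q.totient : ℝ)⁻¹ * (1 / (x - 1))‖ ≤ C := by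
    rw [Real.norm_eq_abs, ← abs_neg, neg_add, neg_neg, mul_one_div, ← sub_eq_add_neg]
    exact hC x hx
  refine ⟨C + |H 2|, fun x hx => ?_⟩
  have h := (convex_Ioc (1 : ℝ) 2).norm_image_sub_le_of_norm_hasDerivWithin_le hder hb
    (Set.right_mem_Ioc.mpr one_lt_two) hx
  have hC0 : 0 ≤ C := (norm_nonneg _).trans (hb x hx)
  have h2 : ‖x - 2‖ ≤ 1 := by
    rw [Real.norm_eq_abs, abs_le]; constructor <;> linarith [hx.1, hx.2]
  have h3 : |H x - H 2| ≤ C := h.trans (by nlinarith)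
  have h4 := abs_sub_abs_le_abs_sub (H x) (H 2)
  change |H x| ≤ _
  linarith

/-- The sum of `1 / p` over the primes `p ≤ N` with the property `A`. -/
noncomputable def recipSum (A : ℕ → Prop) [DecidablePred A] (N : ℕ) : ℝ :=
  ∑ p ∈ (Nat.primesLE N).filter A, (1 / p : ℝ)

theorem recipSum_eq {q : ℕ} (a : ZMod q) (N : ℕ) :
    recipSum (fun p => (p : ZMod q) = a) N =
      ∑ n ∈ Finset.range (N + 1), primeInd a n / (n : ℝ) := by
  rw [recipSum, Nat.primesLE_eq_filter_range, Finset.filter_filter, Finset.sum_filter]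
  refine Finset.sum_congr rfl fun n _ => ?_
  by_cases h : n.Prime ∧ (n : ZMod q) = a
  · simp [primeInd, h]
  · rw [if_neg h, primeInd, Set.indicator_of_notMem (by simpa using h), zero_div]

/-- Rankin's trick: `1 ≤ (N / p) ^ δ` for `p ≤ N`. -/
theorem recipSum_le_of_rpow {q : ℕ} (a : ZMod q) {N : ℕ} (hN : 1 ≤ N) {δ : ℝ} (hδ : 0 < δ) :
    recipSum (fun p => (p : ZMod q) = a) N ≤
      (N : ℝ) ^ δ * ∑' n : ℕ, primeInd a n / (n : ℝ) ^ (1 + δ) := by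
  rw [recipSum_eq]
  calc ∑ n ∈ Finset.range (N + 1), primeInd a n / (n : ℝ)
      ≤ ∑ n ∈ Finset.range (N + 1), (N : ℝ) ^ δ * (primeInd a n / (n : ℝ) ^ (1 + δ)) := by
        refine Finset.sum_le_sum fun n hn => ?_
        rcases n.eq_zero_or_pos with rfl | hn0
        · simp [primeInd_zero]
        · have hn1 : (0 : ℝ) < n := by exact_mod_cast hn0
          have hle : (n : ℝ) ^ δ ≤ (N : ℝ) ^ δ :=
            Real.rpow_le_rpow hn1.le (by exact_mod_cast Nat.lt_succ_iff.mp (Finset.mem_range.mp hn))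
              hδ.le
          have hpos : 0 < (n : ℝ) ^ δ := Real.rpow_pos_of_pos hn1 _
          rw [Real.rpow_add hn1, Real.rpow_one, mul_div_assoc', div_le_div_iff₀ hn1 (by positivity)]
          have := mul_le_mul_of_nonneg_left hle (mul_nonneg (primeInd_nonneg a n) hn1.le)
          nlinarith
    _ = (N : ℝ) ^ δ * ∑ n ∈ Finset.range (N + 1), primeInd a n / (n : ℝ) ^ (1 + δ) := by
        rw [Finset.mul_sum]
    _ ≤ _ := by
        refine mul_le_mul_of_nonneg_left ?_ (by positivity)
        exact (summable_primeInd a (by linarith)).sum_le_tsum _ fun n _ =>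
          div_nonneg (primeInd_nonneg a n) (by positivity)

/-- Rankin's trick for the tail of the Dirichlet series: `1 ≤ (p / N) ^ (δ / 2)` for `p ≥ N`. -/
theorem tsum_primeInd_le_recipSum_add {q : ℕ} (a : ZMod q) {N : ℕ} (hN : 1 ≤ N) {δ : ℝ}
    (hδ : 0 < δ) :
    ∑' n : ℕ, primeInd a n / (n : ℝ) ^ (1 + δ) ≤ recipSum (fun p => (p : ZMod q) = a) N +
      (N : ℝ) ^ (-(δ / 2)) * ∑' n : ℕ, primeInd a n / (n : ℝ) ^ (1 + δ / 2) := by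
  have hs := summable_primeInd a (show 1 < 1 + δ by linarith)
  have hs' := summable_primeInd a (show 1 < 1 + δ / 2 by linarith)
  have hN0 : (0 : ℝ) < N := by exact_mod_cast hN
  have hpt (n : ℕ) : primeInd a n / (n : ℝ) ^ (1 + δ) ≤
      (if n < N + 1 then primeInd a n / (n : ℝ) else 0) +
        (N : ℝ) ^ (-(δ / 2)) * (primeInd a n / (n : ℝ) ^ (1 + δ / 2)) := by
    rcases n.eq_zero_or_pos with rfl | hn0
    · simp [primeInd_zero]
    have hn : (0 : ℝ) < n := by exact_mod_cast hn0
    have hP := primeInd_nonneg a n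
    split_ifs with h
    · have h1 : primeInd a n / (n : ℝ) ^ (1 + δ) ≤ primeInd a n / (n : ℝ) := by
        refine div_le_div_of_nonneg_left hP hn ?_
        conv_lhs => rw [← Real.rpow_one (n : ℝ)]
        exact Real.rpow_le_rpow_of_exponent_le (by exact_mod_cast hn0) (by linarith)
      have h2 : 0 ≤ (N : ℝ) ^ (-(δ / 2)) * (primeInd a n / (n : ℝ) ^ (1 + δ / 2)) := by positivity
      linarith
    · have hmN : (N : ℝ) ≤ n := by
        have : N ≤ n := by omega
        exact_mod_cast this
      have e : (n : ℝ) ^ (1 + δ) = (n : ℝ) ^ (1 + δ / 2) * (n : ℝ) ^ (δ / 2) := by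
        rw [← Real.rpow_add hn]; congr 1; ring
      rw [zero_add, e, Real.rpow_neg hN0.le, ← div_div, inv_mul_eq_div]
      refine div_le_div_of_nonneg_left (by positivity) (by positivity) ?_
      exact Real.rpow_le_rpow hN0.le hmN (by linarith)
  refine Real.tsum_le_of_sum_range_le (fun n => ?_) fun m => ?_
  · exact div_nonneg (primeInd_nonneg a n) (by positivity)
  refine (Finset.sum_le_sum fun n _ => hpt n).trans ?_
  rw [Finset.sum_add_distrib, ← Finset.mul_sum, recipSum_eq]
  refine add_le_add ?_ (mul_le_mul_of_nonneg_left ?_ (by positivity))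
  · rw [← Finset.sum_filter]
    refine Finset.sum_le_sum_of_subset_of_nonneg (fun n hn => ?_) fun n _ _ => ?_
    · exact Finset.mem_range.mpr (Finset.mem_filter.mp hn).2
    · exact div_nonneg (primeInd_nonneg a n) n.cast_nonneg
  · exact hs'.sum_le_tsum _ fun n _ => div_nonneg (primeInd_nonneg a n) (by positivity)

/-- The upper bound of Mertens' theorem in a residue class, in a weak form. -/
theorem recipSum_two_pow_le {q : ℕ} [NeZero q] {a : ZMod q} (ha : IsUnit a) {ε : ℝ} (hε : 0 < ε) :
    ∃ C : ℝ, ∀ T : ℕ, recipSum (fun p => (p : ZMod q) = a) (2 ^ 2 ^ T) ≤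
      ((q.totient : ℝ)⁻¹ * Real.log 2 + ε) * T + C := by
  obtain ⟨C, hC⟩ := abs_tsum_primeInd_add_log_le ha
  set κ : ℝ := min ε 1 with hκ
  have hκ0 : 0 < κ := lt_min hε one_pos
  have hκ1 : κ ≤ 1 := min_le_right _ _
  have hκε : κ ≤ ε := min_le_left _ _
  set φ : ℝ := (q.totient : ℝ)⁻¹ with hφ
  have hφ0 : 0 ≤ φ := by positivity
  have hφ1 : φ ≤ 1 := by
    refine inv_le_one_of_one_le₀ ?_
    exact_mod_cast Nat.totient_pos.mpr (NeZero.pos q)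
  have hl0 : 0 ≤ Real.log 2 := Real.log_nonneg one_le_two
  have hl1 : Real.log 2 ≤ 1 := by have := Real.log_two_lt_d9; linarith
  have hlκ : Real.log κ ≤ 0 := Real.log_nonpos hκ0.le hκ1
  have hC0 : 0 ≤ C := (abs_nonneg _).trans (hC 2 (by norm_num))
  refine ⟨2 * (C - φ * Real.log κ), fun T => ?_⟩
  have h2T : (1 : ℝ) ≤ 2 ^ T := one_le_pow₀ one_le_two
  -- with this `δ`, the factor `(2 ^ 2 ^ T) ^ δ = 2 ^ κ` is close to `1`
  set δ : ℝ := κ / 2 ^ T with hδ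
  have hδ0 : 0 < δ := by positivity
  have hδ1 : δ ≤ 1 := (div_le_one (by positivity)).mpr (hκ1.trans h2T)
  have h1 := recipSum_le_of_rpow a (N := 2 ^ 2 ^ T) Nat.one_le_two_pow hδ0
  have h2 := (abs_le.mp (hC (1 + δ) ⟨by linarith, by linarith⟩)).2
  have e1 : ((2 ^ 2 ^ T : ℕ) : ℝ) ^ δ = 2 ^ κ := by
    push_cast
    rw [← Real.rpow_natCast, ← Real.rpow_mul (by norm_num)]
    congr 1
    push_cast
    rw [hδ]
    field_simp
  have e2 : Real.log (1 + δ - 1) = Real.log κ - T * Real.log 2 := by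
    rw [add_sub_cancel_left, hδ, Real.log_div hκ0.ne' (by positivity), Real.log_pow]
  have e3 : (2 : ℝ) ^ κ ≤ 1 + κ := by
    have := rpow_one_add_le_one_add_mul_self (s := 1) (by norm_num) hκ0.le hκ1
    norm_num at this
    linarith
  have hF : 0 ≤ ∑' n : ℕ, primeInd a n / (n : ℝ) ^ (1 + δ) :=
    tsum_nonneg fun n => div_nonneg (primeInd_nonneg a n) (by positivity)
  rw [e1] at h1
  rw [e2] at h2
  set F := ∑' n : ℕ, primeInd a n / (n : ℝ) ^ (1 + δ) with hFdef
  have hT : (0 : ℝ) ≤ T := T.cast_nonneg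
  have hFle : F ≤ φ * Real.log 2 * T + (C - φ * Real.log κ) := by linarith
  have hpos : 0 ≤ C - φ * Real.log κ := by nlinarith
  calc _ ≤ (2 : ℝ) ^ κ * F := h1
    _ ≤ (1 + κ) * F := mul_le_mul_of_nonneg_right e3 hF
    _ ≤ (1 + κ) * (φ * Real.log 2 * T + (C - φ * Real.log κ)) := by
        exact mul_le_mul_of_nonneg_left hFle (by linarith)
    _ = φ * Real.log 2 * T + κ * (φ * Real.log 2) * T + (1 + κ) * (C - φ * Real.log κ) := by ring
    _ ≤ φ * Real.log 2 * T + ε * T + 2 * (C - φ * Real.log κ) := by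
        have h5 : κ * (φ * Real.log 2) ≤ ε :=
          (mul_le_of_le_one_right hκ0.le (mul_le_one₀ hφ1 hl0 hl1)).trans hκε
        have h6 := mul_le_mul_of_nonneg_right h5 hT
        have h7 := mul_le_mul_of_nonneg_right (show 1 + κ ≤ 2 by linarith) hpos
        linarith
    _ = _ := by ring

/-- The lower bound of Mertens' theorem in a residue class, in a weak form. -/
theorem le_recipSum_two_pow {q : ℕ} [NeZero q] {a : ZMod q} (ha : IsUnit a) {ε : ℝ} (hε : 0 < ε) :
    ∃ C : ℝ, ∀ T : ℕ, ((q.totient : ℝ)⁻¹ * Real.log 2 - ε) * T - C ≤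
      recipSum (fun p => (p : ZMod q) = a) (2 ^ 2 ^ T) := by
  obtain ⟨C, hC⟩ := abs_tsum_primeInd_add_log_le ha
  set κ : ℝ := min ε 1 with hκ
  have hκ0 : 0 < κ := lt_min hε one_pos
  have hκ1 : κ ≤ 1 := min_le_right _ _
  have hκε : κ ≤ ε := min_le_left _ _
  set φ : ℝ := (q.totient : ℝ)⁻¹ with hφ
  have hφ0 : 0 ≤ φ := by positivity
  have hφ1 : φ ≤ 1 := by
    refine inv_le_one_of_one_le₀ ?_
    exact_mod_cast Nat.totient_pos.mpr (NeZero.pos q)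
  have hl0 : 0 < Real.log 2 := Real.log_pos one_lt_two
  have hl1 : Real.log 2 ≤ 1 := by have := Real.log_two_lt_d9; linarith
  have hC0 : 0 ≤ C := (abs_nonneg _).trans (hC 2 (by norm_num))
  -- the bound for the tail, uniform in `T`
  set D : ℝ := 2 * (1 / (κ * Real.log 2 * Real.log 2) + (1 + C)) / Real.log 2 with hD
  refine ⟨C + D, fun T => ?_⟩
  have hT : (0 : ℝ) ≤ T := T.cast_nonneg
  -- `δ` is so large that the tail beyond `2 ^ 2 ^ T`, with its factor
  -- `exp (-2 ^ (κ T) * log 2 / 2)`, is bounded, at the cost of a proportion `κ` of the main term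
  set δ : ℝ := (2 : ℝ) ^ (-((1 - κ) * T)) with hδ
  have hδ0 : 0 < δ := by positivity
  have hδ1 : δ ≤ 1 :=
    Real.rpow_le_one_of_one_le_of_nonpos one_le_two (by nlinarith)
  have h1 := tsum_primeInd_le_recipSum_add a (N := 2 ^ 2 ^ T) Nat.one_le_two_pow hδ0
  have h2 := (abs_le.mp (hC (1 + δ) ⟨by linarith, by linarith⟩)).1
  have h3 := (abs_le.mp (hC (1 + δ / 2) ⟨by linarith, by linarith⟩)).2
  have e1 : Real.log (1 + δ - 1) = -((1 - κ) * T) * Real.log 2 := by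
    rw [add_sub_cancel_left, hδ, Real.log_rpow two_pos]
  have e2 : Real.log (1 + δ / 2 - 1) = -((1 - κ) * T) * Real.log 2 - Real.log 2 := by
    rw [add_sub_cancel_left, hδ, Real.log_div (by positivity) two_ne_zero, Real.log_rpow two_pos]
  rw [e1] at h2
  rw [e2] at h3
  have e3 : ((2 ^ 2 ^ T : ℕ) : ℝ) ^ (-(δ / 2)) = Real.exp (-(2 ^ (κ * T) * Real.log 2 / 2)) := by
    push_cast
    rw [← Real.rpow_natCast, ← Real.rpow_mul (by norm_num), Real.rpow_def_of_pos two_pos]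
    congr 1
    push_cast
    have : (2 : ℝ) ^ T * δ = 2 ^ (κ * T) := by
      rw [hδ, ← Real.rpow_natCast, ← Real.rpow_add two_pos]
      congr 1
      ring
    rw [← this]
    ring
  have e4 : 1 + κ * T * Real.log 2 ≤ (2 : ℝ) ^ (κ * T) := by
    rw [Real.rpow_def_of_pos two_pos]
    have := Real.add_one_le_exp (Real.log 2 * (κ * T))
    linarith
  set u : ℝ := (2 : ℝ) ^ (κ * T) with hu
  have hu0 : 0 < u := by positivity
  have e5 : Real.exp (-(u * Real.log 2 / 2)) ≤ 2 / (u * Real.log 2) := by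
    rw [Real.exp_neg, ← one_div, div_le_div_iff₀ (Real.exp_pos _) (by positivity)]
    have := Real.add_one_le_exp (u * Real.log 2 / 2)
    linarith
  set F := ∑' n : ℕ, primeInd a n / (n : ℝ) ^ (1 + δ / 2) with hF
  have hF0 : 0 ≤ F := tsum_nonneg fun n => div_nonneg (primeInd_nonneg a n) (by positivity)
  have hFle : F ≤ T + (1 + C) := by
    have h4 : φ * ((1 - κ) * T * Real.log 2 + Real.log 2) ≤ T + 1 := by
      have h5 : (1 - κ) * T * Real.log 2 ≤ T := by
        have : (1 - κ) * Real.log 2 ≤ 1 := by nlinarith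
        nlinarith
      have h6 : 0 ≤ (1 - κ) * T * Real.log 2 + Real.log 2 := by
        have : 0 ≤ (1 - κ) * T := mul_nonneg (by linarith) hT
        positivity
      nlinarith
    linarith
  have htail : Real.exp (-(u * Real.log 2 / 2)) * F ≤ D := by
    calc _ ≤ 2 / (u * Real.log 2) * (T + (1 + C)) := mul_le_mul e5 hFle hF0 (by positivity)
      _ ≤ 2 / (u * Real.log 2) * (u * (1 / (κ * Real.log 2 * Real.log 2) + (1 + C))) := by
          refine mul_le_mul_of_nonneg_left ?_ (by positivity)
          have hT' : T ≤ u * (1 / (κ * Real.log 2 * Real.log 2)) := by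
            rw [mul_one_div, le_div_iff₀ (by positivity)]
            nlinarith [mul_nonneg hκ0.le hT, mul_nonneg (mul_nonneg hκ0.le hT) hl0.le]
          have hu1 : 1 ≤ u := by
            have : 0 ≤ κ * T * Real.log 2 := by positivity
            linarith
          nlinarith
      _ = D := by
          rw [hD]
          field_simp
  rw [e3] at h1
  have h7 : φ * κ * Real.log 2 * T ≤ ε * T := by
    refine mul_le_mul_of_nonneg_right ?_ hT
    calc φ * κ * Real.log 2 ≤ 1 * κ * 1 := by gcongr
      _ ≤ ε := by linarith
  have h8 : φ * (-((1 - κ) * T) * Real.log 2) = -(φ * Real.log 2 * T) + φ * κ * Real.log 2 * T := by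
    ring
  linarith

end PrimeSums

/-! ### Sums of reciprocals of all primes and of primes modulo four -/

section PrimeSumsModFour

theorem recipSum_congr {A B : ℕ → Prop} [DecidablePred A] [DecidablePred B]
    (h : ∀ p, A p ↔ B p) (N : ℕ) : recipSum A N = recipSum B N := by
  rw [recipSum, recipSum, Finset.filter_congr fun p _ => h p]

theorem recipSum_nonneg (A : ℕ → Prop) [DecidablePred A] (N : ℕ) : 0 ≤ recipSum A N :=
  Finset.sum_nonneg fun p _ => by positivity

theorem recipSum_add_not (A : ℕ → Prop) [DecidablePred A] (N : ℕ) :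
    recipSum A N + recipSum (fun p => ¬A p) N = recipSum (fun _ => True) N := by
  rw [recipSum, recipSum, recipSum, Finset.sum_filter_add_sum_filter_not, Finset.filter_true]

theorem abs_recipSum_true_sub_le {ε : ℝ} (hε : 0 < ε) :
    ∃ C : ℝ, ∀ T : ℕ, |recipSum (fun _ => True) (2 ^ 2 ^ T) - Real.log 2 * T| ≤ ε * T + C := by
  have hu : IsUnit (0 : ZMod 1) := isUnit_of_subsingleton _
  obtain ⟨C₁, h₁⟩ := recipSum_two_pow_le hu hε
  obtain ⟨C₂, h₂⟩ := le_recipSum_two_pow hu hε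
  refine ⟨max C₁ C₂, fun T => ?_⟩
  have e : recipSum (fun p => (p : ZMod 1) = 0) (2 ^ 2 ^ T) =
      recipSum (fun _ => True) (2 ^ 2 ^ T) :=
    recipSum_congr (fun p => by simp [Subsingleton.elim (p : ZMod 1) 0]) _
  have h₁ := h₁ T
  have h₂ := h₂ T
  rw [e] at h₁ h₂
  simp only [Nat.totient_one, Nat.cast_one, inv_one, one_mul] at h₁ h₂
  rw [abs_le]
  constructor <;> nlinarith [le_max_left C₁ C₂, le_max_right C₁ C₂]

theorem le_recipSum_mod_four {r : ℕ} (hr : r = 1 ∨ r = 3) {ε : ℝ} (hε : 0 < ε) :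
    ∃ C : ℝ, ∀ T : ℕ,
      Real.log 2 / 2 * T - ε * T - C ≤ recipSum (fun p => p % 4 = r) (2 ^ 2 ^ T) := by
  have hu : IsUnit ((r : ℕ) : ZMod 4) := by
    rcases hr with rfl | rfl <;> decide
  obtain ⟨C₂, h₂⟩ := le_recipSum_two_pow hu hε
  refine ⟨C₂, fun T => ?_⟩
  have e : recipSum (fun p => (p : ZMod 4) = (r : ZMod 4)) (2 ^ 2 ^ T) =
      recipSum (fun p => p % 4 = r) (2 ^ 2 ^ T) := by
    refine recipSum_congr (fun p => ?_) _
    rw [ZMod.natCast_eq_natCast_iff']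
    rcases hr with rfl | rfl <;> rfl
  have h₂ := h₂ T
  have ht : Nat.totient 4 = 2 := by decide
  rw [e, ht] at h₂
  push_cast at h₂
  linarith

end PrimeSumsModFour

/-! ### Character sums over intervals -/

section JacobiSums

open scoped NumberTheorySymbols

theorem exists_jacobiSym_prime_eq_neg_one {p : ℕ} (hp : p.Prime) (h2 : p ≠ 2) :
    ∃ u : ℕ, J(u | p) = -1 := by
  have := Fact.mk hp
  obtain ⟨g, hg⟩ := FiniteField.exists_nonsquare (F := ZMod p) (by rwa [ZMod.ringChar_zmod_n])
  refine ⟨g.val, ?_⟩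
  rw [ZMod.nonsquare_iff_jacobiSym_eq_neg_one]
  simpa using hg

theorem abs_jacobiSym_le_one (a : ℤ) (b : ℕ) : |J(a | b)| ≤ 1 := by
  rcases jacobiSym.trichotomy a b with h | h | h <;> simp [h]

theorem jacobiSym_prod (a : ℤ) (S : Finset ℕ) (hS : ∀ p ∈ S, p ≠ 0) :
    J(a | ∏ p ∈ S, p) = ∏ p ∈ S, J(a | p) := by
  induction S using Finset.induction_on with
  | empty => simp
  | insert p S hp ih =>
    rw [Finset.prod_insert hp, Finset.prod_insert hp, jacobiSym.mul_right',
      ih fun r hr => hS r (Finset.mem_insert_of_mem hr)]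
    · exact hS p (Finset.mem_insert_self p S)
    · exact Finset.prod_ne_zero_iff.mpr fun r hr => hS r (Finset.mem_insert_of_mem hr)

theorem exists_jacobiSym_eq_neg_one {V : Finset ℕ} (hV : V.Nonempty)
    (hp : ∀ p ∈ V, p.Prime ∧ p ≠ 2) : ∃ u : ℕ, J(u | ∏ p ∈ V, p) = -1 := by
  obtain ⟨p, hpV⟩ := hV
  obtain ⟨g, hg⟩ := exists_jacobiSym_prime_eq_neg_one (hp p hpV).1 (hp p hpV).2
  have hcop : p.Coprime (∏ r ∈ V.erase p, r) := by
    refine Nat.Coprime.prod_right fun r hr => ?_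
    exact (Nat.coprime_primes (hp p hpV).1 (hp r (Finset.mem_of_mem_erase hr)).1).mpr
      (Finset.ne_of_mem_erase hr).symm
  obtain ⟨u, hu1, hu2⟩ := Nat.chineseRemainder hcop g 1
  refine ⟨u, ?_⟩
  have hne : ∏ r ∈ V.erase p, r ≠ 0 := Finset.prod_ne_zero_iff.mpr fun r hr =>
    (hp r (Finset.mem_of_mem_erase hr)).1.ne_zero
  rw [← Finset.mul_prod_erase V _ hpV, jacobiSym.mul_right' _ (hp p hpV).1.ne_zero hne]
  have h1 : J((u : ℤ) | p) = J((g : ℤ) | p) :=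
    jacobiSym.mod_left' (by exact_mod_cast hu1)
  have h2 : J((u : ℤ) | ∏ r ∈ V.erase p, r) = J(1 | ∏ r ∈ V.erase p, r) :=
    jacobiSym.mod_left' (by exact_mod_cast hu2)
  rw [h1, h2, hg, jacobiSym.one_left, mul_one]

/-- Multiplication by `u` permutes the residues and changes the sign of the sum. -/
theorem sum_range_jacobiSym_eq_zero {e u : ℕ} (he : e ≠ 0) (hu : J(u | e) = -1) :
    ∑ m ∈ Finset.range e, J(m | e) = 0 := by
  have : NeZero e := ⟨he⟩
  have hcop : Nat.Coprime e u := by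
    by_contra h
    have h0 : J(u | e) = 0 := jacobiSym.eq_zero_iff_not_coprime.mpr (by
      rw [Int.gcd_natCast_natCast, Nat.gcd_comm]; exact h)
    omega
  have hmaps : Set.MapsTo (fun m => u * m % e) (Finset.range e) (Finset.range e) := fun m _ => by
    simpa using Nat.mod_lt _ (Nat.pos_of_ne_zero he)
  have hinj : Set.InjOn (fun m => u * m % e) (Finset.range e) := fun m hm m' hm' h => by
    have h1 : m ≡ m' [MOD e] := Nat.ModEq.cancel_left_of_coprime hcop h
    rwa [Nat.ModEq, Nat.mod_eq_of_lt (by simpa using hm), Nat.mod_eq_of_lt (by simpa using hm')]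
      at h1
  have h := Finset.sum_nbij (s := Finset.range e) (t := Finset.range e)
    (f := fun m : ℕ => J((u * m : ℤ) | e)) (g := fun m : ℕ => J(m | e)) (fun m => u * m % e)
    hmaps hinj (Finset.surjOn_of_injOn_of_card_le _ hmaps hinj le_rfl) (fun m _ => by
      rw [jacobiSym.mod_left]; push_cast; rfl)
  simp only [jacobiSym.mul_left, ← Finset.mul_sum, hu] at h
  linarith

theorem abs_sum_range_le_of_periodic {e : ℕ} (he : 0 < e) {f : ℕ → ℤ}
    (hper : ∀ m, f (e + m) = f m) (hzero : ∑ m ∈ Finset.range e, f m = 0)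
    (hf : ∀ m, |f m| ≤ 1) (n : ℕ) : |∑ m ∈ Finset.range n, f m| ≤ e := by
  induction n using Nat.strong_induction_on with
  | _ n ih =>
    rcases lt_or_ge n e with h | h
    · refine (Finset.abs_sum_le_sum_abs _ _).trans ?_
      refine (Finset.sum_le_card_nsmul _ _ 1 fun m _ => hf m).trans ?_
      simp only [Finset.card_range, nsmul_eq_mul, mul_one]
      exact_mod_cast h.le
    · obtain ⟨k, rfl⟩ := Nat.exists_eq_add_of_le h
      rw [Finset.sum_range_add, hzero, zero_add]
      simp only [hper]
      exact ih k (by omega)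

theorem abs_sum_range_jacobiSym_le {V : Finset ℕ} (hV : V.Nonempty)
    (hp : ∀ p ∈ V, p.Prime ∧ p ≠ 2) (n : ℕ) :
    |∑ m ∈ Finset.range n, J(m | ∏ p ∈ V, p)| ≤ ∏ p ∈ V, p := by
  have he : ∏ p ∈ V, p ≠ 0 := Finset.prod_ne_zero_iff.mpr fun r hr => (hp r hr).1.ne_zero
  obtain ⟨u, hu⟩ := exists_jacobiSym_eq_neg_one hV hp
  refine abs_sum_range_le_of_periodic (Nat.pos_of_ne_zero he) (fun m => ?_)
    (sum_range_jacobiSym_eq_zero he hu) (fun m => abs_jacobiSym_le_one _ _) n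
  refine jacobiSym.mod_left' ?_
  push_cast
  simp

end JacobiSums

/-! ### A truncated sieve with quadratic conditions -/

section Sieve

open scoped NumberTheorySymbols

/-- Bonferroni's inequality: inclusion-exclusion cut off after an even number of steps. -/
theorem indicator_empty_le_sum_powerset (D : Finset ℕ) (k : ℕ) :
    (if D = ∅ then 1 else 0 : ℤ) ≤
      ∑ S ∈ D.powerset with S.card ≤ 2 * k, (-1 : ℤ) ^ S.card := by
  rw [Finset.sum_filter,
    Finset.sum_powerset_apply_card (fun j => if j ≤ 2 * k then (-1 : ℤ) ^ j else 0)]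
  have h : ∑ m ∈ Finset.range (D.card + 1),
      D.card.choose m • (if m ≤ 2 * k then (-1 : ℤ) ^ m else 0) =
        ∑ m ∈ Finset.range (2 * k + 1), (-1 : ℤ) ^ m * D.card.choose m := by
    have h1 : ∀ m, D.card.choose m • (if m ≤ 2 * k then (-1 : ℤ) ^ m else 0) =
        if m ∈ Finset.range (2 * k + 1) then (-1 : ℤ) ^ m * D.card.choose m else 0 := by
      intro m
      simp only [Finset.mem_range, Nat.lt_succ_iff, nsmul_eq_mul]
      split_ifs <;> ring
    simp only [h1]
    rw [Finset.sum_ite_mem]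
    refine Finset.sum_subset Finset.inter_subset_right fun m hm hm' => ?_
    have : D.card < m := by
      by_contra hc
      exact hm' (Finset.mem_inter.mpr ⟨Finset.mem_range.mpr (by omega), hm⟩)
    rw [Nat.choose_eq_zero_of_lt this]
    simp
  rw [h]
  rcases Nat.eq_zero_or_pos D.card with h0 | h0
  · rw [if_pos (Finset.card_eq_zero.mp h0), h0, Finset.sum_range_succ']
    simp
  · obtain ⟨n, hn⟩ := Nat.exists_eq_succ_of_ne_zero h0.ne'
    rw [if_neg (by rintro rfl; simp at h0), hn, Int.alternating_sum_range_choose_eq_choose]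
    simp

theorem card_powerset_filter_le (P : Finset ℕ) (k : ℕ) :
    (P.powerset.filter fun S => S.card ≤ k).card ≤ (P.card + 1) ^ k := by
  calc (P.powerset.filter fun S => S.card ≤ k).card
      ≤ ((Finset.range (k + 1)).biUnion fun j => P.powersetCard j).card := by
        refine Finset.card_le_card fun S hS => ?_
        simp only [Finset.mem_filter, Finset.mem_powerset] at hS
        simp only [Finset.mem_biUnion, Finset.mem_range, Finset.mem_powersetCard]
        exact ⟨S.card, by omega, hS.1, rfl⟩
    _ ≤ ∑ j ∈ Finset.range (k + 1), P.card.choose j := by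
        refine Finset.card_biUnion_le.trans (le_of_eq ?_)
        simp
    _ ≤ ∑ j ∈ Finset.range (k + 1), P.card ^ j * 1 ^ (k - j) * k.choose j := by
        refine Finset.sum_le_sum fun j hj => ?_
        rw [one_pow, mul_one]
        exact (Nat.choose_le_pow _ _).trans
          (Nat.le_mul_of_pos_right _ (Nat.choose_pos (by simpa [Nat.lt_succ_iff] using hj)))
    _ = (P.card + 1) ^ k := by rw [add_pow]; simp

theorem sum_Icc_filter_dvd {β : Type*} [AddCommMonoid β] {r : ℕ} (hr : 0 < r) (M : ℕ) (g : ℕ → β) :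
    ∑ d ∈ Finset.Icc 1 M with r ∣ d, g d = ∑ m ∈ Finset.Icc 1 (M / r), g (r * m) := by
  symm
  refine Finset.sum_nbij (fun m => r * m) (fun m hm => ?_) (fun m _ m' _ h => ?_) (fun d hd => ?_)
    fun m _ => rfl
  · simp only [Finset.mem_Icc, Finset.mem_filter] at hm ⊢
    refine ⟨⟨Nat.mul_pos hr hm.1, ?_⟩, dvd_mul_right _ _⟩
    rw [mul_comm]
    exact (Nat.le_div_iff_mul_le hr).mp hm.2
  · exact Nat.eq_of_mul_eq_mul_left hr h
  · simp only [Finset.coe_filter, Finset.mem_Icc, Set.mem_ofPred_eq] at hd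
    obtain ⟨⟨h1, h2⟩, m, rfl⟩ := hd
    refine ⟨m, ?_, rfl⟩
    simp only [Finset.coe_Icc, Set.mem_Icc]
    refine ⟨Nat.pos_of_mul_pos_left h1, ?_⟩
    rw [Nat.le_div_iff_mul_le hr, mul_comm]
    exact h2

/-- The main term of the truncated sieve. A subset `S` with more than `2 k` elements has
`1 ≤ (1 / 4) ^ k * 2 ^ #S`, so that what is cut off is at most the second product. -/
theorem sum_truncated_le (P : Finset ℕ) (k : ℕ) :
    ∑ S ∈ P.powerset with S.card ≤ 2 * k, (-1 : ℝ) ^ S.card / (∏ p ∈ S, p : ℕ) ≤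
      ∏ p ∈ P, (1 - 1 / p : ℝ) + (1 / 4) ^ k * ∏ p ∈ P, (1 + 2 / p : ℝ) := by
  have h1 : ∏ p ∈ P, (1 - 1 / p : ℝ) = ∑ S ∈ P.powerset, (-1 : ℝ) ^ S.card / (∏ p ∈ S, p : ℕ) := by
    simp only [sub_eq_add_neg, Finset.prod_one_add]
    refine Finset.sum_congr rfl fun S _ => ?_
    rw [Finset.prod_neg, Nat.cast_prod, Finset.prod_div_distrib]
    simp [div_eq_mul_inv]
  have h2 : ∏ p ∈ P, (1 + 2 / p : ℝ) = ∑ S ∈ P.powerset, (2 : ℝ) ^ S.card / (∏ p ∈ S, p : ℕ) := by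
    simp only [Finset.prod_one_add]
    refine Finset.sum_congr rfl fun S _ => ?_
    rw [Nat.cast_prod, Finset.prod_div_distrib]
    simp
  rw [h1, h2, Finset.mul_sum, ← Finset.sum_add_distrib, Finset.sum_filter]
  refine Finset.sum_le_sum fun S _ => ?_
  set D : ℝ := ((∏ p ∈ S, p : ℕ) : ℝ)
  have hD : 0 ≤ D := Nat.cast_nonneg _
  split_ifs with h
  · have : 0 ≤ (1 / 4 : ℝ) ^ k * (2 ^ S.card / D) := by positivity
    linarith
  · have h3 : (1 : ℝ) ≤ (1 / 4) ^ k * 2 ^ S.card := by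
      have : (2 : ℝ) ^ (2 * k) ≤ 2 ^ S.card := pow_le_pow_right₀ one_le_two (by omega)
      calc (1 : ℝ) = (1 / 4) ^ k * 2 ^ (2 * k) := by rw [pow_mul, ← mul_pow]; norm_num
        _ ≤ _ := by gcongr
    have h4 : (-1 : ℝ) ≤ (-1) ^ S.card := by
      rcases neg_one_pow_eq_or ℝ S.card with h | h <;> rw [h]; norm_num
    rw [mul_div_assoc', ← add_div]
    exact div_nonneg (by linarith) hD

theorem prod_dvd_iff_subset {P S : Finset ℕ} (hP : ∀ p ∈ P, p.Prime) (hS : S ⊆ P) (d : ℕ) :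
    ∏ p ∈ S, p ∣ d ↔ S ⊆ P.filter (· ∣ d) := by
  constructor
  · intro h p hp
    exact Finset.mem_filter.mpr ⟨hS hp, (Finset.dvd_prod_of_mem _ hp).trans h⟩
  · intro h
    exact Finset.prod_primes_dvd d (fun p hp => (hP p (hS hp)).prime)
      fun p hp => (Finset.mem_filter.mp (h hp)).2

/-- A sieve with quadratic conditions: the conditions at `U` are detected by
`∏ p ∈ U, (1 + (κ d / p)) / 2`, and the divisibilities by the primes of `P` are removed by
inclusion-exclusion with at most `2 k` primes. After expansion, every term with a nontrivial
character is an incomplete character sum, which is bounded by the modulus. -/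
theorem card_sieve_le {U P : Finset ℕ} (hU : ∀ p ∈ U, p.Prime ∧ p ≠ 2) (hP : ∀ p ∈ P, p.Prime)
    (κ M k : ℕ) :
    (((Finset.Icc 1 M).filter fun d : ℕ =>
      (∀ p ∈ U, J(κ * d | p) = 1) ∧ ∀ p ∈ P, ¬p ∣ d).card : ℝ) ≤
      (1 / 2) ^ U.card * (M * (∏ p ∈ P, (1 - 1 / p : ℝ) + (1 / 4) ^ k * ∏ p ∈ P, (1 + 2 / p : ℝ)))
        + ((∏ p ∈ U, p : ℕ) + 1) * ((P.card : ℝ) + 1) ^ (2 * k) := by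
  classical
  set 𝒮 := P.powerset.filter fun S => S.card ≤ 2 * k with h𝒮
  set Q : ℕ := ∏ p ∈ U, p with hQ
  have hSpos : ∀ S ∈ 𝒮, 0 < ∏ p ∈ S, p := fun S hS => Finset.prod_pos fun p hp =>
    (hP p (Finset.mem_powerset.mp (Finset.mem_filter.mp hS).1 hp)).pos
  -- the two weights
  have hw : ∀ d : ℕ, ∑ V ∈ U.powerset, J(κ * d | ∏ p ∈ V, p) = ∏ p ∈ U, (1 + J(κ * d | p)) := by
    intro d
    rw [Finset.prod_one_add]
    refine Finset.sum_congr rfl fun V hV => jacobiSym_prod _ _ fun p hp => ?_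
    exact (hU p (Finset.mem_powerset.mp hV hp)).1.ne_zero
  have hw0 : ∀ d : ℕ, 0 ≤ ∏ p ∈ U, (1 + J(κ * d | p)) := fun d => Finset.prod_nonneg fun p _ => by
    have := (abs_le.mp (abs_jacobiSym_le_one (κ * d) p)).1
    linarith
  have hb : ∀ d : ℕ, (if ∀ p ∈ P, ¬p ∣ d then 1 else 0 : ℤ) ≤
      ∑ S ∈ 𝒮, if ∏ p ∈ S, p ∣ d then (-1 : ℤ) ^ S.card else 0 := by
    intro d
    have h1 := indicator_empty_le_sum_powerset (P.filter (· ∣ d)) k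
    have h2 : (P.filter (· ∣ d) = ∅) ↔ ∀ p ∈ P, ¬p ∣ d := by
      rw [Finset.filter_eq_empty_iff]
    simp only [h2] at h1
    refine h1.trans (le_of_eq ?_)
    rw [← Finset.sum_filter]
    refine Finset.sum_congr ?_ fun _ _ => rfl
    ext S
    simp only [h𝒮, Finset.mem_filter, Finset.mem_powerset]
    constructor
    · rintro ⟨h3, h4⟩
      have h5 : S ⊆ P := h3.trans (Finset.filter_subset _ _)
      exact ⟨⟨h5, h4⟩, (prod_dvd_iff_subset hP h5 d).mpr h3⟩
    · rintro ⟨⟨h3, h4⟩, h5⟩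
      exact ⟨(prod_dvd_iff_subset hP h3 d).mp h5, h4⟩
  -- the inner sums after the order of summation is changed
  set I : Finset ℕ → Finset ℕ → ℤ := fun V S =>
    ∑ d ∈ Finset.Icc 1 M with ∏ p ∈ S, p ∣ d, J(κ * d | ∏ p ∈ V, p) with hI
  have hmain : (2 : ℤ) ^ U.card * ((Finset.Icc 1 M).filter fun d : ℕ =>
      (∀ p ∈ U, J(κ * d | p) = 1) ∧ ∀ p ∈ P, ¬p ∣ d).card ≤
      ∑ V ∈ U.powerset, ∑ S ∈ 𝒮, (-1 : ℤ) ^ S.card * I V S := by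
    calc _ = ∑ d ∈ Finset.Icc 1 M, if (∀ p ∈ U, J(κ * d | p) = 1) ∧ ∀ p ∈ P, ¬p ∣ d then
            (2 : ℤ) ^ U.card else 0 := by
          rw [← Finset.sum_filter, Finset.sum_const, nsmul_eq_mul, mul_comm]
      _ ≤ ∑ d ∈ Finset.Icc 1 M, (∏ p ∈ U, (1 + J(κ * d | p))) *
            ∑ S ∈ 𝒮, if ∏ p ∈ S, p ∣ d then (-1 : ℤ) ^ S.card else 0 := by
          refine Finset.sum_le_sum fun d _ => ?_
          refine le_trans ?_ (mul_le_mul_of_nonneg_left (hb d) (hw0 d))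
          split_ifs with h1 h2 h2
          · rw [Finset.prod_congr rfl fun p hp => by rw [h1.1 p hp]]
            norm_num
          · exact absurd h1.2 h2
          · simpa using hw0 d
          · simp
      _ = ∑ V ∈ U.powerset, ∑ S ∈ 𝒮, (-1 : ℤ) ^ S.card * I V S := by
          simp only [← hw, Finset.sum_mul_sum]
          simp only [hI, Finset.sum_filter, Finset.mul_sum]
          refine Finset.sum_comm.trans (Finset.sum_congr rfl fun V _ => ?_)
          refine Finset.sum_comm.trans (Finset.sum_congr rfl fun S _ => ?_)
          refine Finset.sum_congr rfl fun d _ => ?_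
          split_ifs <;> ring
  have hI0 : ∀ S ∈ 𝒮, I ∅ S = (M / ∏ p ∈ S, p : ℕ) := by
    intro S hS
    simp only [hI, Finset.prod_empty, jacobiSym.one_right]
    rw [sum_Icc_filter_dvd (hSpos S hS)]
    simp
  have hI1 : ∀ V ∈ U.powerset, V ≠ ∅ → ∀ S ∈ 𝒮, |I V S| ≤ Q := by
    intro V hV hne S hS
    have hVp : ∀ p ∈ V, p.Prime ∧ p ≠ 2 := fun p hp => hU p (Finset.mem_powerset.mp hV hp)
    simp only [hI]
    rw [sum_Icc_filter_dvd (hSpos S hS)]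
    have e1 : ∑ m ∈ Finset.Icc 1 (M / ∏ p ∈ S, p), J(κ * ((∏ p ∈ S, p) * m : ℕ) | ∏ p ∈ V, p) =
        J(κ * (∏ p ∈ S, p : ℕ) | ∏ p ∈ V, p) *
          ∑ m ∈ Finset.range (M / ∏ p ∈ S, p + 1), J(m | ∏ p ∈ V, p) := by
      rw [Finset.mul_sum, Finset.range_eq_Ico, Finset.sum_eq_sum_Ico_succ_bot (Nat.succ_pos _)]
      have h0 : J(((0 : ℕ) : ℤ) | ∏ p ∈ V, p) = 0 := by
        refine jacobiSym.zero_left ?_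
        obtain ⟨p, hp⟩ := Finset.nonempty_iff_ne_empty.mpr hne
        refine lt_of_lt_of_le (hVp p hp).1.one_lt (Nat.le_of_dvd ?_ (Finset.dvd_prod_of_mem _ hp))
        exact Finset.prod_pos fun r hr => (hVp r hr).1.pos
      rw [h0, mul_zero, zero_add]
      refine Finset.sum_congr (by ext; simp) fun m _ => ?_
      rw [← jacobiSym.mul_left]
      push_cast
      ring_nf
    rw [e1, abs_mul]
    have h2 := abs_sum_range_jacobiSym_le (Finset.nonempty_iff_ne_empty.mpr hne) hVp
      (M / ∏ p ∈ S, p + 1)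
    have h3 : ∏ p ∈ V, p ≤ Q := by
      refine Nat.le_of_dvd (Finset.prod_pos fun r hr => (hU r hr).1.pos) ?_
      exact Finset.prod_dvd_prod_of_subset _ _ _ (Finset.mem_powerset.mp hV)
    have h3' : ((∏ p ∈ V, p : ℕ) : ℤ) ≤ Q := by exact_mod_cast h3
    have h4 := abs_jacobiSym_le_one (κ * (∏ p ∈ S, p : ℕ)) (∏ p ∈ V, p)
    calc _ ≤ (1 : ℤ) * (∏ p ∈ V, p : ℕ) :=
          mul_le_mul h4 (by exact_mod_cast h2) (abs_nonneg _) one_pos.le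
      _ ≤ Q := by rw [one_mul]; exact h3'
  have hT0 : ((∑ S ∈ 𝒮, (-1 : ℤ) ^ S.card * I ∅ S : ℤ) : ℝ) ≤
      M * (∏ p ∈ P, (1 - 1 / p : ℝ) + (1 / 4) ^ k * ∏ p ∈ P, (1 + 2 / p : ℝ)) + 𝒮.card := by
    have h1 : ((∑ S ∈ 𝒮, (-1 : ℤ) ^ S.card * I ∅ S : ℤ) : ℝ) ≤
        ∑ S ∈ 𝒮, (M * ((-1 : ℝ) ^ S.card / (∏ p ∈ S, p : ℕ)) + 1) := by
      rw [Int.cast_sum]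
      refine Finset.sum_le_sum fun S hS => ?_
      rw [hI0 S hS]
      have hr : (0 : ℝ) < (∏ p ∈ S, p : ℕ) := by exact_mod_cast hSpos S hS
      have h2 : ((M / ∏ p ∈ S, p : ℕ) : ℝ) ≤ M / (∏ p ∈ S, p : ℕ) := Nat.cast_div_le
      have h3 : (M : ℝ) / (∏ p ∈ S, p : ℕ) ≤ (M / ∏ p ∈ S, p : ℕ) + 1 := by
        rw [div_le_iff₀ hr]
        exact_mod_cast (Nat.lt_mul_of_div_lt (Nat.lt_succ_self _) (hSpos S hS)).le
      have e : (M : ℝ) * ((-1) ^ S.card / (∏ p ∈ S, p : ℕ)) =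
          (-1) ^ S.card * (M / (∏ p ∈ S, p : ℕ)) := by ring
      rw [e, Int.cast_mul, Int.cast_pow, Int.cast_neg, Int.cast_one, Int.cast_natCast]
      rcases neg_one_pow_eq_or ℝ S.card with h | h <;> rw [h] <;> linarith
    refine h1.trans ?_
    rw [Finset.sum_add_distrib, ← Finset.mul_sum, Finset.sum_const, nsmul_eq_mul, mul_one]
    gcongr
    exact sum_truncated_le P k
  have hT1 : ∀ V ∈ U.powerset.erase ∅,
      ((∑ S ∈ 𝒮, (-1 : ℤ) ^ S.card * I V S : ℤ) : ℝ) ≤ Q * 𝒮.card := by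
    intro V hV
    have h1 : ∑ S ∈ 𝒮, (-1 : ℤ) ^ S.card * I V S ≤ ∑ S ∈ 𝒮, (Q : ℤ) := by
      refine Finset.sum_le_sum fun S hS => (le_abs_self _).trans ?_
      rw [abs_mul, abs_pow, abs_neg, abs_one, one_pow, one_mul]
      exact hI1 V (Finset.mem_of_mem_erase hV) (Finset.ne_of_mem_erase hV) S hS
    rw [Finset.sum_const, nsmul_eq_mul, mul_comm] at h1
    exact_mod_cast h1
  have hcard : (𝒮.card : ℝ) ≤ ((P.card : ℝ) + 1) ^ (2 * k) := by
    exact_mod_cast card_powerset_filter_le P (2 * k)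
  rw [← Finset.add_sum_erase _ _ (Finset.empty_mem_powerset U)] at hmain
  have hmain' := (Int.cast_le (R := ℝ)).mpr hmain
  rw [Int.cast_add, Int.cast_sum] at hmain'
  have hT1' := Finset.sum_le_card_nsmul _ _ _ hT1
  have hce : ((U.powerset.erase ∅).card : ℝ) ≤ 2 ^ U.card := by
    have := Finset.card_erase_le (s := U.powerset) (a := ∅)
    rw [Finset.card_powerset] at this
    exact_mod_cast this
  rw [nsmul_eq_mul] at hT1'
  push_cast at hmain'
  set N : ℝ := (((Finset.Icc 1 M).filter fun d : ℕ =>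
      (∀ p ∈ U, J(κ * d | p) = 1) ∧ ∀ p ∈ P, ¬p ∣ d).card : ℝ) with hN
  set X : ℝ := M * (∏ p ∈ P, (1 - 1 / p : ℝ) + (1 / 4) ^ k * ∏ p ∈ P, (1 + 2 / p : ℝ)) with hX
  have h2U : (1 : ℝ) ≤ 2 ^ U.card := one_le_pow₀ one_le_two
  have hfin : 2 ^ U.card * N ≤ X + 2 ^ U.card * ((Q + 1) * ((P.card : ℝ) + 1) ^ (2 * k)) := by
    have h5 : ((U.powerset.erase ∅).card : ℝ) * (Q * 𝒮.card) ≤ 2 ^ U.card * (Q * 𝒮.card) := by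
      gcongr
    have h6 : (𝒮.card : ℝ) ≤ 2 ^ U.card * 𝒮.card := le_mul_of_one_le_left (Nat.cast_nonneg _) h2U
    have h7 : (2 : ℝ) ^ U.card * ((Q + 1) * 𝒮.card) ≤
        2 ^ U.card * ((Q + 1) * ((P.card : ℝ) + 1) ^ (2 * k)) := by gcongr
    have h8 : (2 : ℝ) ^ U.card * N ≤ X + 𝒮.card + 2 ^ U.card * (Q * 𝒮.card) := by
      push_cast at hT0 hT1'
      linarith
    linarith
  have h9 : (1 / 2 : ℝ) ^ U.card * 2 ^ U.card = 1 := by rw [← mul_pow]; norm_num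
  calc N = (1 / 2) ^ U.card * (2 ^ U.card * N) := by rw [← mul_assoc, h9, one_mul]
    _ ≤ (1 / 2) ^ U.card * (X + 2 ^ U.card * ((Q + 1) * ((P.card : ℝ) + 1) ^ (2 * k))) := by gcongr
    _ = (1 / 2) ^ U.card * X + (Q + 1) * ((P.card : ℝ) + 1) ^ (2 * k) := by
        rw [mul_add, ← mul_assoc _ ((2 : ℝ) ^ U.card), h9, one_mul]
    _ = _ := by rw [hX]

end Sieve

/-! ### Second moment of character sums over primes -/

section SecondMoment

open scoped NumberTheorySymbols

theorem abs_sum_Ico_jacobiSym_mul_le {p r : ℕ} (hp : p.Prime ∧ p ≠ 2) (hr : r.Prime ∧ r ≠ 2)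
    (hpr : p ≠ r) (κ D D' : ℕ) :
    |∑ c ∈ Finset.Ico D D', J(κ * c | p) * J(κ * c | r)| ≤ 2 * (p * r) := by
  rcases lt_or_ge D' D with h | h
  · rw [Finset.Ico_eq_empty (by omega)]
    simp only [Finset.sum_empty, abs_zero]
    positivity
  have hprod : ∏ s ∈ ({p, r} : Finset ℕ), s = p * r := Finset.prod_pair hpr
  have hV : ∀ s ∈ ({p, r} : Finset ℕ), s.Prime ∧ s ≠ 2 := by
    intro s hs
    rcases Finset.mem_insert.mp hs with rfl | hs
    · exact hp
    · rw [Finset.mem_singleton.mp hs]; exact hr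
  have hb := abs_sum_range_jacobiSym_le ⟨p, Finset.mem_insert_self p {r}⟩ hV
  rw [hprod] at hb
  have e : ∑ c ∈ Finset.Ico D D', J(κ * c | p) * J(κ * c | r) =
      J(κ | p * r) *
        (∑ c ∈ Finset.range D', J(c | p * r) - ∑ c ∈ Finset.range D, J(c | p * r)) := by
    rw [← Finset.sum_Ico_eq_sub _ h, Finset.mul_sum]
    refine Finset.sum_congr rfl fun c _ => ?_
    rw [← jacobiSym.mul_right' _ hp.1.ne_zero hr.1.ne_zero, ← jacobiSym.mul_left]
  rw [e, abs_mul]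
  have h1 := abs_sub (∑ c ∈ Finset.range D', J(c | p * r)) (∑ c ∈ Finset.range D, J(c | p * r))
  have h2 := abs_jacobiSym_le_one κ (p * r)
  have h3 := hb D
  have h4 := hb D'
  push_cast at h3 h4
  nlinarith [abs_nonneg (∑ c ∈ Finset.range D', J(c | p * r) - ∑ c ∈ Finset.range D, J(c | p * r))]

/-- Expanding the square, only the diagonal contributes substantially: for two distinct odd primes
`p` and `r` the symbol modulo `p * r` has bounded sums over intervals. -/
theorem sum_sq_jacobiSym_le {Q : Finset ℕ} (hQ : ∀ p ∈ Q, p.Prime ∧ p ≠ 2) (κ D D' : ℕ) :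
    ∑ c ∈ Finset.Ico D D', (∑ p ∈ Q, (J(κ * c | p) : ℝ) / p) ^ 2 ≤
      (D' - D : ℕ) * ∑ p ∈ Q, ((p : ℝ) ^ 2)⁻¹ + 2 * (Q.card : ℝ) ^ 2 := by
  have h1 : ∑ c ∈ Finset.Ico D D', (∑ p ∈ Q, (J(κ * c | p) : ℝ) / p) ^ 2 =
      ∑ p ∈ Q, ∑ r ∈ Q, (1 / (p * r : ℝ)) *
        (∑ c ∈ Finset.Ico D D', J(κ * c | p) * J(κ * c | r) : ℤ) := by
    simp only [sq, Finset.sum_mul_sum]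
    refine Finset.sum_comm.trans (Finset.sum_congr rfl fun p _ => ?_)
    refine Finset.sum_comm.trans (Finset.sum_congr rfl fun r _ => ?_)
    push_cast
    rw [Finset.mul_sum]
    refine Finset.sum_congr rfl fun c _ => ?_
    rw [div_mul_div_comm]
    ring
  have h2 : ∀ p ∈ Q, ∀ r ∈ Q, (1 / (p * r : ℝ)) *
        (∑ c ∈ Finset.Ico D D', J(κ * c | p) * J(κ * c | r) : ℤ) ≤
      (if p = r then (D' - D : ℕ) * ((p : ℝ) ^ 2)⁻¹ else 0) + 2 := by
    intro p hp r hr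
    have hp0 : (0 : ℝ) < p := by exact_mod_cast (hQ p hp).1.pos
    have hr0 : (0 : ℝ) < r := by exact_mod_cast (hQ r hr).1.pos
    split_ifs with h
    · subst h
      have h3 : ∑ c ∈ Finset.Ico D D', J(κ * c | p) * J(κ * c | p) ≤ (D' - D : ℕ) := by
        refine (Finset.sum_le_card_nsmul _ _ 1 fun c _ => ?_).trans ?_
        · have := abs_le.mp (abs_jacobiSym_le_one (κ * c) p)
          nlinarith
        · simp
      have h4 : ((∑ c ∈ Finset.Ico D D', J(κ * c | p) * J(κ * c | p) : ℤ) : ℝ) ≤ (D' - D : ℕ) := by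
        exact_mod_cast h3
      have h5 : (1 / (p * p : ℝ)) * (∑ c ∈ Finset.Ico D D', J(κ * c | p) * J(κ * c | p) : ℤ) ≤
          (1 / (p * p : ℝ)) * (D' - D : ℕ) := by gcongr
      have h6 : (1 / (p * p : ℝ)) * (D' - D : ℕ) = (D' - D : ℕ) * ((p : ℝ) ^ 2)⁻¹ := by
        rw [sq]; ring
      linarith
    · have h3 := (le_abs_self _).trans (abs_sum_Ico_jacobiSym_mul_le (hQ p hp) (hQ r hr) h κ D D')
      have h4 : ((∑ c ∈ Finset.Ico D D', J(κ * c | p) * J(κ * c | r) : ℤ) : ℝ) ≤ 2 * (p * r) := by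
        exact_mod_cast h3
      rw [zero_add, one_div, inv_mul_le_iff₀ (by positivity)]
      linarith
  rw [h1]
  refine (Finset.sum_le_sum fun p hp => Finset.sum_le_sum fun r hr => h2 p hp r hr).trans ?_
  simp only [Finset.sum_add_distrib, Finset.sum_ite_eq, Finset.sum_const, nsmul_eq_mul]
  rw [Finset.sum_ite_of_true (fun p hp => hp), ← Finset.mul_sum]
  exact le_of_eq (by ring)

/-- Summation of a uniform bound over dyadic intervals. -/
theorem sum_Ico_two_pow_le {f : ℕ → ℝ} {b : ℝ} {A : ℕ}
    (h : ∀ m, A ≤ m → ∑ c ∈ Finset.Ico (2 ^ m) (2 ^ (m + 1)), f c ≤ b) (n : ℕ) :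
    ∑ c ∈ Finset.Ico (2 ^ A) (2 ^ (A + n)), f c ≤ n * b := by
  induction n with
  | zero => simp
  | succ n ih =>
    rw [← add_assoc, ← Finset.sum_Ico_consecutive f
      (Nat.pow_le_pow_right two_pos (Nat.le_add_right A n))
      (Nat.pow_le_pow_right two_pos (Nat.le_succ (A + n)))]
    have := h (A + n) (Nat.le_add_right A n)
    push_cast
    linarith

/-- The integers `c` for which the sum of `(κ c / p) / p` over a set of primes `p > w` is large have
small total weight, by Chebyshev's inequality on each dyadic interval. -/
theorem sum_one_div_exceptional_le {Q : Finset ℕ} {w t : ℕ} (hw : 0 < w) (hwt : w ≤ t)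
    (hQ : ∀ p ∈ Q, p.Prime ∧ p ≠ 2 ∧ w < p ∧ p ≤ t) (κ A n : ℕ) :
    ∑ c ∈ (Finset.Ico (2 ^ A) (2 ^ (A + n))).filter
        (fun c : ℕ => 1 < ∑ p ∈ Q, (J(κ * c | p) : ℝ) / p), (1 / c : ℝ) ≤
      n * (1 / w + 2 * (t : ℝ) ^ 2 / 2 ^ A) := by
  have hsq : ∑ p ∈ Q, ((p : ℝ) ^ 2)⁻¹ ≤ 1 / w := by
    have h1 : Q ⊆ Finset.Ioc w t := fun p hp => Finset.mem_Ioc.mpr (hQ p hp).2.2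
    refine (Finset.sum_le_sum_of_subset_of_nonneg h1 fun p _ _ => by positivity).trans ?_
    refine (sum_Ioc_inv_sq_le_sub hw.ne' hwt).trans ?_
    rw [one_div]
    have : (0 : ℝ) ≤ (t : ℝ)⁻¹ := by positivity
    linarith
  have hcard : (Q.card : ℝ) ≤ t := by
    have h1 : Q ⊆ Finset.Ioc 0 t := fun p hp => Finset.mem_Ioc.mpr
      ⟨(hQ p hp).1.pos, (hQ p hp).2.2.2⟩
    have := Finset.card_le_card h1
    rw [Nat.card_Ioc] at this
    exact_mod_cast this
  rw [Finset.sum_filter]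
  refine sum_Ico_two_pow_le (fun m hm => ?_) n
  have h2m : (0 : ℝ) < 2 ^ m := by positivity
  have h3 : (2 : ℝ) ^ A ≤ 2 ^ m := pow_le_pow_right₀ one_le_two hm
  have hpt : ∀ c ∈ Finset.Ico ((2 : ℕ) ^ m) (2 ^ (m + 1)),
      (if 1 < ∑ p ∈ Q, (J(κ * c | p) : ℝ) / p then (1 / c : ℝ) else 0) ≤
        1 / 2 ^ m * (∑ p ∈ Q, (J(κ * c | p) : ℝ) / p) ^ 2 := by
    intro c hc
    have hc' : (2 : ℝ) ^ m ≤ c := by exact_mod_cast (Finset.mem_Ico.mp hc).1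
    split_ifs with h
    · calc (1 / c : ℝ) ≤ 1 / 2 ^ m := by gcongr
        _ ≤ _ := le_mul_of_one_le_right (by positivity) (one_le_pow₀ h.le)
    · positivity
  refine (Finset.sum_le_sum hpt).trans ?_
  rw [← Finset.mul_sum]
  have h4 := sum_sq_jacobiSym_le (fun p hp => ⟨(hQ p hp).1, (hQ p hp).2.1⟩) κ (2 ^ m) (2 ^ (m + 1))
  have h5 : ((2 ^ (m + 1) - 2 ^ m : ℕ) : ℝ) = 2 ^ m := by
    have : 2 ^ (m + 1) - 2 ^ m = 2 ^ m := by rw [pow_succ]; omega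
    rw [this]; push_cast; rfl
  rw [h5] at h4
  calc _ ≤ 1 / 2 ^ m * (2 ^ m * ∑ p ∈ Q, ((p : ℝ) ^ 2)⁻¹ + 2 * (Q.card : ℝ) ^ 2) := by gcongr
    _ = ∑ p ∈ Q, ((p : ℝ) ^ 2)⁻¹ + 2 * (Q.card : ℝ) ^ 2 / 2 ^ m := by field_simp
    _ ≤ 1 / w + 2 * (t : ℝ) ^ 2 / 2 ^ A := by gcongr

end SecondMoment

/-! ### Sums of multiplicative weights over squarefree integers -/

section Weights

theorem sum_squarefree_le_prod {g : ℕ → ℝ} (hg : ∀ p, 0 ≤ g p) (X : ℕ) :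
    ∑ c ∈ Finset.Icc 1 X with Squarefree c, ∏ p ∈ c.primeFactors, g p ≤
      ∏ p ∈ Nat.primesLE X, (1 + g p) := by
  rw [Finset.prod_one_add]
  have hinj : Set.InjOn Nat.primeFactors ((Finset.Icc 1 X).filter Squarefree : Finset ℕ) := by
    intro c hc d hd h
    have hc := (Finset.mem_filter.mp hc).2
    have hd := (Finset.mem_filter.mp hd).2
    rw [← Nat.prod_primeFactors_of_squarefree hc, ← Nat.prod_primeFactors_of_squarefree hd, h]
  rw [← Finset.sum_image (f := fun S => ∏ p ∈ S, g p) hinj]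
  refine Finset.sum_le_sum_of_subset_of_nonneg (fun S hS => ?_) fun S _ _ =>
    Finset.prod_nonneg fun p _ => hg p
  obtain ⟨c, hc, rfl⟩ := Finset.mem_image.mp hS
  refine Finset.mem_powerset.mpr fun p hp => ?_
  have hc := Finset.mem_Icc.mp (Finset.mem_filter.mp hc).1
  rw [Nat.primesLE_eq_filter_range, Finset.mem_filter, Finset.mem_range, Nat.lt_succ_iff]
  exact ⟨(Nat.le_of_mem_primeFactors hp).trans hc.2, Nat.prime_of_mem_primeFactors hp⟩

theorem prod_one_add_le_exp_sum (P : Finset ℕ) {g : ℕ → ℝ} (hg : ∀ p ∈ P, 0 ≤ g p) :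
    ∏ p ∈ P, (1 + g p) ≤ Real.exp (∑ p ∈ P, g p) := by
  rw [Real.exp_sum]
  refine Finset.prod_le_prod (fun p hp => by linarith [hg p hp]) fun p _ => ?_
  linarith [Real.add_one_le_exp (g p)]

theorem sum_squarefree_le_exp {g : ℕ → ℝ} (hg : ∀ p, 0 ≤ g p) (X : ℕ) :
    ∑ c ∈ Finset.Icc 1 X with Squarefree c, ∏ p ∈ c.primeFactors, g p ≤
      Real.exp (∑ p ∈ Nat.primesLE X, g p) :=
  (sum_squarefree_le_prod hg X).trans (prod_one_add_le_exp_sum _ fun p _ => hg p)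

theorem one_div_eq_prod_primeFactors {c : ℕ} (hc : Squarefree c) :
    (1 / c : ℝ) = ∏ p ∈ c.primeFactors, (1 / p : ℝ) := by
  conv_lhs => rw [← Nat.prod_primeFactors_of_squarefree hc]
  rw [Nat.cast_prod, Finset.prod_div_distrib, Finset.prod_const_one]

theorem sum_primesLE_one_div (X : ℕ) :
    ∑ p ∈ Nat.primesLE X, (1 / p : ℝ) = recipSum (fun _ => True) X := by
  rw [recipSum, Finset.filter_true]

theorem sum_squarefree_one_div_le (X : ℕ) :
    ∑ c ∈ Finset.Icc 1 X with Squarefree c, (1 / c : ℝ) ≤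
      Real.exp (recipSum (fun _ => True) X) := by
  have h := sum_squarefree_le_exp (g := fun p => 1 / (p : ℝ)) (fun p => by positivity) X
  rw [sum_primesLE_one_div] at h
  refine le_trans (le_of_eq (Finset.sum_congr rfl fun c hc => ?_)) h
  exact one_div_eq_prod_primeFactors (Finset.mem_filter.mp hc).2

/-- Integers with many prime factors have small total weight, by comparison with `2 ^ ω(c)`. -/
theorem sum_squarefree_many_primeFactors_le (X h : ℕ) :
    ∑ c ∈ Finset.Icc 1 X with Squarefree c ∧ h < c.primeFactors.card, (1 / c : ℝ) ≤
      (1 / 2) ^ h * Real.exp (2 * recipSum (fun _ => True) X) := by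
  have h1 := sum_squarefree_le_exp (g := fun p => 2 * (1 / (p : ℝ))) (fun p => by positivity) X
  rw [← Finset.mul_sum, sum_primesLE_one_div] at h1
  refine le_trans ?_ (mul_le_mul_of_nonneg_left h1 (by positivity))
  rw [Finset.mul_sum, ← Finset.filter_filter, Finset.sum_filter]
  refine Finset.sum_le_sum fun c hc => ?_
  have e : ∏ p ∈ c.primeFactors, (2 * (1 / (p : ℝ))) = 2 ^ c.primeFactors.card * (1 / c) := by
    rw [Finset.prod_mul_distrib, Finset.prod_const,
      ← one_div_eq_prod_primeFactors (Finset.mem_filter.mp hc).2]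
  rw [e]
  split_ifs with hlt
  · have h3 : (1 : ℝ) ≤ (1 / 2) ^ h * 2 ^ c.primeFactors.card := by
      calc (1 : ℝ) = (1 / 2) ^ h * 2 ^ h := by rw [← mul_pow]; norm_num
        _ ≤ _ := by
          gcongr
          exact one_le_two
    rw [← mul_assoc]
    exact le_mul_of_one_le_left (by positivity) h3
  · positivity

end Weights

/-! ### Linked pairs -/

section Linked

open scoped NumberTheorySymbols

/-- The conditions tying the two factors of a squarefree integer together, up to the prime `2`:
`c` is squarefree, each odd prime `p ∣ c` satisfies `A` and has `(κ d / p) = 1`, and each odd prime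
`p ∣ d` satisfies `B` and has `(κ c / p) = 1`. -/
def Linked (κ : ℕ) (A B : ℕ → Prop) (c d : ℕ) : Prop :=
  Squarefree c ∧ (∀ p : ℕ, p.Prime → p ≠ 2 → p ∣ c → A p ∧ J(κ * d | p) = 1) ∧
    ∀ p : ℕ, p.Prime → p ≠ 2 → p ∣ d → B p ∧ J(κ * c | p) = 1

noncomputable instance (κ : ℕ) (A B : ℕ → Prop) (c : ℕ) : DecidablePred (Linked κ A B c) :=
  Classical.decPred _

/-- The odd primes `p ≤ t` that cannot divide the second entry of a linked pair with first
entry `c`. -/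
def excludedPrimes (κ : ℕ) (B : ℕ → Prop) [DecidablePred B] (c t : ℕ) : Finset ℕ :=
  (Nat.primesLE t).filter fun p => p ≠ 2 ∧ ¬(B p ∧ J(κ * c | p) = 1)

/-- The odd prime factors of `c` that are at most `t`. -/
def smallPrimeFactors (c t : ℕ) : Finset ℕ :=
  c.primeFactors.filter fun p => p ≠ 2 ∧ p ≤ t

variable {κ : ℕ} {A B : ℕ → Prop} [DecidablePred A] [DecidablePred B]

theorem mem_primesLE_iff {p t : ℕ} : p ∈ Nat.primesLE t ↔ p ≤ t ∧ p.Prime := by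
  rw [Nat.primesLE_eq_filter_range, Finset.mem_filter, Finset.mem_range, Nat.lt_succ_iff]

theorem card_primesLE_le (t : ℕ) : (Nat.primesLE t).card ≤ t := by
  have h : Nat.primesLE t ⊆ Finset.Ioc 0 t := fun p hp => by
    rw [mem_primesLE_iff] at hp
    exact Finset.mem_Ioc.mpr ⟨hp.2.pos, hp.1⟩
  simpa using Finset.card_le_card h

theorem primesLE_filter_le {t X : ℕ} (h : t ≤ X) :
    (Nat.primesLE X).filter (· ≤ t) = Nat.primesLE t := by
  ext p
  simp only [Finset.mem_filter, mem_primesLE_iff]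
  constructor
  · rintro ⟨⟨_, h2⟩, h3⟩; exact ⟨h3, h2⟩
  · rintro ⟨h1, h2⟩; exact ⟨⟨h1.trans h, h2⟩, h1⟩

/-- The sieve bound for linked pairs with a given first entry, using only the primes up to `t`. -/
theorem card_linked_le (A : ℕ → Prop) (c t M k : ℕ) :
    (((Finset.Icc 1 M).filter (Linked κ A B c)).card : ℝ) ≤
      (1 / 2) ^ (smallPrimeFactors c t).card *
        (M * (∏ p ∈ excludedPrimes κ B c t, (1 - 1 / p : ℝ) +
          (1 / 4) ^ k * ∏ p ∈ excludedPrimes κ B c t, (1 + 2 / p : ℝ))) +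
      ((∏ p ∈ smallPrimeFactors c t, p : ℕ) + 1) *
        (((excludedPrimes κ B c t).card : ℝ) + 1) ^ (2 * k) := by
  refine le_trans ?_ (card_sieve_le (U := smallPrimeFactors c t) (P := excludedPrimes κ B c t)
    (fun p hp => ?_) (fun p hp => ?_) κ M k)
  · refine Nat.cast_le.mpr (Finset.card_le_card fun d hd => ?_)
    rw [Finset.mem_filter] at hd ⊢
    refine ⟨hd.1, fun p hp => ?_, fun p hp hpd => ?_⟩
    · have hp := Finset.mem_filter.mp hp
      exact (hd.2.2.1 p (Nat.prime_of_mem_primeFactors hp.1) hp.2.1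
        (Nat.dvd_of_mem_primeFactors hp.1)).2
    · have hp := Finset.mem_filter.mp hp
      exact hp.2.2 (hd.2.2.2 p (mem_primesLE_iff.mp hp.1).2 hp.2.1 hpd)
  · have hp := Finset.mem_filter.mp hp
    exact ⟨Nat.prime_of_mem_primeFactors hp.1, hp.2.1⟩
  · exact (mem_primesLE_iff.mp (Finset.mem_filter.mp hp).1).2

theorem prod_one_add_excludedPrimes_le (κ c t : ℕ) :
    ∏ p ∈ excludedPrimes κ B c t, (1 + 2 / p : ℝ) ≤
      Real.exp (2 * recipSum (fun _ => True) t) := by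
  refine (prod_one_add_le_exp_sum _ fun p _ => by positivity).trans (Real.exp_le_exp.mpr ?_)
  rw [← sum_primesLE_one_div, Finset.mul_sum]
  refine (Finset.sum_le_sum_of_subset_of_nonneg (Finset.filter_subset _ _) fun p _ _ => by
    positivity).trans (le_of_eq (Finset.sum_congr rfl fun p _ => by ring))

theorem sum_filter_two_eq_le (P : Finset ℕ) : ∑ p ∈ P with 2 = p, (1 : ℝ) ≤ 1 := by
  have : (P.filter fun p => 2 = p).card ≤ 1 :=
    Finset.card_le_one.mpr fun a ha b hb =>
      (Finset.mem_filter.mp ha).2.symm.trans (Finset.mem_filter.mp hb).2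
  rw [Finset.sum_const, nsmul_eq_mul, mul_one]
  exact_mod_cast this

/-- The odd primes in `(w, t]` with the property `B`. -/
def midPrimes (B : ℕ → Prop) [DecidablePred B] (w t : ℕ) : Finset ℕ :=
  (Nat.primesLE t).filter fun p => p ≠ 2 ∧ w < p ∧ B p

/-- If the character sum over `midPrimes` is at most `1`, then half of the primes with property `B`
and all the other ones are excluded. -/
theorem prod_one_sub_excludedPrimes_le {c w t : ℕ} (hwt : w ≤ t)
    (hS : ∑ p ∈ midPrimes B w t, (J(κ * c | p) : ℝ) / p ≤ 1) :
    ∏ p ∈ excludedPrimes κ B c t, (1 - 1 / p : ℝ) ≤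
      Real.exp (-(recipSum (fun p => ¬B p) t + recipSum B t / 2) +
        recipSum (fun _ => True) w / 2 + 1) := by
  have h1 : ∏ p ∈ excludedPrimes κ B c t, (1 - 1 / p : ℝ) ≤
      Real.exp (∑ p ∈ excludedPrimes κ B c t, -(1 / p : ℝ)) := by
    rw [Real.exp_sum]
    refine Finset.prod_le_prod (fun p hp => ?_) fun p _ => ?_
    · have : (1 : ℝ) ≤ p := by
        exact_mod_cast (mem_primesLE_iff.mp (Finset.mem_filter.mp hp).1).2.one_le
      rw [sub_nonneg]
      exact div_le_one_of_le₀ this (by linarith)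
    · linarith [Real.add_one_le_exp (-(1 / p : ℝ))]
  refine h1.trans (Real.exp_le_exp.mpr ?_)
  rw [Finset.sum_neg_distrib]
  have hpt : ∀ p ∈ Nat.primesLE t, (if ¬B p then (1 / p : ℝ) else 0) +
      (if B p then (1 / p : ℝ) else 0) / 2 - (if p ≤ w then (1 / p : ℝ) else 0) / 2 -
        (if p ≠ 2 ∧ w < p ∧ B p then (J(κ * c | p) : ℝ) / p else 0) / 2 -
          (if 2 = p then (1 / 2 : ℝ) else 0) ≤
      if p ≠ 2 ∧ ¬(B p ∧ J(κ * c | p) = 1) then (1 / p : ℝ) else 0 := by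
    intro p _
    have hp0 : (0 : ℝ) ≤ 1 / p := by positivity
    rcases eq_or_ne p 2 with rfl | h2
    · by_cases hB : B 2 <;> by_cases hw : 2 ≤ w <;> norm_num [hB, hw]
    · have h2' : ¬ 2 = p := fun h => h2 h.symm
      by_cases hB : B p
      · by_cases hw : p ≤ w
        · have hw' : ¬ w < p := by omega
          simp only [hB, hw, hw', h2, h2', not_true_eq_false, if_false, if_true, ne_eq,
            not_false_eq_true, true_and, false_and]
          split_ifs <;> linarith
        · have hw' : w < p := by omega
          simp only [hB, hw, hw', h2, h2', not_true_eq_false, if_false, if_true, ne_eq,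
            not_false_eq_true, true_and]
          split_ifs with hJ
          · rw [hJ]
            push_cast
            linarith
          · have h3 := (abs_le.mp (abs_jacobiSym_le_one (κ * c) p)).1
            have h4 : (-1 : ℝ) ≤ J(κ * c | p) := by exact_mod_cast h3
            have h5 : (-1 : ℝ) * (1 / p) ≤ (J(κ * c | p) : ℝ) * (1 / p) :=
              mul_le_mul_of_nonneg_right h4 hp0
            rw [neg_one_mul, mul_one_div] at h5
            linarith
      · simp only [hB, h2, h2', not_false_eq_true, if_true, if_false, ne_eq, false_and, and_false,
          and_self]
        split_ifs <;> linarith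
  have hsum := Finset.sum_le_sum hpt
  simp only [Finset.sum_sub_distrib, Finset.sum_add_distrib, ← Finset.sum_div,
    ← Finset.sum_filter] at hsum
  rw [primesLE_filter_le hwt, sum_primesLE_one_div] at hsum
  have h3 := sum_filter_two_eq_le (Nat.primesLE t)
  have e1 : ∑ p ∈ excludedPrimes κ B c t, (1 / p : ℝ) =
      ∑ p ∈ Nat.primesLE t with p ≠ 2 ∧ ¬(B p ∧ J(κ * c | p) = 1), (1 / p : ℝ) := rfl
  rw [e1]
  have e2 : recipSum (fun p => ¬B p) t = ∑ p ∈ Nat.primesLE t with ¬B p, (1 / p : ℝ) := rfl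
  have e3 : recipSum B t = ∑ p ∈ Nat.primesLE t with B p, (1 / p : ℝ) := rfl
  have e4 : ∑ p ∈ midPrimes B w t, (J(κ * c | p) : ℝ) / p =
    ∑ p ∈ Nat.primesLE t with p ≠ 2 ∧ w < p ∧ B p, (J(κ * c | p) : ℝ) / p := rfl
  rw [e4] at hS
  rw [e2, e3]
  linarith

/-- The weighted number of possible first entries of linked pairs. -/
theorem sum_pow_card_smallPrimeFactors_le {t X : ℕ} (htX : t ≤ X) :
    ∑ c ∈ Finset.Icc 1 X with Squarefree c ∧ ∀ p ∈ c.primeFactors, p ≠ 2 → A p,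
        (1 / 2 : ℝ) ^ (smallPrimeFactors c t).card * (1 / c) ≤
      Real.exp (recipSum A t / 2 + (recipSum (fun _ => True) X - recipSum (fun _ => True) t)
        + 1) := by
  set g : ℕ → ℝ := fun p => (if p ≠ 2 ∧ p ≤ t then (if A p then 1 / 2 else 0) else 1) * (1 / p)
    with hg
  have hg0 : ∀ p, 0 ≤ g p := fun p => by
    simp only [hg]
    split_ifs <;> positivity
  have h1 := sum_squarefree_le_exp hg0 X
  have h2 : ∑ p ∈ Nat.primesLE X, g p ≤
      recipSum A t / 2 + (recipSum (fun _ => True) X - recipSum (fun _ => True) t) + 1 := by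
    have hpt : ∀ p ∈ Nat.primesLE X, g p ≤
        (if p ≤ t then if A p then (1 / p : ℝ) else 0 else 0) / 2 +
        (if ¬p ≤ t then (1 / p : ℝ) else 0) + (if 2 = p then (1 / 2 : ℝ) else 0) := by
      intro p _
      have hp0 : (0 : ℝ) ≤ 1 / p := by positivity
      simp only [hg]
      rcases eq_or_ne p 2 with rfl | h2
      · split_ifs <;> norm_num at *
      · have h2' : ¬ 2 = p := fun h => h2 h.symm
        simp only [h2, h2', ne_eq, not_false_eq_true, true_and, if_false]
        split_ifs <;> linarith
    refine (Finset.sum_le_sum hpt).trans ?_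
    simp only [Finset.sum_add_distrib, ← Finset.sum_div, ← Finset.sum_filter]
    rw [primesLE_filter_le htX]
    have h3 := sum_filter_two_eq_le (Nat.primesLE X)
    have h4 : ∑ p ∈ Nat.primesLE X with ¬p ≤ t, (1 / p : ℝ) =
        recipSum (fun _ => True) X - recipSum (fun _ => True) t := by
      rw [← sum_primesLE_one_div, ← sum_primesLE_one_div,
        ← Finset.sum_filter_add_sum_filter_not (Nat.primesLE X) (· ≤ t), primesLE_filter_le htX]
      ring
    rw [h4]
    have e3 : recipSum A t = ∑ p ∈ Nat.primesLE t with A p, (1 / p : ℝ) := rfl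
    rw [e3]
    linarith
  refine le_trans ?_ (h1.trans (Real.exp_le_exp.mpr h2))
  rw [← Finset.filter_filter, Finset.sum_filter]
  refine Finset.sum_le_sum fun c hc => ?_
  split_ifs with hA
  · rw [one_div_eq_prod_primeFactors (Finset.mem_filter.mp hc).2, smallPrimeFactors,
      ← Finset.prod_const, Finset.prod_filter, ← Finset.prod_mul_distrib]
    refine le_of_eq (Finset.prod_congr rfl fun p hp => ?_)
    simp only [hg]
    split_ifs with h3 h4
    · rfl
    · exact absurd (hA p hp h3.1) h4
    · rfl
  · exact Finset.prod_nonneg fun p _ => hg0 p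

end Linked

/-! ### Linked pairs with first entry in a doubly exponential block -/

section Block

open scoped NumberTheorySymbols

variable {κ : ℕ} {A B : ℕ → Prop} [DecidablePred A] [DecidablePred B]

/-- The end points of the doubly exponential blocks. -/
@[irreducible] def blockStart (i : ℕ) : ℕ := 2 ^ 2 ^ (20 * i)

/-- The sieving limit used for the block with index `i`. -/
@[irreducible] def blockLevel (i : ℕ) : ℕ := 2 ^ 2 ^ (19 * i)

/-- The primes below this bound are ignored in the character sums for the block with index `i`. -/
@[irreducible] def blockCutoff (i : ℕ) : ℕ := 2 ^ 2 ^ i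

theorem blockStart_pos (i : ℕ) : 0 < blockStart i := by
  rw [blockStart]
  positivity

theorem blockCutoff_pos (i : ℕ) : 0 < blockCutoff i := by
  rw [blockCutoff]
  positivity

theorem blockCutoff_le_blockLevel (i : ℕ) : blockCutoff i ≤ blockLevel i := by
  rw [blockCutoff, blockLevel]
  exact Nat.pow_le_pow_right two_pos (Nat.pow_le_pow_right two_pos (by omega))

theorem blockLevel_le_blockStart_succ (i : ℕ) : blockLevel i ≤ blockStart (i + 1) := by
  rw [blockLevel, blockStart]
  exact Nat.pow_le_pow_right two_pos (Nat.pow_le_pow_right two_pos (by omega))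

theorem two_pow_twenty_mul_ge {i : ℕ} (hi : 300 * i + 100 ≤ 2 ^ i) :
    (300 * i + 100) * 2 ^ (19 * i) ≤ 2 ^ (20 * i) := by
  have e : 2 ^ (20 * i) = 2 ^ i * 2 ^ (19 * i) := by rw [← pow_add]; congr 1; ring
  rw [e]
  exact Nat.mul_le_mul_right _ hi

theorem add_two_pow_nineteen_mul_le {i : ℕ} (hi : 300 * i + 100 ≤ 2 ^ i) :
    i + (20 * (i + 1) + (1 + 2 ^ (19 * i) * 2)) ≤ 2 ^ (20 * i) := by
  have h5 := two_pow_twenty_mul_ge hi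
  have h6 : 1 ≤ 2 ^ (19 * i) := Nat.one_le_two_pow
  generalize 2 ^ (19 * i) = u at *
  generalize 2 ^ (20 * i) = v at *
  have h7 := Nat.le_mul_of_pos_right i h6
  nlinarith

/-- For a first entry with at most `80 i` prime factors, the error term of the sieve is at most
`t ^ (240 i + 1)` with the sieving limit `t`, which is small against the start of the block because
`2 ^ (20 i)` is larger than `(240 i + 1) * 2 ^ (19 i)`. -/
theorem sieve_error_le {i : ℕ} (hi : 300 * i + 100 ≤ 2 ^ i) {c : ℕ}
    (hc : c.primeFactors.card ≤ 80 * i) (κ : ℕ) :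
    (∏ p ∈ smallPrimeFactors c (blockLevel i), p + 1) *
      ((excludedPrimes κ B c (blockLevel i)).card + 1) ^ (2 * (40 * i)) * 2 ^ (22 * i) ≤
        blockStart i := by
  set t := blockLevel i with ht
  have ht2 : 2 ≤ t := by
    rw [ht, blockLevel]
    exact Nat.le_self_pow (pow_ne_zero _ two_ne_zero) 2
  have h1 : ∏ p ∈ smallPrimeFactors c t, p ≤ t ^ (80 * i) := by
    refine (Finset.prod_le_pow_card _ _ t fun p hp => (Finset.mem_filter.mp hp).2.2).trans ?_
    exact Nat.pow_le_pow_right (by omega) ((Finset.card_filter_le _ _).trans hc)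
  have h2 : ∏ p ∈ smallPrimeFactors c t, p + 1 ≤ t ^ (80 * i + 1) := by
    have : 1 ≤ t ^ (80 * i) := Nat.one_le_pow _ _ (by omega)
    rw [pow_succ]
    nlinarith
  have h3 : (excludedPrimes κ B c t).card + 1 ≤ t ^ 2 := by
    have := (Finset.card_filter_le (Nat.primesLE t)
      fun p => p ≠ 2 ∧ ¬(B p ∧ J(κ * c | p) = 1)).trans (card_primesLE_le t)
    rw [excludedPrimes]
    nlinarith
  have h4 : ((excludedPrimes κ B c t).card + 1) ^ (2 * (40 * i)) ≤ t ^ (160 * i) := by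
    refine (Nat.pow_le_pow_left h3 _).trans (le_of_eq ?_)
    rw [← pow_mul]; congr 1; ring
  have h5 := two_pow_twenty_mul_ge hi
  have h6 : 1 ≤ 2 ^ (19 * i) := Nat.one_le_two_pow
  calc _ ≤ t ^ (80 * i + 1) * t ^ (160 * i) * 2 ^ (22 * i) := by gcongr
    _ = 2 ^ (2 ^ (19 * i) * (240 * i + 1) + 22 * i) := by
        rw [ht, blockLevel, ← pow_add, ← pow_mul, ← pow_add]
        congr 2
        ring
    _ ≤ blockStart i := by
        rw [blockStart]
        exact Nat.pow_le_pow_right two_pos (by nlinarith)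

/-- The pairs with a given first entry. The four terms stand for the first entries with too many
prime factors and those with a large character sum, which are both estimated trivially, and for
the main term and the error term of the sieve. -/
theorem card_linked_block_le {i : ℕ} (hi : 300 * i + 100 ≤ 2 ^ i) {c : ℕ} (hc : blockStart i ≤ c)
    (A : ℕ → Prop) [DecidablePred A] (N : ℕ) :
    (((Finset.Icc c (N / c)).filter (Linked κ A B c)).card : ℝ) ≤
      N * ((if Squarefree c ∧ 80 * i < c.primeFactors.card then (1 / c : ℝ) else 0) +
        (if 1 < ∑ p ∈ midPrimes B (blockCutoff i) (blockLevel i), (J(κ * c | p) : ℝ) / p then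
          (1 / c : ℝ) else 0) +
        (Real.exp (-(recipSum (fun p => ¬B p) (blockLevel i) + recipSum B (blockLevel i) / 2) +
            recipSum (fun _ => True) (blockCutoff i) / 2 + 1) +
          (1 / 4) ^ (40 * i) * Real.exp (2 * recipSum (fun _ => True) (blockLevel i))) *
          (if Squarefree c ∧ ∀ p ∈ c.primeFactors, p ≠ 2 → A p then
            (1 / 2 : ℝ) ^ (smallPrimeFactors c (blockLevel i)).card * (1 / c) else 0) +
        (1 / 2) ^ (22 * i) * (if Squarefree c then (1 / c : ℝ) else 0)) := by
  set t := blockLevel i with ht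
  set w := blockCutoff i with hw
  set S : ℝ := ∑ p ∈ midPrimes B w t, (J(κ * c | p) : ℝ) / p with hS
  set v : ℝ := Real.exp (-(recipSum (fun p => ¬B p) t + recipSum B t / 2) +
    recipSum (fun _ => True) w / 2 + 1) +
      (1 / 4) ^ (40 * i) * Real.exp (2 * recipSum (fun _ => True) t) with hv
  have hv0 : 0 ≤ v := by positivity
  set X₁ : ℝ := if Squarefree c ∧ 80 * i < c.primeFactors.card then (1 / c : ℝ) else 0 with hX₁
  set X₂ : ℝ := if 1 < S then (1 / c : ℝ) else 0 with hX₂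
  set X₃ : ℝ := if Squarefree c ∧ ∀ p ∈ c.primeFactors, p ≠ 2 → A p then
    (1 / 2 : ℝ) ^ (smallPrimeFactors c t).card * (1 / c) else 0 with hX₃
  set X₄ : ℝ := if Squarefree c then (1 / c : ℝ) else 0 with hX₄
  have h₁ : 0 ≤ X₁ := by rw [hX₁]; split_ifs <;> positivity
  have h₂ : 0 ≤ X₂ := by rw [hX₂]; split_ifs <;> positivity
  have h₃ : 0 ≤ v * X₃ := mul_nonneg hv0 (by rw [hX₃]; split_ifs <;> positivity)
  have h₄ : 0 ≤ (1 / 2) ^ (22 * i) * X₄ := by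
    refine mul_nonneg (by positivity) ?_
    rw [hX₄]; split_ifs <;> positivity
  have hN : (0 : ℝ) ≤ N := N.cast_nonneg
  have hcpos : 0 < c := (blockStart_pos i).trans_le hc
  have hc0 : (0 : ℝ) < c := by exact_mod_cast hcpos
  rcases (((Finset.Icc c (N / c)).filter (Linked κ A B c))).eq_empty_or_nonempty with he | ⟨d, hd⟩
  · rw [he, Finset.card_empty, Nat.cast_zero]
    positivity
  rw [Finset.mem_filter, Finset.mem_Icc] at hd
  obtain ⟨⟨hd1, hd2⟩, hsq, hA, -⟩ := hd
  have hfloor : ((N / c : ℕ) : ℝ) ≤ N * (1 / c) := by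
    rw [mul_one_div]
    exact Nat.cast_div_le
  have hsub : (Finset.Icc c (N / c)).filter (Linked κ A B c) ⊆
      (Finset.Icc 1 (N / c)).filter (Linked κ A B c) :=
    Finset.filter_subset_filter _ (Finset.Icc_subset_Icc_left hcpos)
  have hle := Finset.card_le_card hsub
  have htriv : (((Finset.Icc c (N / c)).filter (Linked κ A B c)).card : ℝ) ≤ N * (1 / c) := by
    have h := hle.trans (Finset.card_filter_le _ _)
    rw [Nat.card_Icc, Nat.add_sub_cancel] at h
    exact le_trans (by exact_mod_cast h) hfloor
  by_cases h80 : 80 * i < c.primeFactors.card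
  · have e : X₁ = 1 / c := if_pos ⟨hsq, h80⟩
    refine htriv.trans (mul_le_mul_of_nonneg_left ?_ hN)
    linarith
  by_cases hS1 : 1 < S
  · have e : X₂ = 1 / c := if_pos hS1
    refine htriv.trans (mul_le_mul_of_nonneg_left ?_ hN)
    linarith
  have e3 : X₃ = (1 / 2 : ℝ) ^ (smallPrimeFactors c t).card * (1 / c) :=
    if_pos ⟨hsq, fun p hp h2 =>
      (hA p (Nat.prime_of_mem_primeFactors hp) h2 (Nat.dvd_of_mem_primeFactors hp)).1⟩
  have e4 : X₄ = 1 / c := if_pos hsq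
  have hwt : w ≤ t := blockCutoff_le_blockLevel i
  have hsieve := card_linked_le (κ := κ) (B := B) A c t (N / c) (40 * i)
  have hprod : ∏ p ∈ excludedPrimes κ B c t, (1 - 1 / p : ℝ) +
      (1 / 4) ^ (40 * i) * ∏ p ∈ excludedPrimes κ B c t, (1 + 2 / p : ℝ) ≤ v := by
    refine add_le_add (prod_one_sub_excludedPrimes_le hwt (not_lt.mp hS1)) ?_
    exact mul_le_mul_of_nonneg_left (prod_one_add_excludedPrimes_le κ c t) (by positivity)
  have herr : ((∏ p ∈ smallPrimeFactors c t, p : ℕ) + 1 : ℝ) *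
      (((excludedPrimes κ B c t).card : ℝ) + 1) ^ (2 * (40 * i)) ≤
        (1 / 2) ^ (22 * i) * (N * (1 / c)) := by
    have h1 := sieve_error_le (B := B) hi (not_lt.mp h80) κ
    have h2 : ((∏ p ∈ smallPrimeFactors c t, p : ℕ) + 1 : ℝ) *
      (((excludedPrimes κ B c t).card : ℝ) + 1) ^ (2 * (40 * i)) * 2 ^ (22 * i) ≤
        blockStart i := by exact_mod_cast h1
    have h3 : (blockStart i : ℝ) ≤ N * (1 / c) := by
      refine le_trans ?_ hfloor
      exact_mod_cast hc.trans (hd1.trans hd2)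
    have h4 : (1 / 2 : ℝ) ^ (22 * i) * 2 ^ (22 * i) = 1 := by rw [← mul_pow]; norm_num
    calc _ = (1 / 2 : ℝ) ^ (22 * i) * (((∏ p ∈ smallPrimeFactors c t, p : ℕ) + 1 : ℝ) *
        (((excludedPrimes κ B c t).card : ℝ) + 1) ^ (2 * (40 * i)) * 2 ^ (22 * i)) := by
          rw [mul_left_comm ((1 / 2 : ℝ) ^ (22 * i)) _ ((2 : ℝ) ^ (22 * i)), h4, mul_one]
      _ ≤ _ := by
          refine mul_le_mul_of_nonneg_left (h2.trans h3) (by positivity)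
  have hmain : (((Finset.Icc c (N / c)).filter (Linked κ A B c)).card : ℝ) ≤
      (1 / 2) ^ (smallPrimeFactors c t).card * (N * (1 / c) * v) +
        (1 / 2) ^ (22 * i) * (N * (1 / c)) := by
    refine (Nat.cast_le.mpr hle).trans (hsieve.trans (add_le_add ?_ herr))
    refine mul_le_mul_of_nonneg_left ?_ (by positivity)
    exact (mul_le_mul_of_nonneg_left hprod (Nat.cast_nonneg _)).trans
      (mul_le_mul_of_nonneg_right hfloor hv0)
  rw [e3, e4]
  refine hmain.trans ?_
  have e5 : (1 / 2 : ℝ) ^ (smallPrimeFactors c t).card * (N * (1 / c) * v) +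
        (1 / 2) ^ (22 * i) * (N * (1 / c)) =
      N * (v * ((1 / 2 : ℝ) ^ (smallPrimeFactors c t).card * (1 / c)) +
        (1 / 2) ^ (22 * i) * (1 / c)) := by ring
  rw [e5]
  refine mul_le_mul_of_nonneg_left ?_ hN
  linarith

/-- The total weight of the first entries of a block with a large character sum. -/
theorem exceptional_weight_le {i : ℕ} (hi : 300 * i + 100 ≤ 2 ^ i) (κ : ℕ) :
    ∑ c ∈ Finset.Ico (blockStart i) (blockStart (i + 1)),
      (if 1 < ∑ p ∈ midPrimes B (blockCutoff i) (blockLevel i), (J(κ * c | p) : ℝ) / p then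
          (1 / c : ℝ) else 0) ≤ 2 * (1 / 2) ^ i := by
  have hle : 2 ^ (20 * i) ≤ 2 ^ (20 * (i + 1)) := Nat.pow_le_pow_right two_pos (by omega)
  obtain ⟨n, hn⟩ := Nat.exists_eq_add_of_le hle
  have hwt := blockCutoff_le_blockLevel i
  have h := sum_one_div_exceptional_le (Q := midPrimes B (blockCutoff i) (blockLevel i))
    (w := blockCutoff i) (t := blockLevel i) (blockCutoff_pos i) hwt (fun p hp => by
      have hp := Finset.mem_filter.mp hp
      have hp' := mem_primesLE_iff.mp hp.1
      exact ⟨hp'.2, hp.2.1, hp.2.2.1, hp'.1⟩) κ (2 ^ (20 * i)) n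
  rw [← hn, Finset.sum_filter, ← blockStart, ← blockStart] at h
  refine h.trans ?_
  have hn' : (n : ℝ) ≤ 2 ^ (20 * (i + 1)) := by
    have : n ≤ 2 ^ (20 * (i + 1)) := by rw [hn]; exact Nat.le_add_left _ _
    exact_mod_cast this
  have hexp := add_two_pow_nineteen_mul_le hi
  have half (m : ℕ) : (1 / 2 : ℝ) ^ m * 2 ^ m = 1 := by rw [← mul_pow]; norm_num
  have h7 : (2 : ℝ) ^ (20 * (i + 1)) * (1 / blockCutoff i) ≤ (1 / 2) ^ i := by
    rw [mul_one_div, blockCutoff, Nat.cast_pow, Nat.cast_ofNat, div_le_iff₀ (by positivity)]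
    calc (2 : ℝ) ^ (20 * (i + 1)) = (1 / 2) ^ i * (2 ^ i * 2 ^ (20 * (i + 1))) := by
          rw [← mul_assoc, half, one_mul]
      _ = (1 / 2) ^ i * 2 ^ (i + 20 * (i + 1)) := by rw [pow_add 2 i]
      _ ≤ (1 / 2) ^ i * 2 ^ 2 ^ i :=
          mul_le_mul_of_nonneg_left (pow_le_pow_right₀ one_le_two (by omega)) (by positivity)
  have h8 : (2 : ℝ) ^ (20 * (i + 1)) * (2 * (blockLevel i : ℝ) ^ 2 / 2 ^ 2 ^ (20 * i)) ≤
      (1 / 2) ^ i := by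
    rw [mul_div_assoc', blockLevel, Nat.cast_pow, Nat.cast_ofNat, div_le_iff₀ (by positivity)]
    calc (2 : ℝ) ^ (20 * (i + 1)) * (2 * (2 ^ 2 ^ (19 * i)) ^ 2)
        = (1 / 2) ^ i * (2 ^ i * (2 ^ (20 * (i + 1)) * (2 * (2 ^ 2 ^ (19 * i)) ^ 2))) := by
          rw [← mul_assoc ((1 / 2 : ℝ) ^ i), half, one_mul]
      _ = (1 / 2) ^ i * 2 ^ (i + (20 * (i + 1) + (1 + 2 ^ (19 * i) * 2))) := by
          rw [pow_add 2 i, pow_add 2 (20 * (i + 1)), pow_add 2 1, pow_mul 2 (2 ^ (19 * i)), pow_one]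
      _ ≤ (1 / 2) ^ i * 2 ^ 2 ^ (20 * i) :=
          mul_le_mul_of_nonneg_left (pow_le_pow_right₀ one_le_two hexp) (by positivity)
  generalize (2 : ℝ) ^ (20 * (i + 1)) = a at hn' h7 h8
  have h9 : 0 ≤ 1 / (blockCutoff i : ℝ) + 2 * (blockLevel i : ℝ) ^ 2 / 2 ^ 2 ^ (20 * i) :=
    add_nonneg (div_nonneg zero_le_one (Nat.cast_nonneg _))
      (div_nonneg (mul_nonneg zero_le_two (sq_nonneg _)) (pow_nonneg zero_le_two _))
  have h10 := mul_le_mul_of_nonneg_right hn' h9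
  rw [mul_add a] at h10
  linarith

/-- The block bound in terms of sums over primes. -/
theorem sum_card_linked_block_le {i : ℕ} (hi : 300 * i + 100 ≤ 2 ^ i) (κ : ℕ) (A B : ℕ → Prop)
    [DecidablePred A] [DecidablePred B] (N : ℕ) :
    ∑ c ∈ Finset.Ico (blockStart i) (blockStart (i + 1)),
      (((Finset.Icc c (N / c)).filter (Linked κ A B c)).card : ℝ) ≤
      N * ((1 / 2) ^ (80 * i) * Real.exp (2 * recipSum (fun _ => True) (blockStart (i + 1))) +
        2 * (1 / 2) ^ i +
        (Real.exp (-(recipSum (fun p => ¬B p) (blockLevel i) + recipSum B (blockLevel i) / 2) +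
            recipSum (fun _ => True) (blockCutoff i) / 2 + 1) +
          (1 / 4) ^ (40 * i) * Real.exp (2 * recipSum (fun _ => True) (blockLevel i))) *
          Real.exp (recipSum A (blockLevel i) / 2 + (recipSum (fun _ => True) (blockStart (i + 1)) -
            recipSum (fun _ => True) (blockLevel i)) + 1) +
        (1 / 2) ^ (22 * i) * Real.exp (recipSum (fun _ => True) (blockStart (i + 1)))) := by
  refine (Finset.sum_le_sum fun c hc =>
    card_linked_block_le hi (Finset.mem_Ico.mp hc).1 A N).trans ?_
  rw [← Finset.mul_sum]
  refine mul_le_mul_of_nonneg_left ?_ N.cast_nonneg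
  simp only [Finset.sum_add_distrib, ← Finset.mul_sum]
  have hsub : Finset.Ico (blockStart i) (blockStart (i + 1)) ⊆ Finset.Icc 1 (blockStart (i + 1)) :=
    fun c hc => by
      rw [Finset.mem_Ico] at hc
      exact Finset.mem_Icc.mpr ⟨(blockStart_pos i).trans_le hc.1, hc.2.le⟩
  have hext {f : ℕ → ℝ} {P : ℕ → Prop} [DecidablePred P] (hf : ∀ c, 0 ≤ f c) :
      ∑ c ∈ Finset.Ico (blockStart i) (blockStart (i + 1)), (if P c then f c else 0) ≤
        ∑ c ∈ Finset.Icc 1 (blockStart (i + 1)) with P c, f c := by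
    rw [← Finset.sum_filter]
    exact Finset.sum_le_sum_of_subset_of_nonneg (Finset.filter_subset_filter _ hsub)
      fun c _ _ => hf c
  have htX := blockLevel_le_blockStart_succ i
  refine add_le_add (add_le_add (add_le_add ?_ (exceptional_weight_le hi κ)) ?_) ?_
  · exact (hext fun c => by positivity).trans (sum_squarefree_many_primeFactors_le _ _)
  · refine mul_le_mul_of_nonneg_left ?_ (by positivity)
    exact (hext fun c => by positivity).trans (sum_pow_card_smallPrimeFactors_le htX)
  · refine mul_le_mul_of_nonneg_left ?_ (by positivity)
    exact (hext fun c => by positivity).trans (sum_squarefree_one_div_le _)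

/-- The contribution of a block decays geometrically, as soon as the density `α` of the primes
allowed in the first entry and the sieve density `β` satisfy `α / 2 + 1 / 4 ≤ β`. -/
theorem exists_sum_card_linked_block_le (κ : ℕ) (A B : ℕ → Prop) [DecidablePred A]
    [DecidablePred B] {α β C : ℝ} (hαβ : α / 2 + 1 / 4 ≤ β)
    (hM : ∀ T : ℕ, |recipSum (fun _ => True) (2 ^ 2 ^ T) - Real.log 2 * T| ≤
      Real.log 2 / 100 * T + C)
    (hA : ∀ T : ℕ, recipSum A (2 ^ 2 ^ T) ≤ Real.log 2 * (α + 1 / 100) * T + C)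
    (hB : ∀ T : ℕ, Real.log 2 * (β - 1 / 100) * T - C ≤
      recipSum (fun p => ¬B p) (2 ^ 2 ^ T) + recipSum B (2 ^ 2 ^ T) / 2) :
    ∃ K : ℝ, 0 ≤ K ∧ ∀ i : ℕ, 300 * i + 100 ≤ 2 ^ i → ∀ N : ℕ,
      ∑ c ∈ Finset.Ico (blockStart i) (blockStart (i + 1)),
        (((Finset.Icc c (N / c)).filter (Linked κ A B c)).card : ℝ) ≤ K * (1 / 2) ^ i * N := by
  -- `exp (100 + 10 C)` absorbs the bounded errors: each of the four exponents below is at most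
  -- `-log 2 * i` up to a constant, with room for the errors `log 2 / 100 * T`
  refine ⟨4 * Real.exp (100 + 10 * C) + 2, by positivity, fun i hi N => ?_⟩
  have h := sum_card_linked_block_le hi κ A B N
  have hL0 : 0 ≤ Real.log 2 := Real.log_nonneg one_le_two
  have hL1 : Real.log 2 ≤ 1 := by have := Real.log_two_lt_d9; linarith
  set L := Real.log 2 with hL
  have hC : 0 ≤ C := by
    have := (abs_nonneg _).trans (hM 0)
    simpa using this
  have hMt := abs_le.mp (hM (19 * i))
  have hMw := abs_le.mp (hM i)
  have hMX := abs_le.mp (hM (20 * (i + 1)))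
  have hAt := hA (19 * i)
  have hBt := hB (19 * i)
  have hx : (0 : ℝ) ≤ L * i := by positivity
  have hAle : recipSum A (2 ^ 2 ^ (19 * i)) ≤ recipSum (fun _ => True) (2 ^ 2 ^ (19 * i)) := by
    rw [← recipSum_add_not A]
    linarith [recipSum_nonneg (fun p => ¬A p) (2 ^ 2 ^ (19 * i))]
  have half (m : ℕ) : (1 / 2 : ℝ) ^ m = Real.exp (-(L * m)) := by
    rw [one_div, ← Real.exp_log (show (0 : ℝ) < 2⁻¹ by norm_num), ← Real.exp_nat_mul,
      Real.log_inv]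
    congr 1
    ring
  have quarter (m : ℕ) : (1 / 4 : ℝ) ^ m = Real.exp (-(L * (2 * m : ℕ))) := by
    rw [← half, pow_mul]; norm_num
  have hβ : L * (α / 2 + 1 / 4) * i ≤ L * β * i := by gcongr
  simp only [blockStart, blockLevel, blockCutoff] at h ⊢
  set m₁ := recipSum (fun _ => True) (2 ^ 2 ^ (19 * i))
  set m₂ := recipSum (fun _ => True) (2 ^ 2 ^ i)
  set m₃ := recipSum (fun _ => True) (2 ^ 2 ^ (20 * (i + 1)))
  set a := recipSum A (2 ^ 2 ^ (19 * i))
  set b := recipSum (fun p => ¬B p) (2 ^ 2 ^ (19 * i)) + recipSum B (2 ^ 2 ^ (19 * i)) / 2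
  push_cast at hMt hMw hMX hAt hBt
  refine h.trans ?_
  rw [mul_comm _ (N : ℝ)]
  refine mul_le_mul_of_nonneg_left ?_ N.cast_nonneg
  rw [half, half, half, quarter, add_mul, ← Real.exp_add, ← Real.exp_add, ← Real.exp_add,
    ← Real.exp_add, ← Real.exp_add]
  have key : ∀ x : ℝ, x ≤ -(L * i) + (100 + 10 * C) →
      Real.exp x ≤ Real.exp (100 + 10 * C) * Real.exp (-(L * i)) := fun x hx => by
    rw [← Real.exp_add]
    exact Real.exp_le_exp.mpr (by linarith)
  push_cast
  have k1 := key (-(L * (80 * i)) + 2 * m₃) (by linarith)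
  have k2 := key (-b + m₂ / 2 + 1 + (a / 2 + (m₃ - m₁) + 1)) (by linarith)
  have k3 := key (-(L * (2 * (40 * i))) + 2 * m₁ + (a / 2 + (m₃ - m₁) + 1)) (by linarith)
  have k4 := key (-(L * (22 * i)) + m₃) (by linarith)
  linarith

end Block

/-! ### The block bounds with the primes of one entry restricted modulo four -/

section Instances

open scoped NumberTheorySymbols

theorem recipSum_mono {A B : ℕ → Prop} [DecidablePred A] [DecidablePred B]
    (h : ∀ p, p.Prime → A p → B p) (N : ℕ) : recipSum A N ≤ recipSum B N := by
  refine Finset.sum_le_sum_of_subset_of_nonneg (fun p hp => ?_) fun p _ _ => by positivity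
  have hp := Finset.mem_filter.mp hp
  exact Finset.mem_filter.mpr ⟨hp.1, h p (mem_primesLE_iff.mp hp.1).2 hp.2⟩

theorem recipSum_one_mod_four_le : ∃ C : ℝ, ∀ T : ℕ,
    |recipSum (fun _ => True) (2 ^ 2 ^ T) - Real.log 2 * T| ≤ Real.log 2 / 200 * T + C ∧
    recipSum (fun p => p % 4 = 1) (2 ^ 2 ^ T) ≤ Real.log 2 * (1 / 2 + 1 / 100) * T + C := by
  have hL : 0 < Real.log 2 / 200 := by have := Real.log_pos one_lt_two; positivity
  obtain ⟨C₁, h₁⟩ := abs_recipSum_true_sub_le hL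
  obtain ⟨C₂, h₂⟩ := le_recipSum_mod_four (Or.inr rfl) hL
  have hC₁ : 0 ≤ C₁ := by simpa using (abs_nonneg _).trans (h₁ 0)
  have hC₂ : -C₂ ≤ recipSum (fun p => p % 4 = 3) (2 ^ 2 ^ 0) := by simpa using h₂ 0
  refine ⟨C₁ + max C₂ 0, fun T => ?_⟩
  have h3 := h₁ T
  have h4 := h₂ T
  have h5 : recipSum (fun p => p % 4 = 3) (2 ^ 2 ^ T) ≤
      recipSum (fun p => ¬p % 4 = 1) (2 ^ 2 ^ T) :=
    recipSum_mono (fun p _ h => by omega) _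
  have h6 := recipSum_add_not (fun p => p % 4 = 1) (2 ^ 2 ^ T)
  have h7 := le_max_left C₂ 0
  have h8 := le_max_right C₂ 0
  have h9 := (abs_le.mp h3).2
  exact ⟨h3.trans (by linarith), by linarith⟩

theorem recipSum_not_true (N : ℕ) : recipSum (fun _ => ¬True) N = 0 := by
  rw [recipSum, Finset.filter_false_of_mem (fun _ _ => by simp), Finset.sum_empty]

/-- The block bound for first entries composed of primes `1` mod `4` (and `2`). -/
theorem exists_block_bound_left (κ : ℕ) :
    ∃ K : ℝ, 0 ≤ K ∧ ∀ i : ℕ, 300 * i + 100 ≤ 2 ^ i → ∀ N : ℕ,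
      ∑ c ∈ Finset.Ico (blockStart i) (blockStart (i + 1)),
        (((Finset.Icc c (N / c)).filter
          (Linked κ (fun p => p % 4 = 1) (fun _ => True) c)).card : ℝ) ≤ K * (1 / 2) ^ i * N := by
  obtain ⟨C, hC⟩ := recipSum_one_mod_four_le
  have hC0 : 0 ≤ C := by simpa using (abs_nonneg _).trans (hC 0).1
  have hL := Real.log_pos one_lt_two
  refine exists_sum_card_linked_block_le κ _ _ (α := 1 / 2) (β := 1 / 2) (C := C) (by norm_num)
    (fun T => (hC T).1.trans ?_) (fun T => (hC T).2) fun T => ?_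
  · have : 0 ≤ Real.log 2 * T := by positivity
    linarith
  · rw [recipSum_not_true]
    have h := (abs_le.mp (hC T).1).1
    have : 0 ≤ Real.log 2 * T := by positivity
    linarith

/-- The block bound for second entries composed of primes `1` mod `4` (and `2`). -/
theorem exists_block_bound_right (κ : ℕ) :
    ∃ K : ℝ, 0 ≤ K ∧ ∀ i : ℕ, 300 * i + 100 ≤ 2 ^ i → ∀ N : ℕ,
      ∑ c ∈ Finset.Ico (blockStart i) (blockStart (i + 1)),
        (((Finset.Icc c (N / c)).filter
          (Linked κ (fun _ => True) (fun p => p % 4 = 1) c)).card : ℝ) ≤ K * (1 / 2) ^ i * N := by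
  obtain ⟨C, hC⟩ := recipSum_one_mod_four_le
  have hC0 : 0 ≤ C := by simpa using (abs_nonneg _).trans (hC 0).1
  have hL := Real.log_pos one_lt_two
  refine exists_sum_card_linked_block_le κ _ _ (α := 1) (β := 3 / 4) (C := 2 * C) (by norm_num)
    (fun T => (hC T).1.trans ?_) (fun T => ?_) fun T => ?_
  · have : 0 ≤ Real.log 2 * T := by positivity
    linarith
  · have h := (abs_le.mp (hC T).1).2
    have : 0 ≤ Real.log 2 * T := by positivity
    linarith
  · have h := (abs_le.mp (hC T).1).1
    have h1 := (hC T).2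
    have h2 := recipSum_add_not (fun p => p % 4 = 1) (2 ^ 2 ^ T)
    have : 0 ≤ Real.log 2 * T := by positivity
    linarith

end Instances

/-! ### Linked pairs with a fixed first entry -/

section Fixed

open scoped NumberTheorySymbols

/-- Integers free of prime factors from a set with divergent sum of reciprocals have density
zero. -/
theorem exists_card_filter_not_dvd_le {P : ℕ → Prop} [DecidablePred P]
    (hP : ∀ K : ℝ, ∃ N : ℕ, K ≤ recipSum P N) {ε : ℝ} (hε : 0 < ε) :
    ∃ M₀ : ℕ, ∃ S : Finset ℕ, (∀ p ∈ S, p.Prime ∧ P p) ∧ ∀ M : ℕ, M₀ ≤ M →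
      (((Finset.Icc 1 M).filter fun d : ℕ => ∀ p ∈ S, ¬p ∣ d).card : ℝ) ≤ ε * M := by
  obtain ⟨N, hN⟩ := hP (-Real.log (ε / 3))
  set S := (Nat.primesLE N).filter P with hS
  have hSp : ∀ p ∈ S, p.Prime ∧ P p := fun p hp => by
    have hp := Finset.mem_filter.mp hp
    exact ⟨(mem_primesLE_iff.mp hp.1).2, hp.2⟩
  have h1 : ∏ p ∈ S, (1 - 1 / p : ℝ) ≤ ε / 3 := by
    calc ∏ p ∈ S, (1 - 1 / p : ℝ) ≤ Real.exp (∑ p ∈ S, -(1 / p : ℝ)) := by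
          rw [Real.exp_sum]
          refine Finset.prod_le_prod (fun p hp => ?_) fun p _ => ?_
          · have : (1 : ℝ) ≤ p := by exact_mod_cast (hSp p hp).1.one_le
            rw [sub_nonneg]
            exact div_le_one_of_le₀ this (by linarith)
          · linarith [Real.add_one_le_exp (-(1 / p : ℝ))]
      _ ≤ Real.exp (Real.log (ε / 3)) := by
          rw [Finset.sum_neg_distrib]
          refine Real.exp_le_exp.mpr ?_
          have e : ∑ p ∈ S, (1 / p : ℝ) = recipSum P N := rfl
          linarith
      _ = ε / 3 := Real.exp_log (by positivity)
  set D : ℝ := ∏ p ∈ S, (1 + 2 / p : ℝ) with hD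
  have hD0 : 0 < D := Finset.prod_pos fun p _ => by positivity
  obtain ⟨k, hk⟩ := exists_pow_lt_of_lt_one (show 0 < ε / (3 * D) by positivity)
    (show (1 / 4 : ℝ) < 1 by norm_num)
  have hk' : (1 / 4 : ℝ) ^ k * D ≤ ε / 3 := by
    calc (1 / 4 : ℝ) ^ k * D ≤ ε / (3 * D) * D := by gcongr
      _ = ε / 3 := by field_simp
  obtain ⟨M₀, hM₀⟩ := exists_nat_ge (2 * ((S.card : ℝ) + 1) ^ (2 * k) / (ε / 3))
  refine ⟨M₀, S, hSp, fun M hM => ?_⟩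
  have h2 := card_sieve_le (U := ∅) (by simp) (fun p hp => (hSp p hp).1) 1 M k
  simp only [Finset.notMem_empty, IsEmpty.forall_iff, implies_true, true_and, Finset.card_empty,
    pow_zero, one_mul, Finset.prod_empty, Nat.cast_one] at h2
  have hMM : (M₀ : ℝ) ≤ M := by exact_mod_cast hM
  have h3 := (div_le_iff₀ (by positivity)).mp (hM₀.trans hMM)
  have h4 : (M : ℝ) * (∏ p ∈ S, (1 - 1 / p : ℝ) + (1 / 4) ^ k * D) ≤ M * (ε / 3 + ε / 3) := by
    gcongr
  linarith

theorem exists_card_linked_le {κ : ℕ} {A B P : ℕ → Prop} [DecidablePred P] {c : ℕ}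
    (hP : ∀ K : ℝ, ∃ N : ℕ, K ≤ recipSum P N)
    (hB : ∀ p, p.Prime → P p → p ≠ 2 ∧ ¬(B p ∧ J(κ * c | p) = 1)) {ε : ℝ} (hε : 0 < ε) :
    ∃ M₀ : ℕ, ∀ M : ℕ, M₀ ≤ M →
      (((Finset.Icc 1 M).filter (Linked κ A B c)).card : ℝ) ≤ ε * M := by
  obtain ⟨M₀, S, hS, h⟩ := exists_card_filter_not_dvd_le hP hε
  refine ⟨M₀, fun M hM => le_trans (Nat.cast_le.mpr (Finset.card_le_card fun d hd => ?_)) (h M hM)⟩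
  rw [Finset.mem_filter] at hd ⊢
  refine ⟨hd.1, fun p hp hpd => ?_⟩
  obtain ⟨h1, h2⟩ := hS p hp
  exact (hB p h1 h2).2 (hd.2.2.2 p h1 (hB p h1 h2).1 hpd)

theorem exists_le_recipSum {q : ℕ} [NeZero q] {a : ZMod q} (ha : IsUnit a) (K : ℝ) :
    ∃ N : ℕ, K ≤ recipSum (fun p => (p : ZMod q) = a) N := by
  have hφ : 0 < (q.totient : ℝ)⁻¹ * Real.log 2 / 2 := by
    have := Real.log_pos one_lt_two
    have : 0 < (q.totient : ℝ) := by exact_mod_cast Nat.totient_pos.mpr (NeZero.pos q)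
    positivity
  obtain ⟨C, hC⟩ := le_recipSum_two_pow ha hφ
  obtain ⟨T, hT⟩ := exists_nat_ge ((K + C) / ((q.totient : ℝ)⁻¹ * Real.log 2 / 2))
  refine ⟨2 ^ 2 ^ T, le_trans ?_ (hC T)⟩
  have := (div_le_iff₀ hφ).mp hT
  linarith

theorem mod_four_eq_one_of_primeFactors {a : ℕ} (ha : Squarefree a)
    (h : ∀ p : ℕ, p.Prime → p ∣ a → p % 4 = 1) : a % 4 = 1 := by
  rw [← Nat.prod_primeFactors_of_squarefree ha]
  refine Finset.prod_induction (fun p => p) (fun n => n % 4 = 1) (fun m n hm hn => ?_) rfl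
    fun p hp => h p (Nat.prime_of_mem_primeFactors hp) (Nat.dvd_of_mem_primeFactors hp)
  rw [Nat.mul_mod, hm, hn]

/-- By quadratic reciprocity, `(κ a / p) = -1` for all primes `p` in a suitable residue class
mod `8 a`. -/
theorem exists_residueClass_jacobiSym_eq_neg_one {κ a : ℕ} (hκ : κ = 1 ∨ κ = 2)
    (ha : Squarefree a) (h4 : ∀ p : ℕ, p.Prime → p ∣ a → p % 4 = 1) (hne : κ * a ≠ 1) :
    ∃ r : ℕ, r.Coprime (8 * a) ∧ ∀ p : ℕ, p.Prime → p ≡ r [MOD 8 * a] →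
      p ≠ 2 ∧ J(κ * a | p) = -1 := by
  have hmod := mod_four_eq_one_of_primeFactors ha h4
  have h8 : ∀ p : ℕ, p % 8 = 1 ∨ p % 8 = 5 → Odd p ∧ p ≠ 2 := fun p hp =>
    ⟨Nat.odd_iff.mpr (by omega), by omega⟩
  rcases eq_or_ne a 1 with rfl | ha1
  · have hκ2 : κ = 2 := by omega
    subst hκ2
    refine ⟨5, by decide, fun p _ hpr => ?_⟩
    have hp5 : p % 8 = 5 := hpr
    refine ⟨(h8 p (Or.inr hp5)).2, ?_⟩
    rw [Nat.cast_one, mul_one, Nat.cast_ofNat, jacobiSym.at_two (h8 p (Or.inr hp5)).1,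
      ZMod.χ₈_nat_eq_if_mod_eight]
    have h2 : p % 2 ≠ 0 := by omega
    simp [hp5, h2]
  · have hV : a.primeFactors.Nonempty := by
      rw [Nat.nonempty_primeFactors]
      have := ha.ne_zero
      omega
    obtain ⟨u, hu⟩ := exists_jacobiSym_eq_neg_one hV fun p hp => by
      have hp1 := Nat.prime_of_mem_primeFactors hp
      have := h4 p hp1 (Nat.dvd_of_mem_primeFactors hp)
      exact ⟨hp1, by omega⟩
    rw [Nat.prod_primeFactors_of_squarefree ha] at hu
    have hodd : Odd a := Nat.odd_iff.mpr (by omega)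
    have hcop : Nat.Coprime 8 a := by
      have : Nat.Coprime (2 ^ 3) a := (Nat.coprime_two_left.mpr hodd).pow_left 3
      exact this
    obtain ⟨r, hr1, hr2⟩ := Nat.chineseRemainder hcop 1 u
    have hJr : J(r | a) = -1 := by
      rw [← hu]
      exact jacobiSym.mod_left' (by exact_mod_cast hr2)
    have hra : r.Coprime a := by
      by_contra hc
      have : NeZero a := ⟨ha.ne_zero⟩
      have h0 : J(r | a) = 0 := jacobiSym.eq_zero_iff_not_coprime.mpr (by
        rw [Int.gcd_natCast_natCast]; exact hc)
      omega
    have hr8 : r.Coprime 8 := by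
      have : Nat.gcd r 8 = Nat.gcd 1 8 := Nat.ModEq.gcd_eq hr1
      rw [Nat.Coprime, this]
      rfl
    refine ⟨r, Nat.Coprime.mul_right hr8 hra, fun p _ hpr => ?_⟩
    have hp1 : p % 8 = 1 := (hpr.of_mul_right a).trans hr1
    have hp2 : p ≡ r [MOD a] := hpr.of_mul_left 8
    obtain ⟨hpo, hp22⟩ := h8 p (Or.inl hp1)
    refine ⟨hp22, ?_⟩
    have e1 : J(κ | p) = 1 := by
      rcases hκ with rfl | rfl
      · rw [Nat.cast_one, jacobiSym.one_left]
      · rw [Nat.cast_ofNat, jacobiSym.at_two hpo, ZMod.χ₈_nat_eq_if_mod_eight]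
        have h2 : p % 2 ≠ 0 := by omega
        simp [hp1, h2]
    have e2 : J(a | p) = -1 := by
      rw [jacobiSym.quadratic_reciprocity_one_mod_four hmod hpo, ← hJr]
      exact jacobiSym.mod_left' (by exact_mod_cast hp2)
    rw [jacobiSym.mul_left, e1, e2, one_mul]

/-- If `a` violates the condition on first entries there is no pair at all; otherwise the second
entries avoid the primes with `(κ a / p) = -1`. -/
theorem exists_card_linked_left_le {κ a : ℕ} (hκ : κ = 1 ∨ κ = 2) (ha : Odd a) (hne : κ * a ≠ 1)
    {ε : ℝ} (hε : 0 < ε) : ∃ M₀ : ℕ, ∀ M : ℕ, M₀ ≤ M →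
      (((Finset.Icc 1 M).filter
        (Linked κ (fun p => p % 4 = 1) (fun _ => True) a)).card : ℝ) ≤ ε * M := by
  by_cases hsq : Squarefree a ∧ ∀ p : ℕ, p.Prime → p ∣ a → p % 4 = 1
  · obtain ⟨r, hr, h⟩ := exists_residueClass_jacobiSym_eq_neg_one hκ hsq.1 hsq.2 hne
    have : NeZero (8 * a) := ⟨mul_ne_zero (by norm_num) hsq.1.ne_zero⟩
    refine exists_card_linked_le (P := fun p => (p : ZMod (8 * a)) = (r : ZMod (8 * a)))
      (exists_le_recipSum ((ZMod.isUnit_iff_coprime r (8 * a)).mpr hr)) (fun p hp hpr => ?_) hε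
    obtain ⟨h1, h2⟩ := h p hp ((ZMod.natCast_eq_natCast_iff _ _ _).mp hpr)
    refine ⟨h1, fun h3 => ?_⟩
    rw [h2] at h3
    exact absurd h3.2 (by decide)
  · refine ⟨0, fun M _ => ?_⟩
    have hno : ∀ d ∈ Finset.Icc 1 M, ¬Linked κ (fun p => p % 4 = 1) (fun _ => True) a d := by
      intro d _ hd
      refine hsq ⟨hd.1, fun p hp hpa => (hd.2.1 p hp ?_ hpa).1⟩
      rintro rfl
      exact Nat.not_even_iff_odd.mpr ha (even_iff_two_dvd.mpr hpa)
    rw [Finset.filter_false_of_mem hno, Finset.card_empty, Nat.cast_zero]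
    positivity

/-- Here the second entries avoid the primes `3` mod `4`. -/
theorem exists_card_linked_right_le (κ b : ℕ) {ε : ℝ} (hε : 0 < ε) : ∃ M₀ : ℕ, ∀ M : ℕ, M₀ ≤ M →
      (((Finset.Icc 1 M).filter
        (Linked κ (fun _ => True) (fun p => p % 4 = 1) b)).card : ℝ) ≤ ε * M := by
  have hu : IsUnit ((3 : ℕ) : ZMod 4) := by decide
  refine exists_card_linked_le (P := fun p => (p : ZMod 4) = (3 : ℕ)) (exists_le_recipSum hu)
    (fun p _ hp => ?_) hε
  have h3 : p % 4 = 3 := (ZMod.natCast_eq_natCast_iff _ _ _).mp hp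
  exact ⟨by omega, fun h => by omega⟩

end Fixed

/-! ### Local solubility -/

section Local

open scoped NumberTheorySymbols

/-- A solution over `ℚ_p` can be scaled to a solution in `ℤ_p` with a coordinate that is a unit. -/
theorem EvenQuartic.HasPoint.exists_padicInt {p : ℕ} [Fact p.Prime] {a c : ℤ}
    (h : EvenQuartic.HasPoint ⟨a, 0, c⟩ ℚ_[p]) :
    ∃ x y z : ℤ_[p], (IsUnit x ∨ IsUnit y) ∧ z ^ 2 = a * x ^ 4 + c * y ^ 4 := by
  obtain ⟨x, y, z, hxy, hz⟩ := h
  simp only [EvenQuartic.eval, Int.cast_zero, zero_mul, add_zero] at hz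
  -- divide by the coordinate of larger absolute value
  have key : ∀ (a c : ℤ) (x y z : ℚ_[p]), x ≠ 0 → ‖y‖ ≤ ‖x‖ →
      z ^ 2 = a * x ^ 4 + c * y ^ 4 →
      ∃ y' z' : ℤ_[p], z' ^ 2 = a * (1 : ℤ_[p]) ^ 4 + c * y' ^ 4 := by
    intro a c x y z hx hyx hz
    have hy' : ‖y / x‖ ≤ 1 := by
      rw [norm_div]
      exact div_le_one_of_le₀ hyx (norm_nonneg _)
    obtain ⟨y', hy'⟩ : ∃ y' : ℤ_[p], (y' : ℚ_[p]) = y / x := ⟨⟨y / x, hy'⟩, rfl⟩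
    have hz' : (z / x ^ 2) ^ 2 = ((a + c * y' ^ 4 : ℤ_[p]) : ℚ_[p]) := by
      push_cast
      rw [hy']
      field_simp
      rw [hz]
      ring
    have hzn : ‖z / x ^ 2‖ ≤ 1 := by
      have h1 : ‖(z / x ^ 2) ^ 2‖ ≤ 1 := by
        rw [hz']
        exact PadicInt.norm_le_one _
      rw [norm_pow] at h1
      by_contra hc
      have := one_lt_pow₀ (not_le.mp hc) (two_ne_zero)
      linarith
    obtain ⟨z', hzz⟩ : ∃ z' : ℤ_[p], (z' : ℚ_[p]) = z / x ^ 2 := ⟨⟨z / x ^ 2, hzn⟩, rfl⟩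
    refine ⟨y', z', ?_⟩
    rw [one_pow, mul_one]
    apply Subtype.coe_injective
    rw [← hzz, ← PadicInt.coe_pow] at hz'
    exact hz'
  rcases le_total ‖y‖ ‖x‖ with hle | hle
  · have hx : x ≠ 0 := by
      rintro rfl
      rw [norm_zero] at hle
      have := norm_le_zero_iff.mp hle
      tauto
    obtain ⟨y', z', h'⟩ := key a c x y z hx hle hz
    exact ⟨1, y', z', Or.inl isUnit_one, h'⟩
  · have hy : y ≠ 0 := by
      rintro rfl
      rw [norm_zero] at hle
      have := norm_le_zero_iff.mp hle
      tauto
    obtain ⟨x', z', h'⟩ := key c a y x z hy hle (by rw [hz]; ring)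
    exact ⟨x', 1, z', Or.inr isUnit_one, by rw [h']; ring⟩

theorem toZMod_ne_zero_iff {p : ℕ} [Fact p.Prime] (x : ℤ_[p]) :
    PadicInt.toZMod x ≠ 0 ↔ IsUnit x := by
  rw [ne_eq, ← RingHom.mem_ker, PadicInt.ker_toZMod, IsLocalRing.mem_maximalIdeal, mem_nonunits_iff,
    not_not]

theorem dvd_of_toZMod_eq_zero {p : ℕ} [Fact p.Prime] {x : ℤ_[p]} (h : PadicInt.toZMod x = 0) :
    (p : ℤ_[p]) ∣ x := by
  rw [← PadicInt.norm_lt_one_iff_dvd, ← PadicInt.not_isUnit_iff, ← toZMod_ne_zero_iff, not_not]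
  exact h

/-- At a prime `p` dividing `c` exactly twice, a local point makes `a` a square mod `p`. -/
theorem jacobiSym_eq_one_of_hasPoint {p : ℕ} [Fact p.Prime] {a c m : ℤ}
    (ha : ¬(p : ℤ) ∣ a) (hm : ¬(p : ℤ) ∣ m) (h2 : p ≠ 2) (hac : a * c = 4 * m ^ 2)
    (h : EvenQuartic.HasPoint ⟨a, 0, p ^ 2 * c⟩ ℚ_[p]) : J(a | p) = 1 := by
  have hp : (p : ℤ_[p]) ≠ 0 := by exact_mod_cast (Fact.out : p.Prime).ne_zero
  have ha0 : ((a : ℤ) : ZMod p) ≠ 0 := by rwa [ne_eq, ZMod.intCast_zmod_eq_zero_iff_dvd]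
  have hm0 : ((m : ℤ) : ZMod p) ≠ 0 := by rwa [ne_eq, ZMod.intCast_zmod_eq_zero_iff_dvd]
  suffices hs : IsSquare ((a : ℤ) : ZMod p) by
    rw [← jacobiSym.legendreSym.to_jacobiSym]
    exact (legendreSym.eq_one_iff p ha0).mpr hs
  obtain ⟨x, y, z, hxy, hz⟩ := h.exists_padicInt
  set f := PadicInt.toZMod (p := p) with hf
  have hz1 := congrArg f hz
  push_cast [map_pow, map_add, map_mul, map_intCast, map_natCast] at hz1
  simp only [ZMod.natCast_self, zero_pow two_ne_zero, zero_mul, add_zero] at hz1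
  by_cases hx : IsUnit x
  · have hx0 : f x ≠ 0 := (toZMod_ne_zero_iff x).mpr hx
    refine ⟨f z / f x ^ 2, ?_⟩
    field_simp
    rw [hz1]
  · have hx0 : f x = 0 := not_not.mp (mt (toZMod_ne_zero_iff x).mp hx)
    have hy : IsUnit y := hxy.resolve_left hx
    have hy0 : f y ≠ 0 := (toZMod_ne_zero_iff y).mpr hy
    obtain ⟨x₁, rfl⟩ := dvd_of_toZMod_eq_zero hx0
    rw [hx0] at hz1
    have hfz : f z = 0 := by
      refine pow_eq_zero_iff two_ne_zero |>.mp ?_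
      rw [hz1]
      ring
    obtain ⟨z₁, rfl⟩ := dvd_of_toZMod_eq_zero hfz
    have hz2 : z₁ ^ 2 = c * y ^ 4 + p * (p * a * x₁ ^ 4) := by
      have : (p : ℤ_[p]) ^ 2 ≠ 0 := pow_ne_zero 2 hp
      refine mul_left_cancel₀ this ?_
      push_cast at hz
      linear_combination hz
    have hz3 := congrArg f hz2
    simp only [map_pow, map_add, map_mul, map_intCast, map_natCast, ZMod.natCast_self, zero_mul,
      add_zero] at hz3
    have hac' := congrArg (Int.cast : ℤ → ZMod p) hac
    push_cast at hac'
    -- `a z₁² = 4 m² y⁴`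
    have h4 : (a : ZMod p) * (f z₁) ^ 2 = (2 * m * f y ^ 2) ^ 2 := by
      rw [hz3]
      linear_combination (f y) ^ 4 * hac'
    have h20 : (2 : ZMod p) ≠ 0 := by
      have : ((2 : ℕ) : ZMod p) ≠ 0 := by
        rw [ne_eq, ZMod.natCast_eq_zero_iff]
        intro hd
        exact h2 ((Nat.prime_dvd_prime_iff_eq Fact.out Nat.prime_two).mp hd)
      exact_mod_cast this
    have hne : f z₁ ≠ 0 := by
      intro h0
      rw [h0] at h4
      have : (2 * (m : ZMod p) * f y ^ 2) ^ 2 ≠ 0 :=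
        pow_ne_zero 2 (mul_ne_zero (mul_ne_zero h20 hm0) (pow_ne_zero 2 hy0))
      exact this (by rw [← h4]; ring)
    refine ⟨2 * m * f y ^ 2 / f z₁, ?_⟩
    rw [div_mul_div_comm, eq_div_iff (mul_ne_zero hne hne), ← sq, ← sq, h4]

/-- At an odd prime `p` dividing both coefficients exactly once, a local point makes `-1` a square
mod `p`, and, because `-4 = (1 + i)⁴`, also makes `a m` a square mod `p`. -/
theorem isSquare_of_hasPoint {p : ℕ} [Fact p.Prime] {a c m : ℤ}
    (hm : ¬(p : ℤ) ∣ m) (h2 : p ≠ 2) (hac : a * c = 4 * m ^ 2)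
    (h : EvenQuartic.HasPoint ⟨p * a, 0, p * c⟩ ℚ_[p]) :
    p % 4 = 1 ∧ J(a * m | p) = 1 := by
  have hp : (p : ℤ_[p]) ≠ 0 := by exact_mod_cast (Fact.out : p.Prime).ne_zero
  have hm0 : ((m : ℤ) : ZMod p) ≠ 0 := by rwa [ne_eq, ZMod.intCast_zmod_eq_zero_iff_dvd]
  have h20 : (2 : ZMod p) ≠ 0 := by
    have : ((2 : ℕ) : ZMod p) ≠ 0 := by
      rw [ne_eq, ZMod.natCast_eq_zero_iff]
      intro hd
      exact h2 ((Nat.prime_dvd_prime_iff_eq Fact.out Nat.prime_two).mp hd)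
    exact_mod_cast this
  have hac' := congrArg (Int.cast : ℤ → ZMod p) hac
  push_cast at hac'
  have hac0 : (a : ZMod p) * c ≠ 0 := by
    rw [hac']
    refine mul_ne_zero ?_ (pow_ne_zero 2 hm0)
    have : (4 : ZMod p) = 2 * 2 := by norm_num
    rw [this]
    exact mul_ne_zero h20 h20
  have ha0 : (a : ZMod p) ≠ 0 := left_ne_zero_of_mul hac0
  have hc0 : (c : ZMod p) ≠ 0 := right_ne_zero_of_mul hac0
  obtain ⟨x, y, z, hxy, hz⟩ := h.exists_padicInt
  set f := PadicInt.toZMod (p := p) with hf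
  have hz1 := congrArg f hz
  push_cast [map_pow, map_add, map_mul, map_intCast, map_natCast] at hz1
  simp only [ZMod.natCast_self, zero_mul, add_zero] at hz1
  obtain ⟨z₁, rfl⟩ := dvd_of_toZMod_eq_zero ((pow_eq_zero_iff two_ne_zero).mp hz1)
  have hz2 : (p : ℤ_[p]) * z₁ ^ 2 = a * x ^ 4 + c * y ^ 4 := by
    refine mul_left_cancel₀ hp ?_
    push_cast at hz
    linear_combination hz
  have hz3 := congrArg f hz2
  simp only [map_pow, map_add, map_mul, map_intCast, map_natCast, ZMod.natCast_self,
    zero_mul] at hz3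
  have hy0 : f y ≠ 0 := by
    intro h0
    rw [h0] at hz3
    have hx4 : f x ^ 4 = 0 := by
      have : (a : ZMod p) * f x ^ 4 = 0 := by linear_combination -hz3
      exact (mul_eq_zero.mp this).resolve_left ha0
    have hx0 := (pow_eq_zero_iff (by norm_num)).mp hx4
    rcases hxy with hu | hu
    · exact (toZMod_ne_zero_iff x).mpr hu hx0
    · exact (toZMod_ne_zero_iff y).mpr hu h0
  have hv0 : 2 * (m : ZMod p) * f y ^ 2 ≠ 0 :=
    mul_ne_zero (mul_ne_zero h20 hm0) (pow_ne_zero 2 hy0)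
  have hx0 : f x ≠ 0 := by
    intro h0
    rw [h0] at hz3
    have : (c : ZMod p) * f y ^ 4 = 0 := by linear_combination -hz3
    exact mul_ne_zero hc0 (pow_ne_zero 4 hy0) this
  have hsum : ((a : ZMod p) * f x ^ 2) ^ 2 + (2 * m * f y ^ 2) ^ 2 = 0 := by
    linear_combination -(a : ZMod p) * hz3 - f y ^ 4 * hac'
  obtain ⟨i, hi⟩ : ∃ i : ZMod p, i = (a : ZMod p) * f x ^ 2 / (2 * m * f y ^ 2) := ⟨_, rfl⟩
  have hii : i ^ 2 = -1 := by
    rw [hi, div_pow, div_eq_iff (pow_ne_zero 2 hv0)]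
    linear_combination hsum
  have hai : (a : ZMod p) * f x ^ 2 = i * (2 * m * f y ^ 2) := by
    rw [hi, div_mul_cancel₀ _ hv0]
  constructor
  · have hsq : IsSquare (-1 : ZMod p) := ⟨i, by rw [← hii, sq]⟩
    have h3 := ZMod.exists_sq_eq_neg_one_iff.mp hsq
    have hodd : p % 2 = 1 := (Fact.out : p.Prime).eq_two_or_odd.resolve_left h2
    omega
  · have hne : (((a * m : ℤ)) : ZMod p) ≠ 0 := by
      push_cast
      exact mul_ne_zero ha0 hm0
    rw [← jacobiSym.legendreSym.to_jacobiSym]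
    refine (legendreSym.eq_one_iff p hne).mpr ⟨(1 + i) * m * f y / f x, ?_⟩
    push_cast
    rw [div_mul_div_comm, eq_div_iff (mul_ne_zero hx0 hx0)]
    linear_combination (m : ZMod p) * hai - (m : ZMod p) ^ 2 * f y ^ 2 * hii

end Local

/-! ### From locally soluble forms to linked pairs -/

section Forms

open scoped NumberTheorySymbols

/-- The necessary conditions for local solubility at the odd primes, for the form
`κ a x⁴ + c y⁴` with `κ a c = 4 (a b)²`. -/
def Admissible (κ a b : ℕ) : Prop :=
  Odd a ∧ Squarefree (a * b) ∧ (∀ p : ℕ, p.Prime → p ∣ a → p % 4 = 1 ∧ J(κ * b | p) = 1) ∧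
    ∀ p : ℕ, p.Prime → p ≠ 2 → p ∣ b → J(κ * a | p) = 1

noncomputable instance (κ : ℕ) : DecidablePred fun x : ℕ × ℕ => Admissible κ x.1 x.2 :=
  Classical.decPred _

theorem Admissible.linked_left {κ a b : ℕ} (h : Admissible κ a b) :
    Linked κ (fun p => p % 4 = 1) (fun _ => True) a b :=
  ⟨h.2.1.of_mul_left, fun p hp _ hpa => h.2.2.1 p hp hpa,
    fun p hp h2 hpb => ⟨trivial, h.2.2.2 p hp h2 hpb⟩⟩

theorem Admissible.linked_right {κ a b : ℕ} (h : Admissible κ a b) :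
    Linked κ (fun _ => True) (fun p => p % 4 = 1) b a :=
  ⟨h.2.1.of_mul_right, fun p hp h2 hpb => ⟨trivial, h.2.2.2 p hp h2 hpb⟩,
    fun p hp _ hpa => h.2.2.1 p hp hpa⟩

theorem EvenQuartic.pos_of_hasPoint_real {a c : ℤ} (hac : 0 < a * c)
    (h : EvenQuartic.HasPoint ⟨a, 0, c⟩ ℝ) : 0 < a := by
  by_contra ha
  have ha' : a < 0 := lt_of_le_of_ne (not_lt.mp ha) fun h0 => by simp [h0] at hac
  have hc' : c < 0 := by nlinarith
  obtain ⟨x, y, z, hxy, hz⟩ := h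
  simp only [EvenQuartic.eval, Int.cast_zero, zero_mul, add_zero] at hz
  have ha'' : (a : ℝ) < 0 := by exact_mod_cast ha'
  have hc'' : (c : ℝ) < 0 := by exact_mod_cast hc'
  have hx4 : 0 ≤ x ^ 4 := by positivity
  have hy4 : 0 ≤ y ^ 4 := by positivity
  rcases hxy with hx | hy
  · have : 0 < x ^ 4 := by positivity
    nlinarith [sq_nonneg z]
  · have : 0 < y ^ 4 := by positivity
    nlinarith [sq_nonneg z]

theorem natCast_not_dvd {p m : ℕ} (h : ¬p ∣ m) : ¬(p : ℤ) ∣ (m : ℤ) := by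
  rwa [Int.natCast_dvd_natCast]

/-- The condition at a prime dividing the first coefficient. -/
theorem admissible_at_prime_left {κ a b p : ℕ} (hκ : κ = 1 ∨ κ = 2) (hp : p.Prime) (hp2 : p ≠ 2)
    (hab : Squarefree (a * b)) (hpa : p ∣ a) {c : ℤ} (hc : (κ * a : ℤ) * c = 4 * (a * b) ^ 2)
    (h : ∀ (p : ℕ) [Fact p.Prime], EvenQuartic.HasPoint ⟨κ * a, 0, c⟩ ℚ_[p]) :
    p % 4 = 1 ∧ J(κ * b | p) = 1 := by
  have := Fact.mk hp
  obtain ⟨a', rfl⟩ := hpa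
  have hpab : ¬p ∣ a' * b := by
    intro hd
    have : p * p ∣ p * a' * b := by rw [mul_assoc]; exact Nat.mul_dvd_mul_left p hd
    exact hp.not_isUnit (hab p this)
  have hpa' : ¬p ∣ a' := fun hd => hpab (hd.mul_right b)
  have hpκ : ¬p ∣ κ := by
    rcases hκ with rfl | rfl
    · exact hp.one_lt.ne' ∘ Nat.dvd_one.mp
    · exact fun hd => hp2 ((Nat.prime_dvd_prime_iff_eq hp Nat.prime_two).mp hd)
  have hp0 : (p : ℤ) ≠ 0 := by exact_mod_cast hp.ne_zero
  have hpZ : Prime (p : ℤ) := Nat.prime_iff_prime_int.mp hp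
  push_cast at hc
  have e1 : (κ * a' : ℤ) * c = p * (4 * (a' * b) ^ 2) := by
    refine mul_left_cancel₀ hp0 ?_
    linear_combination hc
  have hpc : (p : ℤ) ∣ c := by
    have h1 : (p : ℤ) ∣ (κ * a' : ℤ) * c := ⟨_, e1⟩
    refine (hpZ.dvd_or_dvd h1).resolve_left fun h2 => ?_
    rcases hpZ.dvd_or_dvd h2 with h3 | h3
    · exact natCast_not_dvd hpκ h3
    · exact natCast_not_dvd hpa' h3
  obtain ⟨c', rfl⟩ := hpc
  have e2 : (κ * a' : ℤ) * c' = 4 * ((a' * b : ℕ) : ℤ) ^ 2 := by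
    refine mul_left_cancel₀ hp0 ?_
    push_cast
    linear_combination e1
  have h' := h p
  have e3 : (κ * (p * a' : ℕ) : ℤ) = p * (κ * a') := by push_cast; ring
  rw [e3] at h'
  obtain ⟨h4, h5⟩ := isSquare_of_hasPoint (natCast_not_dvd hpab) hp2 e2 h'
  refine ⟨h4, ?_⟩
  have e4 : (κ * a' * (a' * b : ℕ) : ℤ) = κ * b * (a' : ℤ) ^ 2 := by push_cast; ring
  rw [e4, jacobiSym.mul_left, jacobiSym.sq_one', mul_one] at h5
  · exact h5
  · rw [Int.gcd_natCast_natCast]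
    exact ((Nat.Prime.coprime_iff_not_dvd hp).mpr hpa').symm

/-- The condition at a prime dividing the second coefficient only. -/
theorem admissible_at_prime_right {κ a b p : ℕ} (hκ : κ = 1 ∨ κ = 2) (hp : p.Prime) (hp2 : p ≠ 2)
    (hab : Squarefree (a * b)) (hpb : p ∣ b) {c : ℤ} (hc : (κ * a : ℤ) * c = 4 * (a * b) ^ 2)
    (h : ∀ (p : ℕ) [Fact p.Prime], EvenQuartic.HasPoint ⟨κ * a, 0, c⟩ ℚ_[p]) :
    J(κ * a | p) = 1 := by
  have := Fact.mk hp
  obtain ⟨b', rfl⟩ := hpb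
  have hpab : ¬p ∣ a * b' := by
    intro hd
    have : p * p ∣ a * (p * b') := by rw [mul_left_comm]; exact Nat.mul_dvd_mul_left p hd
    exact hp.not_isUnit (hab p this)
  have hpa : ¬p ∣ a := fun hd => hpab (hd.mul_right b')
  have hpκ : ¬p ∣ κ := by
    rcases hκ with rfl | rfl
    · exact hp.one_lt.ne' ∘ Nat.dvd_one.mp
    · exact fun hd => hp2 ((Nat.prime_dvd_prime_iff_eq hp Nat.prime_two).mp hd)
  have hpκa : ¬p ∣ κ * a := fun hd => (hp.dvd_mul.mp hd).elim hpκ hpa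
  have hpκa' : ¬(p : ℤ) ∣ (κ * a : ℤ) := by exact_mod_cast natCast_not_dvd hpκa
  have hp0 : (p : ℤ) ≠ 0 := by exact_mod_cast hp.ne_zero
  push_cast at hc
  have hpc : (p : ℤ) ^ 2 ∣ c := by
    have h1 : (p : ℤ) ^ 2 ∣ (κ * a : ℤ) * c := ⟨4 * (a * b') ^ 2, by rw [hc]; ring⟩
    refine IsCoprime.dvd_of_dvd_mul_left (IsCoprime.pow_left ?_) h1
    exact (Nat.prime_iff_prime_int.mp hp).coprime_iff_not_dvd.mpr hpκa'
  obtain ⟨c', rfl⟩ := hpc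
  have e2 : (κ * a : ℤ) * c' = 4 * ((a * b' : ℕ) : ℤ) ^ 2 := by
    refine mul_left_cancel₀ (pow_ne_zero 2 hp0) ?_
    push_cast
    linear_combination hc
  exact jacobiSym_eq_one_of_hasPoint hpκa' (natCast_not_dvd hpab) hp2 e2 (h p)

theorem exists_admissible_of_mem_Fls {n : ℕ} (hn : Squarefree n) {f : EvenQuartic}
    (hf : f ∈ EvenQuartic.Fls 0 (4 * (n : ℤ) ^ 2)) :
    ∃ κ a b : ℕ, (κ = 1 ∨ κ = 2) ∧ a * b = n ∧ f.a = (κ * a : ℕ) ∧ Admissible κ a b := by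
  obtain ⟨⟨⟨hB, hM⟩, hord⟩, hR, hQ⟩ := hf
  obtain ⟨α, B, γ⟩ := f
  simp only at hB hM hord
  subst hB
  have hn0 : (n : ℤ) ≠ 0 := by exact_mod_cast hn.ne_zero
  have hα := EvenQuartic.pos_of_hasPoint_real (by rw [hM]; positivity) hR
  obtain ⟨m, rfl⟩ := Int.eq_ofNat_of_zero_le hα.le
  have hm : Squarefree m := by
    rw [Nat.squarefree_iff_prime_squarefree]
    intro p hp hpp
    have h1 := hord p hp
    have h2 : ((p : ℤ)) ^ 2 ∣ (m : ℤ) := by rw [sq]; exact_mod_cast hpp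
    have h3 := le_emultiplicity_of_pow_dvd h2
    exact absurd (h3.trans h1) (by norm_num)
  -- split off the power of two
  obtain ⟨κ, a, hκ, hodd, rfl⟩ : ∃ κ a : ℕ, (κ = 1 ∨ κ = 2) ∧ Odd a ∧ m = κ * a := by
    rcases Nat.even_or_odd m with he | ho
    · obtain ⟨a, rfl⟩ := even_iff_two_dvd.mp he
      refine ⟨2, a, Or.inr rfl, ?_, rfl⟩
      rw [← Nat.not_even_iff_odd, even_iff_two_dvd]
      intro h2
      have := hm 2 (Nat.mul_dvd_mul_left 2 h2)
      exact absurd (Nat.isUnit_iff.mp this) (by norm_num)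
    · exact ⟨1, m, Or.inl rfl, ho, (one_mul m).symm⟩
  have ha : Squarefree a := hm.of_mul_right
  have hdvd : a ∣ n := by
    have h1 : ((a : ℕ) : ℤ) ∣ ((4 * n ^ 2 : ℕ) : ℤ) := by
      refine ⟨κ * γ, ?_⟩
      push_cast at hM ⊢
      linear_combination -hM
    have h2 : a ∣ 4 * n ^ 2 := Int.natCast_dvd_natCast.mp h1
    have hcop : Nat.Coprime a 4 := by
      have : Nat.Coprime a (2 ^ 2) := (Nat.coprime_two_right.mpr hodd).pow_right 2
      exact this
    exact (ha.dvd_pow_iff_dvd two_ne_zero).mp (hcop.dvd_of_dvd_mul_left h2)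
  obtain ⟨b, rfl⟩ := hdvd
  push_cast at hM hQ
  refine ⟨κ, a, b, hκ, rfl, rfl, hodd, hn, fun p hp hpa => ?_, fun p hp h2 hpb => ?_⟩
  · have hp2 : p ≠ 2 := by
      rintro rfl
      exact Nat.not_even_iff_odd.mpr hodd (even_iff_two_dvd.mpr hpa)
    exact admissible_at_prime_left hκ hp hp2 hn hpa hM hQ
  · exact admissible_at_prime_right hκ hp h2 hn hpb hM hQ

/-- The number of admissible factorizations `n = a b`, without the one of the form
`x⁴ + 4 n² y⁴`, which has `κ a = 1`. -/
noncomputable def admissibleCount (κ n : ℕ) : ℕ :=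
  (n.divisorsAntidiagonal.filter fun x => Admissible κ x.1 x.2 ∧ κ * x.1 ≠ 1).card

/-- A locally soluble form is determined by its first coefficient, which is `1` or comes from a
nontrivial admissible factorization. -/
theorem ncard_Fls_le {n : ℕ} (hn : Squarefree n) :
    (EvenQuartic.Fls 0 (4 * (n : ℤ) ^ 2)).ncard ≤
      1 + (admissibleCount 1 n + admissibleCount 2 n) := by
  have hn0 : (n : ℤ) ≠ 0 := by exact_mod_cast hn.ne_zero
  have hinj : Set.InjOn EvenQuartic.a (EvenQuartic.Fls 0 (4 * (n : ℤ) ^ 2)) := by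
    intro f hf g hg hfg
    obtain ⟨⟨⟨hfB, hfM⟩, -⟩, -⟩ := hf
    obtain ⟨⟨⟨hgB, hgM⟩, -⟩, -⟩ := hg
    refine EvenQuartic.ext hfg (hfB.trans hgB.symm) ?_
    have ha : f.a ≠ 0 := by
      intro h0
      rw [h0, zero_mul] at hfM
      exact absurd hfM.symm (by positivity)
    refine mul_left_cancel₀ ha ?_
    rw [hfM, hfg, hgM]
  set T : ℕ → Finset (ℕ × ℕ) := fun κ =>
    n.divisorsAntidiagonal.filter fun x => Admissible κ x.1 x.2 ∧ κ * x.1 ≠ 1 with hT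
  set R : Finset ℤ := {1} ∪ ((T 1).image (fun x => ((1 * x.1 : ℕ) : ℤ)) ∪
    (T 2).image (fun x => ((2 * x.1 : ℕ) : ℤ))) with hR
  have hsub : EvenQuartic.a '' (EvenQuartic.Fls 0 (4 * (n : ℤ) ^ 2)) ⊆ R := by
    rintro _ ⟨f, hf, rfl⟩
    obtain ⟨κ, a, b, hκ, hab, hfa, hadm⟩ := exists_admissible_of_mem_Fls hn hf
    rw [Finset.mem_coe, hR, Finset.mem_union, Finset.mem_union]
    by_cases h1 : κ * a = 1
    · left
      rw [hfa, h1]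
      simp
    · right
      have hmem : (a, b) ∈ T κ := Finset.mem_filter.mpr
        ⟨Nat.mem_divisorsAntidiagonal.mpr ⟨hab, hn.ne_zero⟩, hadm, h1⟩
      rcases hκ with rfl | rfl
      · exact Or.inl (Finset.mem_image.mpr ⟨(a, b), hmem, hfa.symm⟩)
      · exact Or.inr (Finset.mem_image.mpr ⟨(a, b), hmem, hfa.symm⟩)
  rw [← hinj.ncard_image]
  refine (Set.ncard_le_ncard hsub R.finite_toSet).trans ?_
  rw [Set.ncard_coe_finset]
  refine (Finset.card_union_le _ _).trans (add_le_add (by simp) ?_)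
  exact (Finset.card_union_le _ _).trans (add_le_add Finset.card_image_le Finset.card_image_le)

theorem EvenQuartic.HasPoint.of_rat {f : EvenQuartic} (h : f.HasPoint ℚ) (K : Type*) [Field K]
    [CharZero K] : f.HasPoint K := by
  obtain ⟨x, y, z, hxy, hz⟩ := h
  refine ⟨x, y, z, ?_, ?_⟩
  · simpa only [ne_eq, Rat.cast_eq_zero] using hxy
  · have := congrArg (Rat.cast : ℚ → K) hz
    simp only [EvenQuartic.eval] at this ⊢
    push_cast at this
    exact this

theorem Fsol_subset_Fls (B M : ℤ) : EvenQuartic.Fsol B M ⊆ EvenQuartic.Fls B M :=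
  fun _ hf => ⟨hf.1, hf.2.of_rat ℝ, fun p _ => hf.2.of_rat ℚ_[p]⟩

theorem ncard_Fsol_le_ncard_Fls {n : ℕ} (hn : n ≠ 0) :
    (EvenQuartic.Fsol 0 (4 * (n : ℤ) ^ 2)).ncard ≤
      (EvenQuartic.Fls 0 (4 * (n : ℤ) ^ 2)).ncard := by
  have hM : 4 * (n : ℤ) ^ 2 ≠ 0 := by positivity
  exact Set.ncard_le_ncard (Fsol_subset_Fls _ _)
    ((EvenQuartic.F_finite 0 hM).subset fun f hf => hf.1)

/-- The form `x⁴ + 4 n² y⁴` is always soluble. -/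
theorem one_le_ncard_Fsol {n : ℕ} (hn : n ≠ 0) :
    1 ≤ (EvenQuartic.Fsol 0 (4 * (n : ℤ) ^ 2)).ncard := by
  have hM : 4 * (n : ℤ) ^ 2 ≠ 0 := by positivity
  have hfin : (EvenQuartic.Fsol 0 (4 * (n : ℤ) ^ 2)).Finite :=
    (EvenQuartic.F_finite 0 hM).subset fun f hf => hf.1
  refine (Set.ncard_pos hfin).mpr ?_
  refine ⟨⟨1, 0, 4 * (n : ℤ) ^ 2⟩, ⟨⟨rfl, one_mul _⟩, fun p hp => ?_⟩,
    1, 0, 1, Or.inl one_ne_zero, ?_⟩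
  · have h1 : emultiplicity (p : ℤ) 1 = 0 := by
      rw [emultiplicity_eq_zero]
      exact fun h => (Nat.prime_iff_prime_int.mp hp).not_isUnit (isUnit_of_dvd_one h)
    simp only [h1]
    exact zero_le
  · simp [EvenQuartic.eval]

end Forms

/-! ### Admissible factorizations have density zero -/

section Density

theorem card_le_sum_card_of_forall_mem {S : Finset (ℕ × ℕ)} {s : Finset ℕ} {t : ℕ → Finset ℕ}
    (h : ∀ x ∈ S, x.1 ∈ s ∧ x.2 ∈ t x.1) : S.card ≤ ∑ a ∈ s, (t a).card := by
  rw [← Finset.card_sigma]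
  refine Finset.card_le_card_of_injOn (fun x => ⟨x.1, x.2⟩)
    (fun x hx => Finset.mem_coe.mpr (Finset.mem_sigma.mpr (h x hx))) ?_
  rintro ⟨a, b⟩ - ⟨c, d⟩ - heq
  simpa using heq

theorem card_le_sum_card_of_forall_mem_swap {S : Finset (ℕ × ℕ)} {s : Finset ℕ}
    {t : ℕ → Finset ℕ} (h : ∀ x ∈ S, x.2 ∈ s ∧ x.1 ∈ t x.2) : S.card ≤ ∑ b ∈ s, (t b).card := by
  rw [← Finset.card_map (Equiv.prodComm ℕ ℕ).toEmbedding]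
  refine card_le_sum_card_of_forall_mem fun x hx => ?_
  obtain ⟨y, hy, rfl⟩ := Finset.mem_map.mp hx
  exact h y hy

theorem blockStart_le_succ (i : ℕ) : blockStart i ≤ blockStart (i + 1) := by
  unfold blockStart
  gcongr <;> omega

theorem lt_blockStart_add (j N : ℕ) : N < blockStart (j + N) := by
  unfold blockStart
  refine Nat.lt_two_pow_self.trans_le (Nat.pow_le_pow_right two_pos ?_)
  exact Nat.lt_two_pow_self.le.trans (Nat.pow_le_pow_right two_pos (by omega))

theorem three_hundred_mul_le_two_pow {i : ℕ} (hi : 13 ≤ i) : 300 * i + 100 ≤ 2 ^ i := by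
  induction i, hi using Nat.le_induction with
  | base => norm_num
  | succ k hk ih => rw [pow_succ]; omega

/-- Summation of block bounds that decay geometrically. -/
theorem sum_blocks_le {F : ℕ → ℝ} {B : ℝ} {j : ℕ}
    (h : ∀ i, j ≤ i → ∑ c ∈ Finset.Ico (blockStart i) (blockStart (i + 1)), F c ≤ B * (1 / 2) ^ i)
    (m : ℕ) : ∑ c ∈ Finset.Ico (blockStart j) (blockStart (j + m)), F c ≤
      2 * B * (1 / 2) ^ j - 2 * B * (1 / 2) ^ (j + m) := by
  induction m with
  | zero => simp
  | succ m ih =>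
    have hle : ∀ k, blockStart j ≤ blockStart (j + k) := fun k => by
      induction k with
      | zero => exact le_rfl
      | succ k ihk => exact ihk.trans (blockStart_le_succ _)
    rw [← add_assoc, ← Finset.sum_Ico_consecutive F (hle m) (blockStart_le_succ _)]
    have h1 := h (j + m) (Nat.le_add_right _ _)
    rw [pow_succ]
    linarith

theorem exists_sum_le_mul {g : ℕ → ℕ → ℕ} (s : Finset ℕ)
    (h : ∀ a ∈ s, ∀ ε : ℝ, 0 < ε → ∃ M₀ : ℕ, ∀ M : ℕ, M₀ ≤ M → (g a M : ℝ) ≤ ε * M)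
    {ε : ℝ} (hε : 0 < ε) :
    ∃ M₀ : ℕ, ∀ M : ℕ, M₀ ≤ M → ((∑ a ∈ s, g a M : ℕ) : ℝ) ≤ ε * M := by
  have hδ : 0 < ε / (s.card + 1) := by positivity
  have hev : ∀ᶠ M in Filter.atTop, ∀ a ∈ s, (g a M : ℝ) ≤ ε / (s.card + 1) * M :=
    (Filter.eventually_all_finset s).mpr fun a ha => Filter.eventually_atTop.mpr (h a ha _ hδ)
  obtain ⟨M₀, hM₀⟩ := Filter.eventually_atTop.mp hev
  refine ⟨M₀, fun M hM => ?_⟩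
  rw [Nat.cast_sum]
  refine (Finset.sum_le_card_nsmul _ _ _ (hM₀ M hM)).trans ?_
  rw [nsmul_eq_mul, ← mul_assoc]
  refine mul_le_mul_of_nonneg_right ?_ (Nat.cast_nonneg M)
  rw [mul_div_assoc', div_le_iff₀ (by positivity)]
  nlinarith

theorem sum_admissibleCount_le_card (κ N : ℕ) :
    ∑ n ∈ Finset.Icc 1 N, admissibleCount κ n ≤
      ((Finset.Icc 1 N ×ˢ Finset.Icc 1 N).filter fun x : ℕ × ℕ =>
        x.1 * x.2 ≤ N ∧ Admissible κ x.1 x.2 ∧ κ * x.1 ≠ 1).card := by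
  classical
  unfold admissibleCount
  rw [← Finset.card_biUnion]
  · refine Finset.card_le_card fun x hx => ?_
    obtain ⟨n, hn, hx⟩ := Finset.mem_biUnion.mp hx
    obtain ⟨hx, hadm, hne⟩ := Finset.mem_filter.mp hx
    obtain ⟨hxn, hn0⟩ := Nat.mem_divisorsAntidiagonal.mp hx
    have hnN := (Finset.mem_Icc.mp hn).2
    have h1 : x.1 ≠ 0 := fun h => hn0 (by rw [← hxn, h, zero_mul])
    have h2 : x.2 ≠ 0 := fun h => hn0 (by rw [← hxn, h, mul_zero])
    have h3 : x.1 ≤ n := Nat.le_of_dvd (Nat.pos_of_ne_zero hn0) ⟨_, hxn.symm⟩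
    have h4 : x.2 ≤ n := Nat.le_of_dvd (Nat.pos_of_ne_zero hn0) ⟨x.1, by rw [← hxn, mul_comm]⟩
    simp only [Finset.mem_filter, Finset.mem_product, Finset.mem_Icc]
    exact ⟨⟨by omega, by omega⟩, hxn.trans_le hnN, hadm, hne⟩
  · intro n _ m _ hnm
    refine Finset.disjoint_left.mpr fun x hx hx' => hnm ?_
    rw [← (Nat.mem_divisorsAntidiagonal.mp (Finset.mem_filter.mp hx).1).1,
      ← (Nat.mem_divisorsAntidiagonal.mp (Finset.mem_filter.mp hx').1).1]

/-- On average over `n`, there are `o(1)` nontrivial admissible factorizations. -/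
theorem exists_sum_admissibleCount_le {κ : ℕ} (hκ : κ = 1 ∨ κ = 2) {ε : ℝ} (hε : 0 < ε) :
    ∃ N₀ : ℕ, ∀ N : ℕ, N₀ ≤ N →
      ((∑ n ∈ Finset.Icc 1 N, admissibleCount κ n : ℕ) : ℝ) ≤ ε * N := by
  classical
  obtain ⟨K, hK, hleft⟩ := exists_block_bound_left κ
  obtain ⟨K', hK', hright⟩ := exists_block_bound_right κ
  -- the blocks from the `j`-th one on contribute at most `ε N / 2`
  obtain ⟨j, hj13, hj⟩ : ∃ j : ℕ, 13 ≤ j ∧ 2 * (K + K') * (1 / 2) ^ j ≤ ε / 2 := by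
    have ht : Filter.Tendsto (fun j : ℕ => 2 * (K + K') * (1 / 2 : ℝ) ^ j) Filter.atTop
        (nhds (2 * (K + K') * 0)) :=
      (tendsto_pow_atTop_nhds_zero_of_lt_one (by norm_num) (by norm_num)).const_mul _
    rw [mul_zero] at ht
    obtain ⟨j, h1, h2⟩ := ((Filter.eventually_ge_atTop 13).and
      (ht.eventually_le_const (half_pos hε))).exists
    exact ⟨j, h1, h2⟩
  have hblock : ∀ i, j ≤ i → 300 * i + 100 ≤ 2 ^ i := fun i hi =>
    three_hundred_mul_le_two_pow (hj13.trans hi)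
  set E := blockStart j with hE
  obtain ⟨N₁, hN₁⟩ := exists_sum_le_mul (g := fun a M => ((Finset.Icc 1 M).filter
      (Linked κ (fun p => p % 4 = 1) (fun _ => True) a)).card)
    ((Finset.range E).filter fun a => Odd a ∧ κ * a ≠ 1)
    (fun a ha δ hδ => exists_card_linked_left_le hκ (Finset.mem_filter.mp ha).2.1
      (Finset.mem_filter.mp ha).2.2 hδ) (show 0 < ε / 4 by linarith)
  obtain ⟨N₂, hN₂⟩ := exists_sum_le_mul (g := fun b M => ((Finset.Icc 1 M).filter
      (Linked κ (fun _ => True) (fun p => p % 4 = 1) b)).card) (Finset.range E)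
    (fun b _ δ hδ => exists_card_linked_right_le κ b hδ) (show 0 < ε / 4 by linarith)
  refine ⟨max N₁ N₂, fun N hN => ?_⟩
  have hsmall₁ := hN₁ N ((le_max_left _ _).trans hN)
  have hsmall₂ := hN₂ N ((le_max_right _ _).trans hN)
  have hlarge₁ := sum_blocks_le (j := j) (B := K * N) (fun i hi =>
    (hleft i (hblock i hi) N).trans_eq (by ring)) N
  have hlarge₂ := sum_blocks_le (j := j) (B := K' * N) (fun i hi =>
    (hright i (hblock i hi) N).trans_eq (by ring)) N
  rw [← Nat.cast_sum] at hlarge₁ hlarge₂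
  set S := (Finset.Icc 1 N ×ˢ Finset.Icc 1 N).filter fun x : ℕ × ℕ =>
    x.1 * x.2 ≤ N ∧ Admissible κ x.1 x.2 ∧ κ * x.1 ≠ 1 with hS
  have hmem : ∀ x ∈ S, (1 ≤ x.1 ∧ x.1 ≤ N) ∧ (1 ≤ x.2 ∧ x.2 ≤ N) ∧ x.1 * x.2 ≤ N ∧
      Admissible κ x.1 x.2 ∧ κ * x.1 ≠ 1 := fun x hx => by
    simp only [hS, Finset.mem_filter, Finset.mem_product, Finset.mem_Icc] at hx
    tauto
  have hcover : S ⊆ (S.filter fun x => x.1 < E) ∪ ((S.filter fun x => x.2 < E) ∪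
      ((S.filter fun x => E ≤ x.1 ∧ x.1 ≤ x.2) ∪ S.filter fun x => E ≤ x.2 ∧ x.2 ≤ x.1)) := by
    intro x hx
    simp only [Finset.mem_union, Finset.mem_filter, hx, true_and]
    omega
  have c1 := card_le_sum_card_of_forall_mem (S := S.filter fun x => x.1 < E)
    (s := (Finset.range E).filter fun a => Odd a ∧ κ * a ≠ 1)
    (t := fun a => (Finset.Icc 1 N).filter (Linked κ (fun p => p % 4 = 1) (fun _ => True) a))
    fun x hx => by
      obtain ⟨hxS, hxE⟩ := Finset.mem_filter.mp hx
      obtain ⟨-, h2, -, hadm, hne⟩ := hmem x hxS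
      exact ⟨Finset.mem_filter.mpr ⟨Finset.mem_range.mpr hxE, hadm.1, hne⟩,
        Finset.mem_filter.mpr ⟨Finset.mem_Icc.mpr h2, hadm.linked_left⟩⟩
  have c2 := card_le_sum_card_of_forall_mem_swap (S := S.filter fun x => x.2 < E)
    (s := Finset.range E)
    (t := fun b => (Finset.Icc 1 N).filter (Linked κ (fun _ => True) (fun p => p % 4 = 1) b))
    fun x hx => by
      obtain ⟨hxS, hxE⟩ := Finset.mem_filter.mp hx
      obtain ⟨h1, -, -, hadm, -⟩ := hmem x hxS
      exact ⟨Finset.mem_range.mpr hxE,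
        Finset.mem_filter.mpr ⟨Finset.mem_Icc.mpr h1, hadm.linked_right⟩⟩
  have c3 := card_le_sum_card_of_forall_mem (S := S.filter fun x => E ≤ x.1 ∧ x.1 ≤ x.2)
    (s := Finset.Ico (blockStart j) (blockStart (j + N)))
    (t := fun c => (Finset.Icc c (N / c)).filter
      (Linked κ (fun p => p % 4 = 1) (fun _ => True) c))
    fun x hx => by
      obtain ⟨hxS, hxE, hle⟩ := Finset.mem_filter.mp hx
      obtain ⟨h1, -, hprod, hadm, -⟩ := hmem x hxS
      exact ⟨Finset.mem_Ico.mpr ⟨hxE, h1.2.trans_lt (lt_blockStart_add j N)⟩,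
        Finset.mem_filter.mpr ⟨Finset.mem_Icc.mpr
          ⟨hle, (Nat.le_div_iff_mul_le h1.1).mpr (by rwa [mul_comm])⟩, hadm.linked_left⟩⟩
  have c4 := card_le_sum_card_of_forall_mem_swap (S := S.filter fun x => E ≤ x.2 ∧ x.2 ≤ x.1)
    (s := Finset.Ico (blockStart j) (blockStart (j + N)))
    (t := fun c => (Finset.Icc c (N / c)).filter
      (Linked κ (fun _ => True) (fun p => p % 4 = 1) c))
    fun x hx => by
      obtain ⟨hxS, hxE, hle⟩ := Finset.mem_filter.mp hx
      obtain ⟨-, h2, hprod, hadm, -⟩ := hmem x hxS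
      exact ⟨Finset.mem_Ico.mpr ⟨hxE, h2.2.trans_lt (lt_blockStart_add j N)⟩,
        Finset.mem_filter.mpr ⟨Finset.mem_Icc.mpr
          ⟨hle, (Nat.le_div_iff_mul_le h2.1).mpr hprod⟩, hadm.linked_right⟩⟩
  have hcard : S.card ≤ _ := (Finset.card_le_card hcover).trans <|
    (Finset.card_union_le _ _).trans <| add_le_add c1 <|
    (Finset.card_union_le _ _).trans <| add_le_add c2 <|
    (Finset.card_union_le _ _).trans <| add_le_add c3 c4
  have htotal := (sum_admissibleCount_le_card κ N).trans hcard
  rw [← Nat.cast_le (α := ℝ), Nat.cast_add, Nat.cast_add, Nat.cast_add] at htotal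
  have hpos : ∀ B : ℝ, 0 ≤ B → 0 ≤ 2 * (B * N) * (1 / 2) ^ (j + N) := fun B hB => by positivity
  have hN0 : (0 : ℝ) ≤ N := Nat.cast_nonneg N
  have h5 := mul_le_mul_of_nonneg_right hj hN0
  have h6 := hpos K hK
  have h7 := hpos K' hK'
  linarith

end Density

/-! ### Squarefree integers have positive lower density -/

/-- All but `∑ m / d ^ 2` of the integers up to `m` are squarefree, and the sum over `d ≥ 2` is at
most `1 / 4 + 1 / 2` times `m`. -/
theorem le_card_squarefree (m : ℕ) :
    (m : ℝ) / 4 ≤ (((Finset.Icc 1 m).filter Squarefree).card : ℝ) := by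
  classical
  have hbad : ((Finset.Icc 1 m).filter fun n => ¬Squarefree n).card ≤
      ∑ d ∈ Finset.Icc 2 m, m / d ^ 2 := by
    have hsub : ((Finset.Icc 1 m).filter fun n => ¬Squarefree n) ⊆
        (Finset.Icc 2 m).biUnion fun d => (Finset.Ioc 0 m).filter fun n => d ^ 2 ∣ n := by
      intro n hn
      obtain ⟨hn, hsq⟩ := Finset.mem_filter.mp hn
      obtain ⟨h1, h2⟩ := Finset.mem_Icc.mp hn
      rw [Nat.squarefree_iff_prime_squarefree] at hsq
      push Not at hsq
      obtain ⟨p, hp, hpn⟩ := hsq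
      have hle : p ≤ n := (Nat.le_mul_self p).trans (Nat.le_of_dvd h1 hpn)
      refine Finset.mem_biUnion.mpr ⟨p, Finset.mem_Icc.mpr ⟨hp.two_le, hle.trans h2⟩, ?_⟩
      exact Finset.mem_filter.mpr ⟨Finset.mem_Ioc.mpr ⟨h1, h2⟩, by rwa [sq]⟩
    refine (Finset.card_le_card hsub).trans (Finset.card_biUnion_le.trans ?_)
    refine Finset.sum_le_sum fun d _ => ?_
    rw [Nat.Ioc_filter_dvd_card_eq_div]
  have hsum : ∑ d ∈ Finset.Icc 2 m, (((d : ℝ) ^ 2)⁻¹) ≤ 3 / 4 := by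
    rcases lt_or_ge m 2 with hm | hm
    · rw [Finset.Icc_eq_empty (by omega), Finset.sum_empty]
      norm_num
    · have h := sum_Ioc_inv_sq_le_sub (α := ℝ) two_ne_zero hm
      rw [← Finset.add_sum_Ioc_eq_sum_Icc hm]
      have : (0 : ℝ) ≤ (m : ℝ)⁻¹ := by positivity
      norm_num at h ⊢
      linarith
  have hsplit := Finset.card_filter_add_card_filter_not (s := Finset.Icc 1 m) Squarefree
  rw [Nat.card_Icc, Nat.add_sub_cancel] at hsplit
  have h1 : (((Finset.Icc 1 m).filter fun n => ¬Squarefree n).card : ℝ) ≤ m * (3 / 4) := by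
    calc (((Finset.Icc 1 m).filter fun n => ¬Squarefree n).card : ℝ)
        ≤ ∑ d ∈ Finset.Icc 2 m, ((m / d ^ 2 : ℕ) : ℝ) := by exact_mod_cast hbad
      _ ≤ ∑ d ∈ Finset.Icc 2 m, (m : ℝ) * ((d : ℝ) ^ 2)⁻¹ := by
          refine Finset.sum_le_sum fun d _ => Nat.cast_div_le.trans_eq ?_
          rw [Nat.cast_pow, div_eq_mul_inv]
      _ = m * ∑ d ∈ Finset.Icc 2 m, ((d : ℝ) ^ 2)⁻¹ := by rw [Finset.mul_sum]
      _ ≤ m * (3 / 4) := by gcongr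
  have h2 : (((Finset.Icc 1 m).filter Squarefree).card : ℝ) +
      ((Finset.Icc 1 m).filter fun n => ¬Squarefree n).card = m := by exact_mod_cast hsplit
  linarith

/-! ### Comparison of the soluble with the locally soluble forms -/

theorem ceil_div_eight_le_card_sqfBelow {X : ℝ} (hX : 1 < X) :
    (⌈X⌉₊ : ℝ) / 8 ≤ (sqfBelow X).card := by
  obtain ⟨m, hm⟩ : ∃ m, ⌈X⌉₊ = m + 1 :=
    Nat.exists_eq_succ_of_ne_zero (Nat.ceil_pos.mpr (by linarith)).ne'
  have hm1 : 1 ≤ m := by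
    have : 1 < ⌈X⌉₊ := Nat.lt_ceil.mpr (by exact_mod_cast hX)
    omega
  have heq : sqfBelow X = (Finset.Icc 1 m).filter Squarefree := by
    ext n
    simp only [sqfBelow, hm, Finset.mem_filter, Finset.mem_range, Finset.mem_Icc]
    constructor
    · exact fun ⟨h1, h2, h3⟩ => ⟨⟨h2, by omega⟩, h3⟩
    · exact fun ⟨⟨h1, h2⟩, h3⟩ => ⟨by omega, h1, h3⟩
  have h := le_card_squarefree m
  rw [heq, hm]
  have : (1 : ℝ) ≤ m := by exact_mod_cast hm1
  push_cast
  linarith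

theorem sum_ncard_Fls_le {ε : ℝ} (hε : 0 < ε) : ∃ X₀ : ℝ, ∀ X : ℝ, X₀ ≤ X →
    ∑ n ∈ sqfBelow X, ((EvenQuartic.Fls 0 (4 * (n : ℤ) ^ 2)).ncard : ℝ) ≤
      (1 + ε) * (sqfBelow X).card := by
  obtain ⟨N₁, hN₁⟩ := exists_sum_admissibleCount_le (Or.inl rfl) (show 0 < ε / 16 by linarith)
  obtain ⟨N₂, hN₂⟩ := exists_sum_admissibleCount_le (Or.inr rfl) (show 0 < ε / 16 by linarith)
  refine ⟨max 2 (max N₁ N₂), fun X hX => ?_⟩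
  simp only [max_le_iff] at hX
  obtain ⟨hX2, hX₁, hX₂⟩ := hX
  have hceil : ∀ N : ℕ, (N : ℝ) ≤ X → N ≤ ⌈X⌉₊ := fun N hN => by
    exact_mod_cast hN.trans (Nat.le_ceil X)
  have hsub : sqfBelow X ⊆ Finset.Icc 1 ⌈X⌉₊ := fun n hn => by
    simp only [sqfBelow, Finset.mem_filter, Finset.mem_range] at hn
    exact Finset.mem_Icc.mpr ⟨hn.2.1, hn.1.le⟩
  have hle : ∑ n ∈ sqfBelow X, (EvenQuartic.Fls 0 (4 * (n : ℤ) ^ 2)).ncard ≤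
      (sqfBelow X).card + (∑ n ∈ Finset.Icc 1 ⌈X⌉₊, admissibleCount 1 n +
        ∑ n ∈ Finset.Icc 1 ⌈X⌉₊, admissibleCount 2 n) := by
    refine (Finset.sum_le_sum fun n hn => ncard_Fls_le (mem_sqfBelow.mp hn).2.2).trans ?_
    rw [Finset.sum_add_distrib, Finset.sum_add_distrib, Finset.sum_const, smul_eq_mul, mul_one]
    gcongr
  have hle' : ∑ n ∈ sqfBelow X, ((EvenQuartic.Fls 0 (4 * (n : ℤ) ^ 2)).ncard : ℝ) ≤
      (sqfBelow X).card + (((∑ n ∈ Finset.Icc 1 ⌈X⌉₊, admissibleCount 1 n : ℕ) : ℝ) +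
        ((∑ n ∈ Finset.Icc 1 ⌈X⌉₊, admissibleCount 2 n : ℕ) : ℝ)) := by
    exact_mod_cast hle
  have h1 := hN₁ _ (hceil _ hX₁)
  have h2 := hN₂ _ (hceil _ hX₂)
  have h3 := mul_le_mul_of_nonneg_left
    (ceil_div_eight_le_card_sqfBelow (X := X) (by linarith)) hε.le
  linarith

theorem theorem4p2 :
    Filter.Tendsto
      (fun X : ℝ =>
        (∑ n ∈ sqfBelow X, ((EvenQuartic.Fsol 0 (4 * (n : ℤ) ^ 2)).ncard : ℝ)) /
          (∑ n ∈ sqfBelow X, ((EvenQuartic.Fls 0 (4 * (n : ℤ) ^ 2)).ncard : ℝ)))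
      Filter.atTop (nhds 1) := by
  have hne : ∀ {X : ℝ} {n : ℕ}, n ∈ sqfBelow X → n ≠ 0 := fun hn =>
    (mem_sqfBelow.mp hn).1.ne'
  have hsol : ∀ X : ℝ, ((sqfBelow X).card : ℝ) ≤
      ∑ n ∈ sqfBelow X, ((EvenQuartic.Fsol 0 (4 * (n : ℤ) ^ 2)).ncard : ℝ) := fun X => by
    rw [← nsmul_one]
    exact Finset.card_nsmul_le_sum _ _ _ fun n hn => by exact_mod_cast one_le_ncard_Fsol (hne hn)
  have hls : ∀ X : ℝ, ∑ n ∈ sqfBelow X, ((EvenQuartic.Fsol 0 (4 * (n : ℤ) ^ 2)).ncard : ℝ) ≤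
      ∑ n ∈ sqfBelow X, ((EvenQuartic.Fls 0 (4 * (n : ℤ) ^ 2)).ncard : ℝ) := fun X =>
    Finset.sum_le_sum fun n hn => by exact_mod_cast ncard_Fsol_le_ncard_Fls (hne hn)
  rw [Metric.tendsto_atTop]
  intro ε hε
  obtain ⟨X₀, hX₀⟩ := sum_ncard_Fls_le (half_pos hε)
  refine ⟨max X₀ 2, fun X hX => ?_⟩
  obtain ⟨hX0, hX2⟩ := max_le_iff.mp hX
  have hcard : (0 : ℝ) < (sqfBelow X).card := by
    have h := ceil_div_eight_le_card_sqfBelow (X := X) (by linarith)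
    have : (0 : ℝ) < ⌈X⌉₊ := by exact_mod_cast Nat.ceil_pos.mpr (by linarith)
    linarith
  have h1 := hsol X
  have h2 := hls X
  have h3 := hX₀ X hX0
  set s := ∑ n ∈ sqfBelow X, ((EvenQuartic.Fsol 0 (4 * (n : ℤ) ^ 2)).ncard : ℝ)
  set l := ∑ n ∈ sqfBelow X, ((EvenQuartic.Fls 0 (4 * (n : ℤ) ^ 2)).ncard : ℝ)
  have hl : 0 < l := by linarith
  rw [Real.dist_eq, abs_sub_lt_iff]
  constructor
  · have := (div_le_one hl).mpr h2
    linarith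
  · have : 1 - ε < s / l := by
      rw [lt_div_iff₀ hl]
      nlinarith
    linarith
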